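/- Let $\mathbb D=\{z\in\mathbb C:|z|<1\}$. Let $\mathcal C$ be the class of close-to-convex functions, that is, of holomorphic $f:\mathbb D\to\mathbb C$ with $f(0)=0$, $f'(0)=1$ for which there is a univalent holomorphic function $g$ on $\mathbb D$ with convex image $g(\mathbb D)$ (not necessarily normalized) such that $\operatorname{Re}\,(f'(z)/g'(z))>0$ on $\mathbb D$. Such an $f$ is univalent; let $\log[f(z)/z]$ be the holomorphic branch on $\mathbb D$ that vanishes at $z=0$, and for $c\in\mathbb C$ let $$f_c(z)=z\left(\frac{f(z)}z\right)^c=z\exp\bigl(c\log[f(z)/z]\bigr),$$ where $f_c(z)/z$ is given its limit $1$ at $z=0$. **Theorem.** The equation $$2b\left(\arctan b-\arctan\frac{3b}{\sqrt{1-8b^2}}+\pi\right)=\log\left(5-4b^2+3\sqrt{1-8b^2}\right)-\log 2$$ has exactly one solution $b_0$ in the interval $0<b<\frac1{2\sqrt2}$, and $b_0=0.24001\dots$, that is, $0.24001\le b_0<0.24002$. Let $c=a+bi$ with $a,b\in\mathbb R$. If $a>0$, then $$\inf_{f\in\mathcal C,\ z\in\mathbb D}\log\left|\frac{f_c(z)}z\right|=\begin{cases}-\dfrac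 a2\log\dfrac{2\left(5a^2-4b^2+3a\sqrt{a^2-8b^2}\right)}{a^2+b^2}-b\arctan\dfrac{3b}{\sqrt{a^2-8b^2}}&\text{if }\left|\dfrac ba\right|\le b_0,\\[3mm]\dfrac a2\log(a^2+b^2)-a\log(2a)-|b|\left(\arctan\left|\dfrac ba\right|+\pi\right)&\text{if }\left|\dfrac ba\right|\ge b_0.\end{cases}$$ If $a<0$, then $$\sup_{f\in\mathcal C,\ z\in\mathbb D}\log\left|\frac{f_c(z)}z\right|=\begin{cases}-\dfrac a2\log\dfrac{2\left(5a^2-4b^2+3|a|\sqrt{a^2-8b^2}\right)}{a^2+b^2}+b\arctan\dfrac{3b}{\sqrt{a^2-8b^2}}&\text{if }\left|\dfrac ba\right|\le b_0,\\[3mm]\dfrac a2\log(a^2+b^2)-a\log(2|a|)+|b|\left(\arctan\left|\dfrac ba\right|+\pi\right)&\text{if }\left|\dfrac ba\right|\ge b_0.\end{cases}$$ -/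

import Mathlib

open Complex Metric Set

namespace PowerDeformation

/-- The class `𝒜`: functions holomorphic on the open unit disk with `f 0 = 0` and `f' 0 = 1`.
(Only the values on the disk matter.) -/
structure IsNormalizedAnalytic (f : ℂ → ℂ) : Prop where
  differentiableOn : DifferentiableOn ℂ f (ball 0 1)
  map_zero : f 0 = 0
  deriv_zero : deriv f 0 = 1

/-- A convex function on the unit disk (not necessarily normalized): a univalent holomorphic
function whose image is a convex domain. -/
structure IsConvexFunction (g : ℂ → ℂ) : Prop where
  differentiableOn : DifferentiableOn ℂ g (ball 0 1)
  injOn : InjOn g (ball 0 1)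
  convex_image : Convex ℝ (g '' ball 0 1)

/-- Close-to-convex (equivalently, linearly accessible) functions: `f ∈ 𝒜` such that
`Re (f' / g') > 0` on the unit disk for some convex function `g`, which need not be
normalized. Such an `f` is automatically univalent, see `IsCloseToConvex.injOn`. -/
structure IsCloseToConvex (f : ℂ → ℂ) : Prop extends IsNormalizedAnalytic f where
  exists_convex : ∃ g : ℂ → ℂ, IsConvexFunction g ∧
    ∀ z ∈ ball (0 : ℂ) 1, 0 < (deriv f z / deriv g z).re

/-- The quotient `f z / z` of a function with `f 0 = 0`, with its removable singularity
at the origin filled in by the value `f' 0`. -/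
noncomputable def quotient (f : ℂ → ℂ) (z : ℂ) : ℂ := dslope f 0 z

/-- `g` is the holomorphic branch of `log (f z / z)` on the unit disk with `g 0 = 0`. -/
structure IsLogQuotient (f g : ℂ → ℂ) : Prop where
  differentiableOn : DifferentiableOn ℂ g (ball 0 1)
  map_zero : g 0 = 0
  exp_eq : ∀ z ∈ ball (0 : ℂ) 1, exp (g z) = quotient f z

/-- The branch of `log (f z / z)` that vanishes at the origin. For a normalized univalent `f`
it exists and is unique on the disk: `isLogQuotient_logQuotient`, `IsLogQuotient.eqOn`. -/
noncomputable def logQuotient (f : ℂ → ℂ) : ℂ → ℂ := Classical.epsilon (IsLogQuotient f)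

/-- The power deformation `f_c z = z (f z / z) ^ c = z exp (c log (f z / z))`. -/
noncomputable def powerDeformation (c : ℂ) (f : ℂ → ℂ) (z : ℂ) : ℂ :=
  z * exp (c * logQuotient f z)

/-- All values `log |f_c z / z|`, for `f` close-to-convex and `z` in the unit disk. -/
def logModulusValues (c : ℂ) : Set ℝ :=
  {x | ∃ f : ℂ → ℂ, IsCloseToConvex f ∧ ∃ z ∈ ball (0 : ℂ) 1,
    x = Real.log ‖quotient (powerDeformation c f) z‖}

theorem quotient_of_ne_zero {f : ℂ → ℂ} (h0 : f 0 = 0) {z : ℂ} (hz : z ≠ 0) :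
    quotient f z = f z / z := by
  simp [quotient, dslope_of_ne _ hz, slope_def_field, h0]

theorem IsNormalizedAnalytic.quotient_zero {f : ℂ → ℂ} (hf : IsNormalizedAnalytic f) :
    quotient f 0 = 1 := by
  simp [quotient, hf.deriv_zero]

/-- A close-to-convex function is univalent. -/
theorem IsCloseToConvex.injOn {f : ℂ → ℂ} (hf : IsCloseToConvex f) :
    InjOn f (ball 0 1) := by
  obtain ⟨g, hg, hre⟩ := hf.exists_convex
  have hG : ∀ z ∈ ball (0 : ℂ) 1, Function.invFunOn g (ball 0 1) (g z) = z := fun z hz =>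
    hg.injOn.leftInvOn_invFunOn hz
  set G := Function.invFunOn g (ball 0 1) with hGdef
  have hder : ∀ z ∈ ball (0 : ℂ) 1,
      HasDerivAt (fun w => f (G w)) (deriv f z / deriv g z) (g z) := by
    intro z hz
    have hnhds : ball (0 : ℂ) 1 ∈ nhds z := isOpen_ball.mem_nhds hz
    have hne : deriv g z ≠ 0 := by
      intro h
      have := hre z hz
      simp [h] at this
    have hs : HasStrictDerivAt g (deriv g z) z :=
      (hg.differentiableOn.analyticAt hnhds).hasStrictDerivAt
    have hmap := hs.map_nhds_eq hne
    have hev : ∀ᶠ y in nhds z, G (g y) = y := by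
      filter_upwards [hnhds] with y hy using hG y hy
    have hcont : ContinuousAt G (g z) := by
      rw [ContinuousAt, hG z hz, ← hmap, Filter.tendsto_map'_iff]
      exact Filter.tendsto_id.congr' (by filter_upwards [hev] with y hy using hy.symm)
    have hinv : ∀ᶠ w in nhds (g z), g (G w) = w := by
      rw [← hmap, Filter.eventually_map]
      filter_upwards [hev] with y hy
      rw [hy]
    have hGd : HasDerivAt G (deriv g z)⁻¹ (g z) := by
      refine HasDerivAt.of_local_left_inverse hcont ?_ hne hinv
      rw [hG z hz]
      exact hs.hasDerivAt
    have hfd : HasDerivAt f (deriv f z) (G (g z)) := by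
      rw [hG z hz]
      exact (hf.differentiableOn.differentiableAt hnhds).hasDerivAt
    rw [div_eq_mul_inv]
    exact hfd.comp (g z) hGd
  intro z₁ h₁ z₂ h₂ heq
  by_contra hne
  have hw : g z₂ - g z₁ ≠ 0 := fun h => hne (hg.injOn h₁ h₂ (sub_eq_zero.mp h).symm)
  set d := g z₂ - g z₁ with hd
  let φ : ℝ → ℝ := fun t => (f (G (g z₁ + (t : ℂ) * d)) / d).re
  have hφ : ∀ t ∈ Icc (0 : ℝ) 1, ∃ p : ℝ, 0 < p ∧ HasDerivAt φ p t := by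
    intro t ht
    have hmem : g z₁ + (t : ℂ) * d ∈ g '' ball 0 1 := by
      have := hg.convex_image.add_smul_sub_mem (mem_image_of_mem g h₁)
        (mem_image_of_mem g h₂) ht
      simpa [Complex.real_smul] using this
    obtain ⟨z, hz, hgz⟩ := hmem
    refine ⟨_, hre z hz, ?_⟩
    have h1 := hder z hz
    rw [hgz] at h1
    have h2 : HasDerivAt (fun s : ℂ => g z₁ + s * d) d (t : ℂ) := by
      simpa using ((hasDerivAt_id (t : ℂ)).mul_const d).const_add (g z₁)
    have h3 := ((h1.comp (t : ℂ) h2).div_const d).real_of_complex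
    rw [mul_div_cancel_right₀ _ hw] at h3
    exact h3
  have hmono : StrictMonoOn φ (Icc 0 1) := by
    refine strictMonoOn_of_deriv_pos (convex_Icc 0 1) ?_ ?_
    · intro t ht
      obtain ⟨p, -, hp⟩ := hφ t ht
      exact hp.continuousAt.continuousWithinAt
    · intro t ht
      obtain ⟨p, hpos, hp⟩ := hφ t (interior_subset ht)
      rwa [hp.deriv]
  have hlt := hmono (left_mem_Icc.mpr zero_le_one) (right_mem_Icc.mpr zero_le_one) zero_lt_one
  have e0 : φ 0 = (f z₁ / d).re := by simp [φ, hG z₁ h₁]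
  have e1 : φ 1 = (f z₂ / d).re := by simp [φ, hd, hG z₂ h₂]
  rw [e0, e1, heq] at hlt
  exact lt_irrefl _ hlt

/-- The normalized branch of `log (f z / z)` exists for a normalized univalent function. -/
theorem exists_isLogQuotient {f : ℂ → ℂ} (hf : IsNormalizedAnalytic f)
    (hinj : InjOn f (ball 0 1)) : ∃ g, IsLogQuotient f g := by
  have h0 : (0 : ℂ) ∈ ball (0 : ℂ) 1 := mem_ball_self one_pos
  have hq : DifferentiableOn ℂ (quotient f) (ball 0 1) :=
    (Complex.differentiableOn_dslope (isOpen_ball.mem_nhds h0)).mpr hf.differentiableOn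
  have hne : ∀ z ∈ ball (0 : ℂ) 1, quotient f z ≠ 0 := by
    intro z hz
    by_cases h : z = 0
    · simp [h, hf.quotient_zero]
    · rw [quotient_of_ne_zero hf.map_zero h]
      refine div_ne_zero (fun hfz => h (hinj hz h0 ?_)) h
      rw [hfz, hf.map_zero]
  have hqd : ∀ z ∈ ball (0 : ℂ) 1, HasDerivAt (quotient f) (deriv (quotient f) z) z :=
    fun z hz => (hq.differentiableAt (isOpen_ball.mem_nhds hz)).hasDerivAt
  obtain ⟨g, hg0, hg⟩ := DifferentiableOn.isExactOn_ball
    ((hq.deriv isOpen_ball).div hq hne) |>.with_val_at 0 0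
  refine ⟨g, fun z hz => (hg z hz).differentiableAt.differentiableWithinAt, hg0, ?_⟩
  have hconst : ∀ z ∈ ball (0 : ℂ) 1, HasDerivAt (fun w => exp (-g w) * quotient f w) 0 z := by
    intro z hz
    have hgz := hg z hz
    have h := (hgz.neg.cexp).mul (hqd z hz)
    refine h.congr_deriv ?_
    have := hne z hz
    simp only [Pi.div_apply, Pi.neg_apply]
    field_simp
    ring
  intro z hz
  have hc := (convex_ball (0 : ℂ) 1).is_const_of_fderivWithin_eq_zero (𝕜 := ℂ)
    (f := fun w => exp (-g w) * quotient f w)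
    (fun w hw => (hconst w hw).differentiableAt.differentiableWithinAt)
    (fun w hw => by
      rw [fderivWithin_of_isOpen isOpen_ball hw]
      ext
      simp [(hconst w hw).deriv]) hz h0
  simp only [hg0, hf.quotient_zero, neg_zero, exp_zero, mul_one, exp_neg] at hc
  have hexp := exp_ne_zero (g z)
  field_simp at hc
  exact hc.symm

theorem isLogQuotient_logQuotient {f : ℂ → ℂ} (hf : IsNormalizedAnalytic f)
    (hinj : InjOn f (ball 0 1)) : IsLogQuotient f (logQuotient f) :=
  Classical.epsilon_spec (exists_isLogQuotient hf hinj)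

/-- The normalized branch of `log (f z / z)` is unique on the disk. -/
theorem IsLogQuotient.eqOn {f g₁ g₂ : ℂ → ℂ} (h₁ : IsLogQuotient f g₁)
    (h₂ : IsLogQuotient f g₂) : EqOn g₁ g₂ (ball 0 1) := by
  have hder : ∀ w ∈ ball (0 : ℂ) 1, HasDerivAt (fun w => g₁ w - g₂ w) 0 w := by
    intro w hw
    have hn := isOpen_ball.mem_nhds hw
    have d₁ := (h₁.differentiableOn.differentiableAt hn).hasDerivAt
    have d₂ := (h₂.differentiableOn.differentiableAt hn).hasDerivAt
    have he : (fun w => exp (g₁ w)) =ᶠ[nhds w] fun w => exp (g₂ w) := by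
      filter_upwards [hn] with y hy
      rw [h₁.exp_eq y hy, h₂.exp_eq y hy]
    have hu := (d₁.cexp.congr_of_eventuallyEq he.symm).unique d₂.cexp
    have hew : exp (g₁ w) = exp (g₂ w) := he.eq_of_nhds
    rw [hew] at hu
    have := mul_left_cancel₀ (exp_ne_zero (g₂ w)) hu
    exact (d₁.sub d₂).congr_deriv (by rw [this, sub_self])
  intro z hz
  have hc := (convex_ball (0 : ℂ) 1).is_const_of_fderivWithin_eq_zero (𝕜 := ℂ)
    (f := fun w => g₁ w - g₂ w)
    (fun w hw => (hder w hw).differentiableAt.differentiableWithinAt)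
    (fun w hw => by
      rw [fderivWithin_of_isOpen isOpen_ball hw]
      ext
      simp [(hder w hw).deriv]) hz (mem_ball_self one_pos)
  simp only [h₁.map_zero, h₂.map_zero, sub_zero] at hc
  exact sub_eq_zero.mp hc

/-- The equation that determines the threshold `b₀`. -/
def ThresholdEquation (b : ℝ) : Prop :=
  2 * b * (Real.arctan b - Real.arctan (3 * b / √(1 - 8 * b ^ 2)) + Real.pi) =
    Real.log (5 - 4 * b ^ 2 + 3 * √(1 - 8 * b ^ 2)) - Real.log 2

end PowerDeformation

/-!
Write `w = f z / z`, `L = logQuotient f z` and `c = a + b i`, so that `log |f_c z / z| = Re (c L)`.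
Dividing by `a`, with a change of sign and of infimum into supremum when `a < 0`, and replacing `f`
by its conjugate, one has to minimize `Re L - b Im L` for `b ≥ 0` over the variability region of `L`.

The region is found from a convolution argument of Ruscheweyh-Sheil-Small type. Let `g` be a convex
function with `Re (f' / g') > 0` and let `ζ = (g z - g 0) / (z g' 0)`. For `|κ| ≤ 1 / 3` the kernel
`v (1 + κ v) / (1 - v)` is starlike, and the quotient of the Hadamard products of `f` and `g` with it
has positive real part (`IsConvexFunction.re_kernelOp_div_pos`). By the Herglotz representation of
`f' / g'` it is enough to treat `f' = ((1 + u) / (1 - u) + τ i) g'`, and there the Hadamard product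
does not vanish (`kernelOp_ne_zero`): it is the integral over the circle of a kernel whose argument
is monotone, against a real function which, because `g` is convex, has at most one turning point;
such an integral cannot vanish (`RotatingKernel.integral_ne_zero_of_hasDerivAt`).
Explicitly, `((1 + κ) w - κ) / ((1 + κ) ζ - κ)` takes values in a fixed half-plane, and `Re ζ ≥ 1 / 2`
by the Marx-Strohhäcker theorem (`IsConvexFunction.half_le_re_div`). Hence `(1 + κ) w ≠ κ` for all
these `κ`, which says `|1 / w - 1| < 3`; and following the arguments for `κ = -1 / 3` shows that
`|Im L| ≥ π` is possible only for `|Im L| < 3 π / 2` and `Re w < -1 / 2`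
(`IsCloseToConvex.logQuotient_mem`).

Minimizing `Re L - b Im L` along the curves `|1 / w - 1| = 3` and `Re w = -1 / 2` gives the values
`innerBound b` and `outerBound b` (`bounds_le_sub_mul`), whose difference `thresholdFun b` is strictly
increasing and vanishes exactly at the solution `b₀` of the threshold equation. Both values are limits
along the boundary for the slit mappings `extremalFun`, which are close-to-convex (`le_innerBound`,
`le_outerBound`).
-/

namespace PowerDeformation

/-! ### Convex functions on the disk -/

/-- The inverse of a convex function is holomorphic along its values. -/
theorem IsConvexFunction.hasDerivAt_invFunOn {g : ℂ → ℂ} (hg : IsConvexFunction g)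
    (hne : ∀ z ∈ ball (0 : ℂ) 1, deriv g z ≠ 0) {z : ℂ} (hz : z ∈ ball (0 : ℂ) 1) :
    HasDerivAt (Function.invFunOn g (ball 0 1)) (deriv g z)⁻¹ (g z) := by
  have hG : ∀ z ∈ ball (0 : ℂ) 1, Function.invFunOn g (ball 0 1) (g z) = z := fun z hz =>
    hg.injOn.leftInvOn_invFunOn hz
  have hnhds : ball (0 : ℂ) 1 ∈ nhds z := isOpen_ball.mem_nhds hz
  have hs : HasStrictDerivAt g (deriv g z) z :=
    (hg.differentiableOn.analyticAt hnhds).hasStrictDerivAt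
  have hmap := hs.map_nhds_eq (hne z hz)
  have hcont : ContinuousAt (Function.invFunOn g (ball 0 1)) (g z) := by
    rw [ContinuousAt, hG z hz, ← hmap, Filter.tendsto_map'_iff]
    exact Filter.tendsto_id.congr' (by filter_upwards [hnhds] with y hy using (hG y hy).symm)
  have hinv : ∀ᶠ w in nhds (g z), g (Function.invFunOn g (ball 0 1) w) = w := by
    rw [← hmap, Filter.eventually_map]
    filter_upwards [hnhds] with y hy
    rw [hG y hy]
  refine HasDerivAt.of_local_left_inverse hcont ?_ (hne z hz) hinv
  rw [hG z hz]
  exact hs.hasDerivAt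

/-- The image of a closed disk `‖u‖ ≤ ‖ξ‖` under a convex function lies in the half-plane
bounded by the tangent at `g ξ`. -/
theorem IsConvexFunction.support {g : ℂ → ℂ} (hg : IsConvexFunction g)
    (hne : ∀ z ∈ ball (0 : ℂ) 1, deriv g z ≠ 0) {ξ u : ℂ} (hξ : ξ ∈ ball (0 : ℂ) 1)
    (hξ0 : ξ ≠ 0) (hu : ‖u‖ ≤ ‖ξ‖) :
    0 ≤ ((g ξ - g u) / (ξ * deriv g ξ)).re := by
  set G := Function.invFunOn g (ball 0 1)
  have hξ1 : ‖ξ‖ < 1 := by simpa using hξ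
  have hξpos : 0 < ‖ξ‖ := norm_pos_iff.mpr hξ0
  have hrot : ∀ z ∈ ball (0 : ℂ) 1, u / ξ * z ∈ ball (0 : ℂ) 1 := by
    intro z hz
    have hz1 : ‖z‖ < 1 := by simpa using hz
    have h1 : ‖u / ξ‖ ≤ 1 := by rw [norm_div]; exact div_le_one_of_le₀ hu hξpos.le
    have : ‖u / ξ * z‖ ≤ ‖z‖ := by
      rw [norm_mul]; exact mul_le_of_le_one_left (norm_nonneg _) h1
    simpa using this.trans_lt hz1
  have hmem : ∀ e ∈ Icc (0 : ℝ) 1, ∀ z ∈ ball (0 : ℂ) 1,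
      g z + (e : ℂ) * (g (u / ξ * z) - g z) ∈ g '' ball 0 1 := by
    intro e he z hz
    have := hg.convex_image.add_smul_sub_mem (mem_image_of_mem g hz)
      (mem_image_of_mem g (hrot z hz)) he
    simpa [Complex.real_smul] using this
  have h0 : (0 : ℂ) ∈ ball (0 : ℂ) 1 := mem_ball_self one_pos
  have hbound : ∀ e ∈ Icc (0 : ℝ) 1, ‖G (g ξ + (e : ℂ) * (g u - g ξ))‖ ≤ ‖ξ‖ := by
    intro e he
    set Ψ : ℂ → ℂ := fun z => G (g z + (e : ℂ) * (g (u / ξ * z) - g z)) with hΨ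
    have hd : DifferentiableOn ℂ Ψ (ball 0 1) := by
      intro z hz
      obtain ⟨v, hv, hgv⟩ := hmem e he z hz
      have hGd := hg.hasDerivAt_invFunOn hne hv
      rw [hgv] at hGd
      have hgz := (hg.differentiableOn.differentiableAt (isOpen_ball.mem_nhds hz))
      have hgz' := (hg.differentiableOn.differentiableAt (isOpen_ball.mem_nhds (hrot z hz)))
      have hin : DifferentiableAt ℂ (fun z => g z + (e : ℂ) * (g (u / ξ * z) - g z)) z := by
        have h2 : DifferentiableAt ℂ (fun z => g (u / ξ * z)) z :=
          DifferentiableAt.comp z hgz' (by fun_prop)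
        exact hgz.add ((h2.sub hgz).const_mul _)
      exact (DifferentiableAt.comp z hGd.differentiableAt hin).differentiableWithinAt
    have hmaps : MapsTo Ψ (ball 0 1) (closedBall 0 1) := by
      intro z hz
      exact ball_subset_closedBall (Function.invFunOn_mem (by
        obtain ⟨v, hv, hgv⟩ := hmem e he z hz; exact ⟨v, hv, hgv⟩))
    have hΨ0 : Ψ 0 = 0 := by
      simp only [hΨ, mul_zero, sub_self, add_zero]
      exact hg.injOn.leftInvOn_invFunOn h0
    have := Complex.norm_le_norm_of_mapsTo_ball hd hmaps hΨ0 hξ1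
    simpa [hΨ, hξ0] using this
  -- differentiate `‖G (g ξ + e (g u - g ξ))‖ ^ 2 ≤ ‖ξ‖ ^ 2` at `e = 0`
  set d := g u - g ξ with hd
  have hGξ : G (g ξ) = ξ := hg.injOn.leftInvOn_invFunOn hξ
  have hder : HasDerivAt (fun e : ℝ => (G (g ξ + (e : ℂ) * d) / ξ).re)
      ((deriv g ξ)⁻¹ * d / ξ).re 0 := by
    have h1 := hg.hasDerivAt_invFunOn hne hξ
    have h2 : HasDerivAt (fun s : ℂ => g ξ + s * d) d ((0 : ℝ) : ℂ) := by
      simpa using ((hasDerivAt_id ((0 : ℝ) : ℂ)).mul_const d).const_add (g ξ)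
    have h3 : HasDerivAt G (deriv g ξ)⁻¹ (g ξ + ((0 : ℝ) : ℂ) * d) := by simpa using h1
    exact ((h3.comp ((0 : ℝ) : ℂ) h2).div_const ξ).real_of_complex
  have hle : ∀ e ∈ Icc (0 : ℝ) 1, (G (g ξ + (e : ℂ) * d) / ξ).re ≤ 1 := by
    intro e he
    refine (Complex.re_le_norm _).trans ?_
    rw [norm_div]
    exact div_le_one_of_le₀ (hbound e he) hξpos.le
  have hneg : ((deriv g ξ)⁻¹ * d / ξ).re ≤ 0 := by
    by_contra hpos
    push Not at hpos
    have hlim := (hasDerivAt_iff_tendsto_slope.mp hder).mono_left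
      (nhdsWithin_mono (0 : ℝ) (fun x (hx : x ∈ Ioi (0 : ℝ)) => (ne_of_gt hx : x ≠ 0)))
    have hev := hlim.eventually (lt_mem_nhds hpos)
    have hev2 : ∀ᶠ e in nhdsWithin (0 : ℝ) (Ioi 0), e ∈ Ioc (0 : ℝ) 1 :=
      Ioc_mem_nhdsGT one_pos
    obtain ⟨e, he1, he2⟩ := (hev.and hev2).exists
    have h4 := hle e ⟨he2.1.le, he2.2⟩
    simp only [slope_def_field, ofReal_zero, zero_mul, add_zero, hGξ, sub_zero,
      div_self hξ0, one_re] at he1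
    have := (div_pos_iff_of_pos_right he2.1).mp he1
    linarith
  have heq : (g ξ - g u) / (ξ * deriv g ξ) = -((deriv g ξ)⁻¹ * d / ξ) := by
    have := hne ξ hξ
    rw [hd]; field_simp; ring
  rw [heq, neg_re]
  linarith

/-- Rotation by small positive angles approaches a nonzero point without meeting it. -/
theorem tendsto_mul_exp_nhdsNE {ξ : ℂ} (hξ0 : ξ ≠ 0) :
    Filter.Tendsto (fun t : ℝ => ξ * exp (t * I)) (nhdsWithin 0 (Ioi 0)) (nhdsWithin ξ {ξ}ᶜ) := by
  refine tendsto_nhdsWithin_iff.mpr ⟨?_, ?_⟩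
  · have : ContinuousAt (fun t : ℝ => ξ * exp (t * I)) 0 := by fun_prop
    have h := this.tendsto
    simp only [ofReal_zero, zero_mul, exp_zero, mul_one] at h
    exact h.mono_left nhdsWithin_le_nhds
  · filter_upwards [Ioo_mem_nhdsGT (show (0 : ℝ) < Real.pi from Real.pi_pos)] with t ht h
    have h1 : exp (t * I) = 1 := by
      have h' : ξ * exp (t * I) = ξ := h
      exact mul_left_cancel₀ hξ0 (by rw [h', mul_one])
    have h2 := congrArg Complex.im h1
    rw [exp_ofReal_mul_I_im, one_im] at h2
    exact (Real.sin_pos_of_pos_of_lt_pi ht.1 ht.2).ne' h2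

/-- The logarithmic derivative of the boundary tangent of a convex function is nonnegative. -/
theorem IsConvexFunction.re_one_add_nonneg {g : ℂ → ℂ} (hg : IsConvexFunction g)
    (hne : ∀ z ∈ ball (0 : ℂ) 1, deriv g z ≠ 0) {ξ : ℂ} (hξ : ξ ∈ ball (0 : ℂ) 1) :
    0 ≤ (1 + ξ * deriv (deriv g) ξ / deriv g ξ).re := by
  rcases eq_or_ne ξ 0 with rfl | hξ0
  · simp
  have hd2 : DifferentiableOn ℂ (deriv g) (ball 0 1) := hg.differentiableOn.deriv isOpen_ball
  have hn := isOpen_ball.mem_nhds hξ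
  have hgd := (hg.differentiableOn.differentiableAt hn).hasDerivAt
  have hgd2 := (hd2.differentiableAt hn).hasDerivAt
  have hσ : HasDerivAt (fun z => z * deriv g z) (1 * deriv g ξ + ξ * deriv (deriv g) ξ) ξ :=
    (hasDerivAt_id ξ).mul hgd2
  -- compare the supporting half-planes at `ξ` and at a nearby point of the same circle
  have hquot : ∀ x : ℂ, ‖x‖ = ‖ξ‖ → x ≠ ξ →
      0 ≤ (slope (fun z => z * deriv g z) ξ x / slope g ξ x).re := by
    intro x hx hxξ
    have hx0 : x ≠ 0 := by rw [← norm_pos_iff, hx]; exact norm_pos_iff.mpr hξ0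
    have hxb : x ∈ ball (0 : ℂ) 1 := by
      have : ‖ξ‖ < 1 := by simpa using hξ
      simpa [hx] using this
    have hgne : g x - g ξ ≠ 0 := fun h => hxξ (hg.injOn hxb hξ (sub_eq_zero.mp h))
    have h1 := hg.support hne hξ hξ0 hx.le
    have h2 := hg.support hne hxb hx0 hx.ge
    have hinv : ∀ w : ℂ, 0 ≤ w.re → 0 ≤ (w⁻¹).re := by
      intro w hw
      rw [inv_re]; exact div_nonneg hw (normSq_nonneg _)
    have h3 := add_nonneg (hinv _ h1) (hinv _ h2)
    rw [← add_re] at h3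
    have : slope (fun z => z * deriv g z) ξ x / slope g ξ x =
        ((g ξ - g x) / (ξ * deriv g ξ))⁻¹ + ((g x - g ξ) / (x * deriv g x))⁻¹ := by
      rw [slope_def_field, slope_def_field]
      have hxx : x - ξ ≠ 0 := sub_ne_zero.mpr hxξ
      rw [inv_div, inv_div, ← neg_sub (g x) (g ξ)]
      field_simp
      ring
    rwa [this]
  have hlim : Filter.Tendsto (fun x => (slope (fun z => z * deriv g z) ξ x / slope g ξ x).re)
      (nhdsWithin ξ {ξ}ᶜ) (nhds ((1 * deriv g ξ + ξ * deriv (deriv g) ξ) / deriv g ξ).re) :=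
    (continuous_re.tendsto _).comp
      ((hasDerivAt_iff_tendsto_slope.mp hσ).div (hasDerivAt_iff_tendsto_slope.mp hgd) (hne ξ hξ))
  have harc := tendsto_mul_exp_nhdsNE hξ0
  have heq : 1 + ξ * deriv (deriv g) ξ / deriv g ξ =
      (1 * deriv g ξ + ξ * deriv (deriv g) ξ) / deriv g ξ := by
    have := hne ξ hξ
    field_simp
  rw [heq]
  refine ge_of_tendsto (hlim.comp harc) ?_
  have hmem : ∀ᶠ t : ℝ in nhdsWithin 0 (Ioi 0), ξ * exp (t * I) ∈ ({ξ}ᶜ : Set ℂ) :=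
    (tendsto_nhdsWithin_iff.mp harc).2
  filter_upwards [hmem] with t ht
  exact hquot _ (by simp [norm_exp_ofReal_mul_I]) ht

/-- A holomorphic function on the disk with nonnegative real part that is positive at the
origin has positive real part. -/
theorem re_pos_of_re_nonneg {E : ℂ → ℂ} (hE : DifferentiableOn ℂ E (ball 0 1))
    (h : ∀ z ∈ ball (0 : ℂ) 1, 0 ≤ (E z).re) (h0 : 0 < (E 0).re) {z : ℂ}
    (hz : z ∈ ball (0 : ℂ) 1) : 0 < (E z).re := by
  rcases (hE.analyticOnNhd isOpen_ball).is_constant_or_isOpen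
    (convex_ball (0 : ℂ) 1).isPreconnected with ⟨w, hw⟩ | hopen
  · rw [hw z hz, ← hw 0 (mem_ball_self one_pos)]; exact h0
  · have hO := hopen (ball 0 1) subset_rfl isOpen_ball
    refine lt_of_le_of_ne (h z hz) fun hzero => ?_
    obtain ⟨ε, hε, hsub⟩ := Metric.isOpen_iff.mp hO (E z) (mem_image_of_mem E hz)
    have hmem : E z - (ε / 2 : ℝ) ∈ ball (E z) ε := by
      rw [mem_ball, dist_eq_norm, sub_sub_cancel_left, norm_neg, norm_real, Real.norm_eq_abs,
        abs_of_pos (by linarith)]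
      linarith
    obtain ⟨v, hv, hEv⟩ := hsub hmem
    have := h v hv
    rw [hEv, sub_re, ofReal_re, ← hzero] at this
    linarith

theorem IsConvexFunction.re_one_add_pos {g : ℂ → ℂ} (hg : IsConvexFunction g)
    (hne : ∀ z ∈ ball (0 : ℂ) 1, deriv g z ≠ 0) {ξ : ℂ} (hξ : ξ ∈ ball (0 : ℂ) 1) :
    0 < (1 + ξ * deriv (deriv g) ξ / deriv g ξ).re := by
  refine re_pos_of_re_nonneg (E := fun ξ => 1 + ξ * deriv (deriv g) ξ / deriv g ξ) ?_
    (fun z hz => hg.re_one_add_nonneg hne hz) (by simp) hξ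
  have hd2 : DifferentiableOn ℂ (deriv g) (ball 0 1) := hg.differentiableOn.deriv isOpen_ball
  exact (differentiableOn_const 1).add
    ((differentiableOn_id.mul (hd2.deriv isOpen_ball)).div hd2 hne)

/-- A function holomorphic near the closed unit disk whose real part is nonnegative on the unit
circle away from the point `1` has nonnegative real part at the origin. -/
theorem re_nonneg_of_circle {F : ℂ → ℂ} {R : ℝ} (hR : 1 < R)
    (hF : DifferentiableOn ℂ F (ball 0 R))
    (h : ∀ x : ℂ, ‖x‖ = 1 → x ≠ 1 → 0 ≤ (F x).re) : 0 ≤ (F 0).re := by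
  have hsub : closedBall (0 : ℂ) 1 ⊆ ball 0 R := closedBall_subset_ball hR
  have h1mem : (1 : ℂ) ∈ ball (0 : ℂ) R := by simpa using hR
  have hone : 0 ≤ (F 1).re := by
    have hc : ContinuousAt F 1 :=
      (hF.differentiableAt (isOpen_ball.mem_nhds h1mem)).continuousAt
    have hlim := (continuous_re.tendsto _).comp
      ((hc.tendsto.mono_left nhdsWithin_le_nhds).comp (tendsto_mul_exp_nhdsNE one_ne_zero))
    refine ge_of_tendsto hlim ?_
    filter_upwards [(tendsto_nhdsWithin_iff.mp (tendsto_mul_exp_nhdsNE one_ne_zero)).2] with t ht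
    exact h _ (by simp [norm_exp_ofReal_mul_I]) ht
  have hdc : DiffContOnCl ℂ F (ball 0 |(1 : ℝ)|) := by
    rw [abs_one]
    exact (hF.mono (by rw [closure_ball _ one_ne_zero]; exact hsub)).diffContOnCl
  have havg := hdc.circleAverage
  have hint : CircleIntegrable F 0 1 :=
    (hF.continuousOn.mono (sphere_subset_closedBall.trans hsub)).circleIntegrable zero_le_one
  have hre := Complex.reCLM.circleAverage_comp_comm hint
  rw [havg] at hre
  have : 0 ≤ Real.circleAverage (Complex.reCLM ∘ F) 0 1 := by
    refine Real.circleAverage_nonneg_of_nonneg fun x hx => ?_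
    rw [abs_one, mem_sphere_zero_iff_norm] at hx
    by_cases hx1 : x = 1
    · rw [hx1]; exact hone
    · exact h x hx hx1
  rw [hre] at this
  exact this

/-- Convex functions are starlike of order `1/2`. -/
theorem IsConvexFunction.half_le_re {g : ℂ → ℂ} (hg : IsConvexFunction g)
    (hne : ∀ z ∈ ball (0 : ℂ) 1, deriv g z ≠ 0) {ξ : ℂ} (hξ : ξ ∈ ball (0 : ℂ) 1) (hξ0 : ξ ≠ 0) :
    1 / 2 ≤ (ξ * deriv g ξ / (g ξ - g 0)).re := by
  have hξ1 : ‖ξ‖ < 1 := by simpa using hξ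
  have hξpos : 0 < ‖ξ‖ := norm_pos_iff.mpr hξ0
  set R := ‖ξ‖⁻¹
  have hR : 1 < R := (one_lt_inv₀ hξpos).mpr hξ1
  have hmaps : ∀ x ∈ ball (0 : ℂ) R, x * ξ ∈ ball (0 : ℂ) 1 := by
    intro x hx
    have hx' : ‖x‖ < ‖ξ‖⁻¹ := by simpa using hx
    have : ‖x‖ * ‖ξ‖ < 1 := by
      calc ‖x‖ * ‖ξ‖ < ‖ξ‖⁻¹ * ‖ξ‖ := by gcongr
        _ = 1 := inv_mul_cancel₀ hξpos.ne'
    simpa using this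
  have h1mem : (1 : ℂ) ∈ ball (0 : ℂ) R := by simpa using hR
  set W : ℂ → ℂ := fun x => g (x * ξ) with hW
  have hWd : DifferentiableOn ℂ W (ball 0 R) :=
    hg.differentiableOn.comp (by fun_prop) hmaps
  set c := ξ * deriv g ξ with hc
  have hc0 : c ≠ 0 := mul_ne_zero hξ0 (hne ξ hξ)
  have hWder : deriv W 1 = c := by
    have h1 : HasDerivAt g (deriv g ξ) (1 * ξ) := by
      rw [one_mul]
      exact (hg.differentiableOn.differentiableAt (isOpen_ball.mem_nhds hξ)).hasDerivAt
    have h2 : HasDerivAt (fun x : ℂ => x * ξ) ξ 1 := by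
      simpa using (hasDerivAt_id (1 : ℂ)).mul_const ξ
    have h3 := (h1.comp (1 : ℂ) h2).deriv
    rw [mul_comm] at h3
    exact h3
  set V : ℂ → ℂ := fun x => dslope W 1 x / c with hV
  have hVd : DifferentiableOn ℂ V (ball 0 R) :=
    ((Complex.differentiableOn_dslope (isOpen_ball.mem_nhds h1mem)).mpr hWd).div_const c
  have hV1 : V 1 = 1 := by simp [hV, hWder, hc0]
  have hVx : ∀ x ≠ 1, V x = (g ξ - g (x * ξ)) / ((1 - x) * c) := by
    intro x hx
    have h2 : 1 - x ≠ 0 := sub_ne_zero.mpr hx.symm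
    simp only [hV, dslope_of_ne _ hx, slope_def_field, hW, one_mul]
    field_simp
    ring
  have hVne : ∀ x ∈ ball (0 : ℂ) R, V x ≠ 0 := by
    intro x hx
    by_cases hx1 : x = 1
    · rw [hx1, hV1]; exact one_ne_zero
    · rw [hVx x hx1]
      refine div_ne_zero (sub_ne_zero.mpr fun h => hx1 ?_)
        (mul_ne_zero (sub_ne_zero.mpr (Ne.symm hx1)) hc0)
      have := hg.injOn hξ (hmaps x hx) h
      exact mul_right_cancel₀ hξ0 (by rw [← this, one_mul])
  -- the pole of `1 / V` at `1` cancels that of the half-plane map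
  set n : ℂ → ℂ := fun x => (V x)⁻¹ - (1 + x) / 2 with hn
  have hnd : DifferentiableOn ℂ n (ball 0 R) := (hVd.inv hVne).sub (by fun_prop)
  have hn1 : n 1 = 0 := by simp [hn, hV1]
  have hFd : DifferentiableOn ℂ (fun x => -dslope n 1 x) (ball 0 R) :=
    ((Complex.differentiableOn_dslope (isOpen_ball.mem_nhds h1mem)).mpr hnd).neg
  have hFx : ∀ x ≠ 1, -dslope n 1 x =
      ((g ξ - g (x * ξ)) / c)⁻¹ - (1 + x) / (2 * (1 - x)) := by
    intro x hx
    have h2 : 1 - x ≠ 0 := sub_ne_zero.mpr hx.symm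
    rw [dslope_of_ne _ hx, slope_def_field, hn1, sub_zero]
    simp only [hn, hVx x hx]
    rw [inv_div, inv_div, ← neg_sub 1 x]
    field_simp
  have key := re_nonneg_of_circle hR hFd fun x hx hx1 => by
    rw [hFx x hx1, sub_re]
    have hA : 0 ≤ (((g ξ - g (x * ξ)) / c)⁻¹).re := by
      rw [inv_re]
      exact div_nonneg (hg.support hne hξ hξ0 (by simp [hx])) (normSq_nonneg _)
    have hB : ((1 + x) / (2 * (1 - x))).re = 0 := by
      have hsq : x.re * x.re + x.im * x.im = 1 := by
        have := Complex.normSq_eq_norm_sq x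
        rw [hx, normSq_apply] at this
        simpa using this
      have : ((1 + x) / (2 * (1 - x))).re =
          (1 - (x.re * x.re + x.im * x.im)) * 2 / normSq (2 * (1 - x)) := by
        rw [div_re]; simp; ring
      rw [this, hsq]; simp
    linarith
  rw [hFx 0 zero_ne_one] at key
  have heq : ((g ξ - g (0 * ξ)) / c)⁻¹ - (1 + 0) / (2 * (1 - 0)) =
      ξ * deriv g ξ / (g ξ - g 0) - (1 / 2 : ℝ) := by
    rw [inv_div, zero_mul, hc]; norm_num
  rw [heq, sub_re, ofReal_re] at key
  linarith

/-- **Jack's lemma**: where `‖ω‖` attains its maximum over a disk centred at a zero of `ω`,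
the number `z ω' z / ω z` is real and at least `1`. -/
theorem jack {ω : ℂ → ℂ} (hω : DifferentiableOn ℂ ω (ball 0 1)) (h0 : ω 0 = 0) {z : ℂ}
    (hz : z ∈ ball (0 : ℂ) 1) (hz0 : ω z ≠ 0) (hmax : ∀ y : ℂ, ‖y‖ ≤ ‖z‖ → ‖ω y‖ ≤ ‖ω z‖) :
    ∃ k : ℝ, 1 ≤ k ∧ z * deriv ω z / ω z = k := by
  have hz1 : ‖z‖ < 1 := by simpa using hz
  have hzne : z ≠ 0 := by rintro rfl; exact hz0 h0
  have hzpos : 0 < ‖z‖ := norm_pos_iff.mpr hzne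
  have hMpos : 0 < ‖ω z‖ := norm_pos_iff.mpr hz0
  have hder : HasDerivAt ω (deriv ω z) z :=
    (hω.differentiableAt (isOpen_ball.mem_nhds hz)).hasDerivAt
  set k := z * deriv ω z / ω z with hk
  refine ⟨k.re, ?_, ?_⟩
  · -- the Schwarz lemma bounds `‖ω (t z)‖` by `t ‖ω z‖`
    have hschwarz : ∀ t ∈ Ico (0 : ℝ) 1, (ω (t * z) / ω z).re ≤ t := by
      intro t ht
      have hd : DifferentiableOn ℂ ω (ball 0 ‖z‖) := hω.mono (ball_subset_ball hz1.le)
      have hm : MapsTo ω (ball 0 ‖z‖) (closedBall (ω 0) ‖ω z‖) := by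
        intro y hy
        have hy' : ‖y‖ < ‖z‖ := by simpa using hy
        simpa [h0] using hmax y hy'.le
      have hmem : (t : ℂ) * z ∈ ball (0 : ℂ) ‖z‖ := by
        simp only [mem_ball_zero_iff, norm_mul, norm_real, Real.norm_eq_abs, abs_of_nonneg ht.1]
        exact mul_lt_of_lt_one_left hzpos ht.2
      have := Complex.dist_le_div_mul_dist_of_mapsTo_ball hd hm hmem
      simp only [h0, dist_zero_right, norm_mul, norm_real, Real.norm_eq_abs,
        abs_of_nonneg ht.1] at this
      refine (re_le_norm _).trans ?_
      rw [norm_div, div_le_iff₀ hMpos]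
      calc ‖ω (t * z)‖ ≤ ‖ω z‖ / ‖z‖ * (t * ‖z‖) := this
        _ = t * ‖ω z‖ := by field_simp
    have hd1 : HasDerivAt (fun t : ℝ => (ω (t * z) / ω z).re) k.re 1 := by
      have h2 : HasDerivAt (fun s : ℂ => s * z) z ((1 : ℝ) : ℂ) := by
        simpa using (hasDerivAt_id ((1 : ℝ) : ℂ)).mul_const z
      have h3 : HasDerivAt ω (deriv ω z) (((1 : ℝ) : ℂ) * z) := by simpa using hder
      have h4 := ((h3.comp ((1 : ℝ) : ℂ) h2).div_const (ω z)).real_of_complex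
      rw [mul_comm (deriv ω z) z] at h4
      exact h4
    have hlim := (hasDerivAt_iff_tendsto_slope.mp hd1).mono_left
      (nhdsWithin_mono (1 : ℝ) (fun x (hx : x ∈ Iio (1 : ℝ)) => (ne_of_lt hx : x ≠ 1)))
    refine ge_of_tendsto hlim ?_
    filter_upwards [Ico_mem_nhdsLT (show (0 : ℝ) < 1 from one_pos)] with t ht
    rw [slope_def_field, ofReal_one, one_mul, div_self hz0, one_re]
    have h1 := hschwarz t ht
    have h2 : t - 1 < 0 := by linarith [ht.2]
    rw [le_div_iff_of_neg h2]
    linarith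
  · -- `‖ω‖` is stationary along the circle through `z`
    have hd1 : HasDerivAt (fun t : ℝ => (ω (z * exp (t * I)) / ω z).re) (k * I).re 0 := by
      have h2 : HasDerivAt (fun s : ℂ => z * exp (s * I)) (z * I) ((0 : ℝ) : ℂ) := by
        have := (((hasDerivAt_id ((0 : ℝ) : ℂ)).mul_const I).cexp).const_mul z
        simpa using this
      have h3 : HasDerivAt ω (deriv ω z) (z * exp (((0 : ℝ) : ℂ) * I)) := by simpa using hder
      have h4 := ((h3.comp ((0 : ℝ) : ℂ) h2).div_const (ω z)).real_of_complex
      have : deriv ω z * (z * I) / ω z = k * I := by rw [hk]; ring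
      rw [this] at h4
      exact h4
    have hloc : IsLocalMax (fun t : ℝ => (ω (z * exp (t * I)) / ω z).re) 0 := by
      refine Filter.Eventually.of_forall fun t => ?_
      simp only [ofReal_zero, zero_mul, exp_zero, mul_one, div_self hz0, one_re]
      refine (re_le_norm _).trans ?_
      rw [norm_div]
      exact div_le_one_of_le₀ (hmax _ (by simp [norm_exp_ofReal_mul_I])) hMpos.le
    have := hloc.hasDerivAt_eq_zero hd1
    apply Complex.ext
    · simp
    · simpa using this

/-- The **Marx–Strohhäcker theorem**: a convex function normalized at the origin satisfies
`1/2 ≤ Re (g z / z)`. -/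
theorem IsConvexFunction.half_le_re_div {g : ℂ → ℂ} (hg : IsConvexFunction g)
    (hne : ∀ z ∈ ball (0 : ℂ) 1, deriv g z ≠ 0) {z : ℂ} (hz : z ∈ ball (0 : ℂ) 1) :
    1 / 2 ≤ (dslope g 0 z / deriv g 0).re := by
  have h0 : (0 : ℂ) ∈ ball (0 : ℂ) 1 := mem_ball_self one_pos
  have hg0 := hne 0 h0
  have hdd : DifferentiableOn ℂ (dslope g 0) (ball 0 1) :=
    (Complex.differentiableOn_dslope (isOpen_ball.mem_nhds h0)).mpr hg.differentiableOn
  have hdne : ∀ z ∈ ball (0 : ℂ) 1, dslope g 0 z ≠ 0 := by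
    intro z hz
    by_cases h : z = 0
    · simp [h, hg0]
    · rw [dslope_of_ne _ h, slope_def_field]
      exact div_ne_zero (sub_ne_zero.mpr fun h' => h (hg.injOn hz h0 h')) (by simpa using h)
  set ω : ℂ → ℂ := fun z => deriv g 0 / dslope g 0 z - 1 with hω
  have hωd : DifferentiableOn ℂ ω (ball 0 1) :=
    ((differentiableOn_const _).div hdd hdne).sub (differentiableOn_const _)
  have hω0 : ω 0 = 0 := by simp [hω, hg0]
  have hle : ∀ z ∈ ball (0 : ℂ) 1, ‖ω z‖ ≤ 1 := by
    intro z₁ hz₁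
    by_contra hgt
    push Not at hgt
    have hz₁' : ‖z₁‖ < 1 := by simpa using hz₁
    have hcb : closedBall (0 : ℂ) ‖z₁‖ ⊆ ball 0 1 := closedBall_subset_ball hz₁'
    obtain ⟨z, hzc, hzmax⟩ := (isCompact_closedBall (0 : ℂ) ‖z₁‖).exists_isMaxOn
      ⟨z₁, by simp⟩ ((hωd.continuousOn.mono hcb).norm)
    have hzb := hcb hzc
    have hzle : ‖z‖ ≤ ‖z₁‖ := by simpa using hzc
    have hM : 1 < ‖ω z‖ := hgt.trans_le (hzmax (by simp))
    have hωz : ω z ≠ 0 := by rw [← norm_pos_iff]; linarith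
    have hz0 : z ≠ 0 := by rintro rfl; exact hωz hω0
    obtain ⟨k, hk1, hk⟩ := jack hωd hω0 hzb hωz fun y hy => hzmax (by simpa using hy.trans hzle)
    have hgz0 : g z - g 0 ≠ 0 := sub_ne_zero.mpr fun h => hz0 (hg.injOn hzb h0 h)
    -- the logarithmic derivative of `1 + ω = g'(0) z / (g z - g 0)`
    have hderiv : deriv ω z = deriv g 0 * ((g z - g 0) - z * deriv g z) / (g z - g 0) ^ 2 := by
      have hev : ω =ᶠ[nhds z] fun y => deriv g 0 * (y / (g y - g 0)) - 1 := by
        filter_upwards [isOpen_ne.mem_nhds hz0, isOpen_ball.mem_nhds hzb] with y hy hyb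
        simp only [hω, dslope_of_ne _ hy, slope_def_field, sub_zero]
        rw [div_div_eq_mul_div, mul_div_assoc]
      have hgd : HasDerivAt g (deriv g z) z :=
        (hg.differentiableOn.differentiableAt (isOpen_ball.mem_nhds hzb)).hasDerivAt
      have := (((hasDerivAt_id z).div (hgd.sub_const (g 0)) hgz0).const_mul (deriv g 0)).sub_const 1
      rw [hev.deriv_eq]
      refine this.deriv.trans ?_
      simp only [id, one_mul]
      ring
    have hωval : 1 + ω z = deriv g 0 * z / (g z - g 0) := by
      simp only [hω, dslope_of_ne _ hz0, slope_def_field, sub_zero]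
      rw [div_div_eq_mul_div]; ring
    have hlog : (k : ℂ) * (ω z / (1 + ω z)) = 1 - z * deriv g z / (g z - g 0) := by
      rw [← hk, hωval, hderiv]
      field_simp
    have hre := hg.half_le_re hne hzb hz0
    have h1 := congrArg Complex.re hlog
    rw [re_ofReal_mul, sub_re, one_re] at h1
    have h1ω : 1 + ω z ≠ 0 := by
      rw [hωval]; exact div_ne_zero (mul_ne_zero hg0 hz0) hgz0
    have h2 : 1 / 2 < (ω z / (1 + ω z)).re := by
      have hpos : 0 < normSq (1 + ω z) := normSq_pos.mpr h1ω
      have hsq : 1 < normSq (ω z) := by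
        rw [normSq_eq_norm_sq]; nlinarith
      have : (ω z / (1 + ω z)).re =
          ((ω z).re + normSq (ω z)) / normSq (1 + ω z) := by
        rw [div_re, normSq_apply (ω z)]; simp; ring
      rw [this, lt_div_iff₀ hpos]
      rw [normSq_apply] at hsq ⊢
      rw [normSq_apply]
      simp only [add_re, one_re, add_im, one_im]
      nlinarith
    nlinarith
  -- `‖1 / Q - 1‖ ≤ 1` is equivalent to `1 / 2 ≤ Re Q`
  have h1 := hle z hz
  have hQ := div_ne_zero (hdne z hz) hg0
  set Q := dslope g 0 z / deriv g 0 with hQdef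
  have hωQ : ω z = (1 - Q) / Q := by
    have := hdne z hz
    simp only [hω, hQdef]; field_simp
  rw [hωQ, norm_div, div_le_one (norm_pos_iff.mpr hQ)] at h1
  have h2 : normSq (1 - Q) ≤ normSq Q := by
    rw [normSq_eq_norm_sq, normSq_eq_norm_sq]; gcongr
  rw [normSq_apply, normSq_apply] at h2
  simp only [sub_re, one_re, sub_im, one_im] at h2
  nlinarith

/-! ### Convolution with the kernel `v (1 + κ v) / (1 - v)` as an integral over the circle -/

/-- The kernel `h (z / u)` on the unit circle, where `h v = v (1 + κ v) / (1 - v)`. -/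
noncomputable def circleKernel (κ z u : ℂ) : ℂ := z * (u + κ * z) / (u * (u - z))

/-- The Hadamard product of `F - F 0` with `v (1 + κ v) / (1 - v)`, evaluated at `z`. -/
noncomputable def kernelOp (κ z : ℂ) (F : ℂ → ℂ) : ℂ :=
  (1 + κ) * (F z - F 0) - κ * z * deriv F 0

theorem circleKernel_continuousOn {κ z : ℂ} (hz : ‖z‖ < 1) :
    ContinuousOn (circleKernel κ z) (sphere 0 1) := by
  refine ContinuousOn.div (by fun_prop) (by fun_prop) fun u hu => ?_
  rw [mem_sphere_zero_iff_norm] at hu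
  refine mul_ne_zero ?_ (sub_ne_zero.mpr ?_)
  · rw [← norm_pos_iff, hu]; exact one_pos
  · rintro rfl; linarith

theorem continuous_circleKernel_circleMap {κ z : ℂ} (hz : ‖z‖ < 1) :
    Continuous fun θ : ℝ => circleKernel κ z (circleMap 0 1 θ) :=
  (circleKernel_continuousOn hz).comp_continuous (continuous_circleMap 0 1)
    fun θ => by simp

/-- Cauchy's formula for the kernel. -/
theorem circleAverage_mul_circleKernel {κ z : ℂ} (hz : ‖z‖ < 1) {F : ℂ → ℂ} {R : ℝ} (hR : 1 < R)
    (hF : DifferentiableOn ℂ F (ball 0 R)) :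
    Real.circleAverage (fun u => F u * circleKernel κ z u) 0 1 = kernelOp κ z F := by
  have hsub : closedBall (0 : ℂ) 1 ⊆ ball 0 R := closedBall_subset_ball hR
  have h0R : (0 : ℂ) ∈ ball (0 : ℂ) R := mem_ball_self (by linarith)
  have hdd : DifferentiableOn ℂ (dslope F 0) (ball 0 R) :=
    (Complex.differentiableOn_dslope (isOpen_ball.mem_nhds h0R)).mpr hF
  have hcl : ∀ {G : ℂ → ℂ}, DifferentiableOn ℂ G (ball 0 R) →
      DiffContOnCl ℂ G (ball 0 |(1 : ℝ)|) := by
    intro G hG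
    rw [abs_one]
    exact (hG.mono (by rw [closure_ball _ one_ne_zero]; exact hsub)).diffContOnCl
  have hint : ∀ {G : ℂ → ℂ}, ContinuousOn G (sphere 0 1) → CircleIntegrable G 0 1 :=
    fun h => h.circleIntegrable zero_le_one
  have hFc : ContinuousOn F (sphere 0 1) :=
    hF.continuousOn.mono (sphere_subset_closedBall.trans hsub)
  have h1 := (hcl hF).circleAverage_smul_div (w := z) (by simpa using hz)
  have h2 := (hcl hF).circleAverage
  have h3 := (hcl hdd).circleAverage
  have hne : ∀ u ∈ sphere (0 : ℂ) 1, u ≠ 0 ∧ u - z ≠ 0 := by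
    intro u hu
    rw [mem_sphere_zero_iff_norm] at hu
    refine ⟨?_, sub_ne_zero.mpr ?_⟩
    · rw [← norm_pos_iff, hu]; exact one_pos
    · rintro rfl; linarith
  have heq : EqOn (fun u => F u * circleKernel κ z u)
      (fun u => (1 + κ) * ((u - 0) / (u - z)) • F u - ((1 + κ) * F u + κ * z * dslope F 0 u
        + κ * z * F 0 * u⁻¹)) (sphere 0 |(1 : ℝ)|) := by
    intro u hu
    rw [abs_one] at hu
    obtain ⟨hu0, huz⟩ := hne u hu
    simp only [circleKernel, dslope_of_ne _ hu0, slope_def_field, sub_zero, smul_eq_mul]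
    field_simp
    ring
  have hinv : Real.circleAverage (fun u : ℂ => u⁻¹) 0 1 = 0 := by
    have h4 := Real.circleAverage_zero_one_congr_inv (f := fun u : ℂ => u)
    rw [h4]
    simpa using (hcl (G := fun u : ℂ => u) differentiableOn_id).circleAverage
  have hc1 : ContinuousOn (fun u : ℂ => ((u - 0) / (u - z)) • F u) (sphere 0 1) :=
    (ContinuousOn.div (by fun_prop) (by fun_prop) fun u hu => (hne u hu).2).smul hFc
  have hc2 : ContinuousOn (fun u : ℂ => u⁻¹) (sphere 0 1) :=
    continuousOn_inv₀.mono fun u hu => (hne u hu).1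
  have hc3 : ContinuousOn (dslope F 0) (sphere 0 1) :=
    hdd.continuousOn.mono (sphere_subset_closedBall.trans hsub)
  rw [Real.circleAverage_congr_sphere heq, Real.circleAverage_fun_sub, Real.circleAverage_fun_add,
    Real.circleAverage_fun_add]
  · have e1 := Real.circleAverage_fun_smul (a := 1 + κ) (c := 0) (R := 1)
      (f := fun u : ℂ => ((u - 0) / (u - z)) • F u)
    have e2 := Real.circleAverage_fun_smul (a := 1 + κ) (c := 0) (R := 1) (f := F)
    have e3 := Real.circleAverage_fun_smul (a := κ * z) (c := 0) (R := 1) (f := dslope F 0)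
    have e4 := Real.circleAverage_fun_smul (a := κ * z * F 0) (c := 0) (R := 1)
      (f := fun u : ℂ => u⁻¹)
    simp only [smul_eq_mul] at e1 e2 e3 e4 h1 ⊢
    rw [e1, e2, e3, e4, h2, h3, hinv, h1, dslope_same, kernelOp]
    ring
  · exact hint (continuousOn_const.mul hFc)
  · exact hint (continuousOn_const.mul hc3)
  · exact hint ((continuousOn_const.mul hFc).add (continuousOn_const.mul hc3))
  · exact hint (continuousOn_const.mul hc2)
  · exact hint (continuousOn_const.mul hc1)
  · exact hint (((continuousOn_const.mul hFc).add (continuousOn_const.mul hc3)).add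
      (continuousOn_const.mul hc2))

/-- The kernel annihilates conjugates of holomorphic functions. -/
theorem circleAverage_conj_mul_circleKernel {κ z : ℂ} (hz : ‖z‖ < 1) {F : ℂ → ℂ} {R : ℝ}
    (hR : 1 < R) (hF : DifferentiableOn ℂ F (ball 0 R)) :
    Real.circleAverage (fun u => (starRingEnd ℂ) (F u) * circleKernel κ z u) 0 1 = 0 := by
  have hsub : closedBall (0 : ℂ) 1 ⊆ ball 0 R := closedBall_subset_ball hR
  set zc := (starRingEnd ℂ) z with hzc
  set kc := (starRingEnd ℂ) κ with hkc
  set L : ℂ → ℂ := fun u => F u * (zc * u * (1 + kc * zc * u) / (1 - zc * u)) with hL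
  have hLd : DifferentiableOn ℂ L (closedBall 0 1) := by
    refine (hF.mono hsub).mul (DifferentiableOn.div (by fun_prop) (by fun_prop) fun u hu => ?_)
    have hu' : ‖u‖ ≤ 1 := by simpa using hu
    have : ‖zc * u‖ < 1 := by
      rw [norm_mul, hzc, RCLike.norm_conj]
      nlinarith [norm_nonneg z, norm_nonneg u]
    intro h
    rw [← sub_eq_zero.mp h, norm_one] at this
    exact lt_irrefl _ this
  have hcl : DiffContOnCl ℂ L (ball 0 |(1 : ℝ)|) := by
    rw [abs_one]
    rw [← closure_ball _ one_ne_zero] at hLd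
    exact hLd.diffContOnCl
  have havg := hcl.circleAverage
  have heq : EqOn (fun u => (starRingEnd ℂ) (F u) * circleKernel κ z u)
      (fun u => (starRingEnd ℂ) (L u)) (sphere 0 |(1 : ℝ)|) := by
    intro u hu
    rw [abs_one, mem_sphere_zero_iff_norm] at hu
    have hu0 : u ≠ 0 := by rw [← norm_pos_iff, hu]; exact one_pos
    have huz : u - z ≠ 0 := sub_ne_zero.mpr (by rintro rfl; linarith)
    have hconj : (starRingEnd ℂ) u = u⁻¹ := by
      rw [inv_def, normSq_eq_norm_sq, hu]; simp
    simp only [hL, map_mul, map_div₀, map_add, map_sub, map_one, hzc, hkc, conj_conj, hconj,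
      circleKernel]
    congr 1
    have : 1 - z * u⁻¹ ≠ 0 := by
      rw [← mul_ne_zero_iff_right hu0]
      have : (1 - z * u⁻¹) * u = u - z := by field_simp
      rw [this]; exact huz
    field_simp
  rw [Real.circleAverage_congr_sphere heq]
  have hint : CircleIntegrable L 0 1 :=
    (hLd.continuousOn.mono sphere_subset_closedBall).circleIntegrable zero_le_one
  have hre := (Complex.conjCLE : ℂ →L[ℝ] ℂ).circleAverage_comp_comm hint
  rw [havg] at hre
  have h0 : L 0 = 0 := by simp [hL]
  rw [h0, map_zero] at hre
  exact hre

/-- The kernel operator, applied to a function holomorphic near the closed disk, only sees the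
real part on the circle. -/
theorem integral_re_mul_circleKernel {κ z : ℂ} (hz : ‖z‖ < 1) {F : ℂ → ℂ} {R : ℝ} (hR : 1 < R)
    (hF : DifferentiableOn ℂ F (ball 0 R)) :
    ∫ θ in (0 : ℝ)..2 * Real.pi, ((F (circleMap 0 1 θ)).re : ℂ) * circleKernel κ z (circleMap 0 1 θ)
      = Real.pi * kernelOp κ z F := by
  have hsub : closedBall (0 : ℂ) 1 ⊆ ball 0 R := closedBall_subset_ball hR
  have hFc : ContinuousOn F (sphere 0 1) :=
    hF.continuousOn.mono (sphere_subset_closedBall.trans hsub)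
  have h1 := circleAverage_mul_circleKernel (κ := κ) hz hR hF
  have h2 := circleAverage_conj_mul_circleKernel (κ := κ) hz hR hF
  have hk := circleKernel_continuousOn (κ := κ) hz
  have h3 := Real.circleAverage_fun_add
    (f₁ := fun u => F u * circleKernel κ z u)
    (f₂ := fun u => (starRingEnd ℂ) (F u) * circleKernel κ z u)
    ((hFc.mul hk).circleIntegrable zero_le_one)
    ((((continuous_conj.comp_continuousOn hFc)).mul hk).circleIntegrable zero_le_one)
  rw [h1, h2, Real.circleAverage_def, add_zero] at h3
  have h4 : ∀ θ : ℝ, F (circleMap 0 1 θ) * circleKernel κ z (circleMap 0 1 θ) +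
      (starRingEnd ℂ) (F (circleMap 0 1 θ)) * circleKernel κ z (circleMap 0 1 θ) =
      2 * (((F (circleMap 0 1 θ)).re : ℂ) * circleKernel κ z (circleMap 0 1 θ)) := by
    intro θ
    rw [← add_mul, add_conj]; push_cast; ring
  simp only [h4, intervalIntegral.integral_const_mul] at h3
  rw [← h3, Complex.real_smul]
  push_cast
  have : (Real.pi : ℂ) ≠ 0 := by exact_mod_cast Real.pi_ne_zero
  field_simp

theorem one_sub_mem_slitPlane {u : ℂ} (hu : ‖u‖ ≤ 1) (hu1 : u ≠ 1) : 1 - u ∈ slitPlane := by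
  rw [mem_slitPlane_iff]
  left
  have h1 : u.re ≤ 1 := (re_le_norm u).trans hu
  rcases h1.lt_or_eq with h | h
  · simpa using h
  · exfalso
    apply hu1
    have h2 : u.re * u.re + u.im * u.im ≤ 1 := by
      rw [← normSq_apply, normSq_eq_norm_sq]; nlinarith [norm_nonneg u]
    rw [h] at h2
    have : u.im = 0 := by nlinarith
    exact Complex.ext (by simpa using h) (by simpa using this)

theorem circleMap_ne_one {θ : ℝ} (hθ : θ ∈ Ioo 0 (2 * Real.pi)) : circleMap 0 1 θ ≠ 1 := by
  intro h
  rw [circleMap_zero, ofReal_one, one_mul, Complex.exp_eq_one_iff] at h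
  obtain ⟨n, hn⟩ := h
  have h1 : (θ : ℂ) = n * (2 * Real.pi) := by
    have := mul_right_cancel₀ I_ne_zero (hn.trans (by ring : _ = (n * (2 * Real.pi) : ℂ) * I))
    exact this
  have h2 : θ = n * (2 * Real.pi) := by exact_mod_cast h1
  have hpi := Real.pi_pos
  have h3 : (0 : ℝ) < n := by
    by_contra hn0
    push Not at hn0
    have := hθ.1
    nlinarith
  have h4 : (n : ℝ) < 1 := by
    by_contra hn1
    push Not at hn1
    have := hθ.2
    nlinarith
  have h5 : 0 < n := by exact_mod_cast h3
  have h6 : n < 1 := by exact_mod_cast h4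
  omega

/-- The real part of `log (1 - u)` is only logarithmically singular on the circle, so that
`integral_re_mul_circleKernel` extends to it. -/
theorem integral_re_log_mul_circleKernel {κ z : ℂ} (hz : ‖z‖ < 1) (c : ℂ) :
    IntervalIntegrable (fun θ : ℝ => (c * log (1 - circleMap 0 1 θ)).re) MeasureTheory.volume
      0 (2 * Real.pi) ∧
    ∫ θ in (0 : ℝ)..2 * Real.pi, ((c * log (1 - circleMap 0 1 θ)).re : ℂ) *
      circleKernel κ z (circleMap 0 1 θ) =
      Real.pi * (c * ((1 + κ) * log (1 - z) + κ * z)) := by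
  have hpi := Real.pi_pos
  have hkc := continuous_circleKernel_circleMap (κ := κ) hz
  obtain ⟨C, hC⟩ := (isCompact_Icc (a := (0 : ℝ)) (b := 2 * Real.pi)).exists_bound_of_continuousOn
    hkc.continuousOn
  -- an integrable majorant, uniform in the radius
  set b : ℝ → ℝ := fun θ =>
    ‖c‖ * (|Real.log ‖circleMap 0 1 θ - 1‖| + Real.log 2 + Real.pi) with hb
  have hlogint : IntervalIntegrable (fun θ => Real.log ‖circleMap 0 1 θ - 1‖)
      MeasureTheory.volume 0 (2 * Real.pi) :=
    circleIntegrable_log_norm_sub_const (c := 0) (a := 1) 1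
  have hbint : IntervalIntegrable b MeasureTheory.volume 0 (2 * Real.pi) :=
    ((hlogint.abs.add intervalIntegrable_const).add intervalIntegrable_const).const_mul _
  have hlog : ∀ ρ ∈ Icc (0 : ℝ) 1, ∀ θ ∈ Ioo 0 (2 * Real.pi),
      ‖(c * log (1 - ρ * circleMap 0 1 θ)).re‖ ≤ b θ := by
    intro ρ hρ θ hθ
    set u := circleMap 0 1 θ with hu
    have hun : ‖u‖ = 1 := by simp [hu]
    have hu1 : u ≠ 1 := circleMap_ne_one hθ
    have hupos : 0 < ‖u - 1‖ := norm_pos_iff.mpr (sub_ne_zero.mpr hu1)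
    have hle : ‖u - 1‖ ≤ 2 * ‖1 - ρ * u‖ := by
      have h1 : 1 - ρ ≤ ‖1 - ρ * u‖ := by
        have := norm_sub_norm_le (1 : ℂ) (ρ * u)
        rw [norm_one, norm_mul, hun, mul_one, norm_real, Real.norm_of_nonneg hρ.1] at this
        exact this
      have h2 : ‖u - 1‖ ≤ ‖1 - ρ * u‖ + (1 - ρ) := by
        have : u - 1 = -(1 - ρ * u) + ((1 - ρ : ℝ) : ℂ) * u := by push_cast; ring
        rw [this]
        refine (norm_add_le _ _).trans ?_
        rw [norm_neg, norm_mul, hun, mul_one, norm_real, Real.norm_of_nonneg (by linarith [hρ.2])]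
      linarith
    have hpos : 0 < ‖1 - ρ * u‖ := by linarith
    have hge : ‖1 - ρ * u‖ ≤ 2 := by
      refine (norm_sub_le _ _).trans ?_
      rw [norm_one, norm_mul, hun, mul_one, norm_real, Real.norm_of_nonneg hρ.1]
      linarith [hρ.2]
    have hre : |(log (1 - ρ * u)).re| ≤ |Real.log ‖u - 1‖| + Real.log 2 := by
      rw [log_re, abs_le]
      constructor
      · have := Real.log_le_log hupos hle
        rw [Real.log_mul two_ne_zero hpos.ne'] at this
        linarith [neg_abs_le (Real.log ‖u - 1‖)]
      · have := Real.log_le_log hpos hge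
        linarith [abs_nonneg (Real.log ‖u - 1‖)]
    have him : |(log (1 - ρ * u)).im| ≤ Real.pi := by rw [log_im]; exact abs_arg_le_pi _
    calc ‖(c * log (1 - ρ * u)).re‖ ≤ ‖c * log (1 - ρ * u)‖ := abs_re_le_norm _
      _ = ‖c‖ * ‖log (1 - ρ * u)‖ := norm_mul _ _
      _ ≤ b θ := by
        simp only [hb]
        gcongr
        exact (norm_le_abs_re_add_abs_im _).trans (by rw [add_assoc] at *; linarith)
  have hmeas : ∀ ρ : ℝ, Measurable fun θ : ℝ => (c * log (1 - ρ * circleMap 0 1 θ)).re := by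
    intro ρ
    have : Measurable (circleMap 0 1) := (continuous_circleMap 0 1).measurable
    fun_prop
  have hae : ∀ᵐ θ : ℝ, θ ∈ uIoc 0 (2 * Real.pi) → θ ∈ Ioo 0 (2 * Real.pi) := by
    have : ∀ᵐ θ : ℝ, θ ≠ 2 * Real.pi := by simp [MeasureTheory.ae_iff]
    filter_upwards [this] with θ h1 h2
    rw [uIoc_of_le (by linarith)] at h2
    exact ⟨h2.1, lt_of_le_of_ne h2.2 h1⟩
  refine ⟨?_, ?_⟩
  · refine hbint.mono_fun ?_ ?_
    · have := hmeas 1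
      simp only [ofReal_one, one_mul] at this
      exact this.aestronglyMeasurable
    · rw [Filter.EventuallyLE, MeasureTheory.ae_restrict_iff' measurableSet_uIoc]
      filter_upwards [hae] with θ h1 h2
      have := hlog 1 (by simp) θ (h1 h2)
      simp only [ofReal_one, one_mul] at this
      exact this.trans (le_abs_self _)
  · have hlim : Filter.Tendsto (fun ρ : ℝ => ∫ θ in (0 : ℝ)..2 * Real.pi,
        ((c * log (1 - ρ * circleMap 0 1 θ)).re : ℂ) * circleKernel κ z (circleMap 0 1 θ))
        (nhdsWithin 1 (Iio 1)) (nhds (∫ θ in (0 : ℝ)..2 * Real.pi,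
        ((c * log (1 - circleMap 0 1 θ)).re : ℂ) * circleKernel κ z (circleMap 0 1 θ))) := by
      refine intervalIntegral.tendsto_integral_filter_of_dominated_convergence
        (fun θ => b θ * C) ?_ ?_ (hbint.mul_const C) ?_
      · refine Filter.Eventually.of_forall fun ρ => ?_
        exact ((measurable_ofReal.comp (hmeas ρ)).mul hkc.measurable).aestronglyMeasurable
      · filter_upwards [Ioo_mem_nhdsLT (show (0 : ℝ) < 1 from one_pos)] with ρ hρ
        filter_upwards [hae] with θ h1 h2
        rw [norm_mul, norm_real]
        have h3 := h1 h2
        have h4 := hlog ρ ⟨hρ.1.le, hρ.2.le⟩ θ h3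
        have h5 := hC θ ⟨h3.1.le, h3.2.le⟩
        exact mul_le_mul h4 h5 (norm_nonneg _) ((norm_nonneg _).trans h4)
      · filter_upwards [hae] with θ h1 h2
        have hmem := one_sub_mem_slitPlane (u := circleMap 0 1 θ) (by simp)
          (circleMap_ne_one (h1 h2))
        have hcont : ContinuousAt (fun ρ : ℝ => ((c * log (1 - ρ * circleMap 0 1 θ)).re : ℂ) *
            circleKernel κ z (circleMap 0 1 θ)) 1 := by
          have : ContinuousAt (fun ρ : ℝ => log (1 - ρ * circleMap 0 1 θ)) 1 :=
            ContinuousAt.clog (by fun_prop) (by simpa using hmem)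
          exact ((continuous_ofReal.comp continuous_re).continuousAt.comp
            (continuousAt_const.mul this)).mul continuousAt_const
        have := hcont.tendsto
        simp only [ofReal_one, one_mul] at this
        exact this.mono_left nhdsWithin_le_nhds
    have hzmem := one_sub_mem_slitPlane hz.le (by rintro rfl; simp at hz)
    have hlim2 : Filter.Tendsto (fun ρ : ℝ =>
        (Real.pi : ℂ) * (c * ((1 + κ) * log (1 - ρ * z) + κ * (ρ * z))))
        (nhdsWithin 1 (Iio 1)) (nhds (Real.pi * (c * ((1 + κ) * log (1 - z) + κ * z)))) := by
      have : ContinuousAt (fun ρ : ℝ =>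
          (Real.pi : ℂ) * (c * ((1 + κ) * log (1 - ρ * z) + κ * (ρ * z)))) 1 := by
        have : ContinuousAt (fun ρ : ℝ => log (1 - ρ * z)) 1 :=
          ContinuousAt.clog (by fun_prop) (by simpa using hzmem)
        fun_prop
      have := this.tendsto
      simp only [ofReal_one, one_mul] at this
      exact this.mono_left nhdsWithin_le_nhds
    refine tendsto_nhds_unique hlim (hlim2.congr' ?_)
    filter_upwards [Ioo_mem_nhdsLT (show (0 : ℝ) < 1 from one_pos)] with ρ hρ
    have hmem : ∀ u ∈ ball (0 : ℂ) ρ⁻¹, 1 - ρ * u ∈ slitPlane := by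
      intro u hu
      have hu' : ‖u‖ < ρ⁻¹ := by simpa using hu
      have : ‖(ρ : ℂ) * u‖ < 1 := by
        rw [norm_mul, norm_real, Real.norm_of_nonneg hρ.1.le]
        calc ρ * ‖u‖ < ρ * ρ⁻¹ := mul_lt_mul_of_pos_left hu' hρ.1
          _ = 1 := mul_inv_cancel₀ hρ.1.ne'
      refine one_sub_mem_slitPlane this.le ?_
      intro h
      rw [h, norm_one] at this
      exact lt_irrefl _ this
    have hd : ∀ u ∈ ball (0 : ℂ) ρ⁻¹, HasDerivAt (fun u => c * log (1 - ρ * u))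
        (c * (-ρ / (1 - ρ * u))) u := by
      intro u hu
      have h1 : HasDerivAt (fun u : ℂ => 1 - ρ * u) (-ρ) u := by
        simpa using ((hasDerivAt_id u).const_mul (ρ : ℂ)).const_sub 1
      exact (h1.clog (hmem u hu)).const_mul c
    have hF : DifferentiableOn ℂ (fun u => c * log (1 - ρ * u)) (ball 0 ρ⁻¹) :=
      fun u hu => (hd u hu).differentiableAt.differentiableWithinAt
    have h1 := integral_re_mul_circleKernel (κ := κ) hz
      ((one_lt_inv₀ hρ.1).mpr hρ.2) hF
    rw [h1, kernelOp, (hd 0 (mem_ball_self (inv_pos.mpr hρ.1))).deriv]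
    simp
    ring

/-! ### Integrals of unimodal functions against a rotating kernel -/

/-- A continuous kernel on `[0, 2π]` whose argument `-ω` decreases strictly, by `2π` over a
period, and whose mean is zero. The bound on `ω θ - θ` makes `ω` surjective. -/
structure RotatingKernel (k : ℝ → ℂ) (ω : ℝ → ℝ) : Prop where
  continuous : Continuous k
  ne_zero : ∀ θ, k θ ≠ 0
  polar : ∀ θ, k θ = ‖k θ‖ * exp (-(ω θ * I))
  continuous_angle : Continuous ω
  strictMono : StrictMono ω
  bounded : ∃ C, ∀ θ, |ω θ - θ| ≤ C
  period : ω (2 * Real.pi) = ω 0 + 2 * Real.pi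
  mean_zero : ∫ θ in (0 : ℝ)..2 * Real.pi, k θ = 0

/-- If `S - l` is negative between two angles at which the kernel points in opposite directions
and positive elsewhere, then the integral of `S` against the kernel does not vanish. -/
theorem RotatingKernel.integral_ne_zero {k : ℝ → ℂ} {ω : ℝ → ℝ} (h : RotatingKernel k ω)
    {S : ℝ → ℝ} (hS : IntervalIntegrable S MeasureTheory.volume 0 (2 * Real.pi))
    {A B l : ℝ} (hA : 0 ≤ A) (hB : B ≤ 2 * Real.pi) (hAB : ω B = ω A + Real.pi)
    (hin : ∀ θ ∈ Ioo A B, S θ < l) (hout : ∀ θ ∈ Ioo 0 A ∪ Ioo B (2 * Real.pi), l < S θ) :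
    ∫ θ in (0 : ℝ)..2 * Real.pi, (S θ : ℂ) * k θ ≠ 0 := by
  intro hzero
  have hpi := Real.pi_pos
  have hpi2 : (0 : ℝ) < 2 * Real.pi := by linarith
  -- rotate the kernel so that its imaginary part changes sign exactly where `S - l` does
  set e := exp (ω A * I) with he
  have hsub : IntervalIntegrable (fun θ => S θ - l) MeasureTheory.volume 0 (2 * Real.pi) :=
    hS.sub intervalIntegrable_const
  have him : ∀ θ, (e * k θ).im = -(‖k θ‖ * Real.sin (ω θ - ω A)) := by
    intro θ
    rw [h.polar θ, he, mul_left_comm, ← exp_add]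
    have : (ω A : ℂ) * I + -(ω θ * I) = ((ω A - ω θ : ℝ) : ℂ) * I := by push_cast; ring
    rw [this, im_ofReal_mul, exp_ofReal_mul_I_im, norm_mul, norm_real, norm_norm, norm_exp]
    simp only [neg_re, mul_re, ofReal_re, I_re, mul_zero, ofReal_im, I_im, mul_one, sub_self,
      neg_zero, Real.exp_zero]
    rw [← neg_sub (ω θ) (ω A), Real.sin_neg]
    ring
  set f : ℝ → ℝ := fun θ => (S θ - l) * (e * k θ).im with hf
  have hkim : Continuous fun θ => (e * k θ).im :=
    continuous_im.comp (continuous_const.mul h.continuous)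
  have hfint : IntervalIntegrable f MeasureTheory.volume 0 (2 * Real.pi) :=
    hsub.mul_continuousOn hkim.continuousOn
  have hSc : IntervalIntegrable (fun θ => (S θ : ℂ)) MeasureTheory.volume 0 (2 * Real.pi) := by
    simp only [intervalIntegrable_iff] at hS ⊢
    exact Complex.ofRealCLM.integrable_comp hS
  have hval : ∫ θ in (0 : ℝ)..2 * Real.pi, f θ = 0 := by
    have h1 : ∫ θ in (0 : ℝ)..2 * Real.pi, e * (((S θ : ℂ) - l) * k θ) = 0 := by
      rw [intervalIntegral.integral_const_mul]
      have : ∀ θ, ((S θ : ℂ) - l) * k θ = (S θ : ℂ) * k θ - (l : ℂ) * k θ := fun θ => sub_mul _ _ _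
      simp only [this]
      rw [intervalIntegral.integral_sub, hzero, intervalIntegral.integral_const_mul, h.mean_zero]
      · simp
      · exact hSc.mul_continuousOn h.continuous.continuousOn
      · exact (continuous_const.mul h.continuous).intervalIntegrable _ _
    have hint : IntervalIntegrable (fun θ => e * (((S θ : ℂ) - l) * k θ))
        MeasureTheory.volume 0 (2 * Real.pi) :=
      ((hSc.sub intervalIntegrable_const).mul_continuousOn h.continuous.continuousOn).const_mul e
    have h2 : ∫ θ in (0 : ℝ)..2 * Real.pi, (e * (((S θ : ℂ) - l) * k θ)).im =
        (∫ θ in (0 : ℝ)..2 * Real.pi, e * (((S θ : ℂ) - l) * k θ)).im :=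
      intervalIntegral.intervalIntegral_im hint
    rw [h1, zero_im] at h2
    rw [← h2]
    congr 1 with θ
    rw [mul_left_comm, ← ofReal_sub, im_ofReal_mul]
  have hpos : 0 < ∫ θ in (0 : ℝ)..2 * Real.pi, f θ := by
    have hfpos : ∀ θ ∈ Ioo 0 (2 * Real.pi), θ ≠ A → θ ≠ B → 0 < f θ := by
      intro θ hθ hθA hθB
      have hk := norm_pos_iff.mpr (h.ne_zero θ)
      simp only [hf, him]
      have hlo : ω 0 < ω θ := h.strictMono hθ.1
      have hhi : ω θ < ω 0 + 2 * Real.pi := h.period ▸ h.strictMono hθ.2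
      have hA0 : ω 0 ≤ ω A := h.strictMono.monotone hA
      have hB2 : ω A + Real.pi ≤ ω 0 + 2 * Real.pi := by
        rw [← hAB, ← h.period]; exact h.strictMono.monotone hB
      rcases lt_or_gt_of_ne hθA with h1 | h1
      · have h2 := h.strictMono h1
        have hs : Real.sin (ω θ - ω A) < 0 :=
          Real.sin_neg_of_neg_of_neg_pi_lt (by linarith) (by linarith)
        have hSl := hout θ (Or.inl ⟨hθ.1, h1⟩)
        have := mul_neg_of_pos_of_neg hk hs
        exact mul_pos (by linarith) (by linarith)
      · have h2 := h.strictMono h1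
        rcases lt_or_gt_of_ne hθB with h3 | h3
        · have h4 := h.strictMono h3
          have hs : 0 < Real.sin (ω θ - ω A) :=
            Real.sin_pos_of_pos_of_lt_pi (by linarith) (by linarith)
          have hSl := hin θ ⟨h1, h3⟩
          have := mul_pos hk hs
          exact mul_pos_of_neg_of_neg (by linarith) (by linarith)
        · have h4 := h.strictMono h3
          have hs : Real.sin (ω θ - ω A) < 0 := by
            have : Real.sin (ω θ - ω A) = -Real.sin (ω θ - ω A - Real.pi) := by
              rw [Real.sin_sub_pi, neg_neg]
            rw [this, neg_lt_zero]
            exact Real.sin_pos_of_pos_of_lt_pi (by linarith) (by linarith)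
          have hSl := hout θ (Or.inr ⟨h3, hθ.2⟩)
          have := mul_neg_of_pos_of_neg hk hs
          exact mul_pos (by linarith) (by linarith)
    have hnonneg : 0 ≤ᵐ[MeasureTheory.volume.restrict (Ioc 0 (2 * Real.pi))] f := by
      rw [Filter.EventuallyLE, MeasureTheory.ae_restrict_iff' measurableSet_Ioc]
      have e1 : ∀ᵐ θ : ℝ, θ ≠ 2 * Real.pi := by simp [MeasureTheory.ae_iff]
      have e2 : ∀ᵐ θ : ℝ, θ ≠ A := by simp [MeasureTheory.ae_iff]
      have e3 : ∀ᵐ θ : ℝ, θ ≠ B := by simp [MeasureTheory.ae_iff]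
      filter_upwards [e1, e2, e3] with θ h1 h2 h3 h4
      exact (hfpos θ ⟨h4.1, lt_of_le_of_ne h4.2 h1⟩ h2 h3).le
    rw [intervalIntegral.integral_pos_iff_support_of_nonneg_ae' (by
      rwa [uIoc_of_le hpi2.le]) hfint]
    refine ⟨hpi2, ?_⟩
    have hsup : Ioo 0 (2 * Real.pi) \ {A, B} ⊆ Function.support f ∩ Ioc 0 (2 * Real.pi) := by
      rintro θ ⟨hθ, hne⟩
      simp only [mem_insert_iff, mem_singleton_iff, not_or] at hne
      exact ⟨(hfpos θ hθ hne.1 hne.2).ne', hθ.1, hθ.2.le⟩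
    refine lt_of_lt_of_le ?_ (MeasureTheory.measure_mono hsup)
    rw [MeasureTheory.measure_sdiff_null ((Set.toFinite {A, B}).measure_zero _), Real.volume_Ioo]
    simpa using hpi
  exact hpos.ne' hval

/-- The integral of a function with a single minimum, tending to infinity at both ends, against
a rotating kernel does not vanish. -/
theorem RotatingKernel.integral_ne_zero_of_valley {k : ℝ → ℂ} {ω : ℝ → ℝ}
    (h : RotatingKernel k ω) {S : ℝ → ℝ}
    (hS : IntervalIntegrable S MeasureTheory.volume 0 (2 * Real.pi))
    (hcont : ContinuousOn S (Ioo 0 (2 * Real.pi))) {Q : ℝ}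
    (hanti : StrictAntiOn S (Ioc 0 Q)) (hmono : StrictMonoOn S (Ico Q (2 * Real.pi)))
    (h0 : Filter.Tendsto S (nhdsWithin 0 (Ioi 0)) Filter.atTop)
    (h1 : Filter.Tendsto S (nhdsWithin (2 * Real.pi) (Iio (2 * Real.pi))) Filter.atTop) :
    ∫ θ in (0 : ℝ)..2 * Real.pi, (S θ : ℂ) * k θ ≠ 0 := by
  have hpi := Real.pi_pos
  have hsurj : Function.Surjective ω := by
    obtain ⟨C, hC⟩ := h.bounded
    refine h.continuous_angle.surjective ?_ ?_
    · refine Filter.tendsto_atTop_mono (f := fun θ => θ - C) (fun θ => ?_)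
        (Filter.tendsto_atTop_add_const_right _ _ Filter.tendsto_id)
      linarith [(abs_le.mp (hC θ)).1]
    · refine Filter.tendsto_atBot_mono (fun θ => (by linarith [(abs_le.mp (hC θ)).2] : ω θ ≤ θ + C))
        (Filter.tendsto_atBot_add_const_right _ _ Filter.tendsto_id)
  set e := h.strictMono.orderIsoOfSurjective ω hsurj
  have hes : ∀ v, ω (e.symm v) = v := fun v => e.apply_symm_apply v
  have hse : ∀ θ, e.symm (ω θ) = θ := fun θ => e.symm_apply_apply θ
  have hec : Continuous e.symm := e.symm.continuous
  set v0 := ω 0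
  have e0 : e.symm v0 = 0 := hse 0
  have e2 : e.symm (v0 + 2 * Real.pi) = 2 * Real.pi := by rw [← h.period]; exact hse _
  have hm : ∀ {v w : ℝ}, v < w → e.symm v < e.symm w := fun hvw => e.symm.strictMono hvw
  set m := e.symm (v0 + Real.pi)
  have hm0 : 0 < m := by rw [← e0]; exact hm (by linarith)
  have hm2 : m < 2 * Real.pi := by rw [← e2]; exact hm (by linarith)
  -- a chord of opposite kernel directions with equal values of `S` at its ends
  set D : ℝ → ℝ := fun v => S (e.symm v) - S (e.symm (v + Real.pi)) with hD
  have hDc : ContinuousOn D (Ioo v0 (v0 + Real.pi)) := by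
    refine ContinuousOn.sub (hcont.comp hec.continuousOn fun v hv => ?_)
      (hcont.comp (hec.comp (continuous_id.add continuous_const)).continuousOn fun v hv => ?_)
    · refine ⟨?_, ?_⟩
      · rw [← e0]; exact hm hv.1
      · rw [← e2]; exact hm (by linarith [hv.2])
    · refine ⟨?_, ?_⟩
      · rw [← e0]; exact hm (by linarith [hv.1])
      · rw [← e2]; exact hm (by linarith [hv.2])
  have hSm : ContinuousAt S m := hcont.continuousAt (Ioo_mem_nhds hm0 hm2)
  have hshift : Filter.Tendsto (fun v => e.symm (v + Real.pi)) (nhds v0) (nhds m) :=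
    (hec.comp (continuous_id.add continuous_const)).tendsto v0
  have hDtop : Filter.Tendsto D (nhdsWithin v0 (Ioi v0)) Filter.atTop := by
    refine Filter.Tendsto.atTop_add (C := -S m) ?_ ?_
    · refine h0.comp (tendsto_nhdsWithin_iff.mpr ⟨?_, ?_⟩)
      · have := hec.tendsto v0
        rw [e0] at this
        exact this.mono_left nhdsWithin_le_nhds
      · filter_upwards [self_mem_nhdsWithin] with v hv
        rw [mem_Ioi, ← e0]; exact hm hv
    · exact ((hSm.tendsto.comp hshift).mono_left nhdsWithin_le_nhds).neg
  have hDbot : Filter.Tendsto D (nhdsWithin (v0 + Real.pi) (Iio (v0 + Real.pi)))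
      Filter.atBot := by
    have : Filter.Tendsto (fun v => S (e.symm (v + Real.pi)) + -S (e.symm v))
        (nhdsWithin (v0 + Real.pi) (Iio (v0 + Real.pi))) Filter.atTop := by
      refine Filter.Tendsto.atTop_add (C := -S m) ?_ ?_
      · refine h1.comp (tendsto_nhdsWithin_iff.mpr ⟨?_, ?_⟩)
        · have := (hec.comp (continuous_id.add continuous_const)).tendsto (v0 + Real.pi)
            (f := fun v => e.symm (v + Real.pi))
          rw [show v0 + Real.pi + Real.pi = v0 + 2 * Real.pi by ring, e2] at this
          exact this.mono_left nhdsWithin_le_nhds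
        · filter_upwards [self_mem_nhdsWithin] with v hv
          have hv' : v < v0 + Real.pi := hv
          rw [mem_Iio, ← e2]; exact hm (by linarith)
      · exact ((hSm.tendsto.comp (hec.tendsto (v0 + Real.pi))).mono_left
          nhdsWithin_le_nhds).neg
    have h3 := Filter.tendsto_neg_atTop_atBot.comp this
    refine h3.congr fun v => ?_
    simp only [hD, Function.comp]
    ring
  obtain ⟨v1, hv1D, hv1⟩ := ((hDtop.eventually_gt_atTop 0).and
    (Ioo_mem_nhdsGT (show v0 < v0 + Real.pi by linarith))).exists
  obtain ⟨v2, hv2D, hv2⟩ := ((hDbot.eventually_lt_atBot 0).and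
    (Ioo_mem_nhdsLT (show v0 < v0 + Real.pi by linarith))).exists
  obtain ⟨v, hv, hvD⟩ := (isPreconnected_Ioo.intermediate_value hv2 hv1 hDc)
    (⟨hv2D.le, hv1D.le⟩ : (0 : ℝ) ∈ Icc (D v2) (D v1))
  set A := e.symm v with hAdef
  set B := e.symm (v + Real.pi) with hBdef
  have hA0 : 0 < A := by rw [← e0]; exact hm hv.1
  have hB2 : B < 2 * Real.pi := by rw [← e2]; exact hm (by linarith [hv.2])
  have hAB : A < B := hm (by linarith)
  have hSAB : S A = S B := by
    simp only [hD] at hvD; linarith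
  have hAQ : A < Q := by
    by_contra hle
    push Not at hle
    exact (hmono ⟨hle, hAB.trans hB2⟩ ⟨hle.trans hAB.le, hB2⟩ hAB).ne hSAB
  have hQB : Q < B := by
    by_contra hle
    push Not at hle
    exact (hanti ⟨hA0, hAQ.le⟩ ⟨hA0.trans hAB, hle⟩ hAB).ne hSAB.symm
  refine h.integral_ne_zero hS hA0.le hB2.le (l := S A) (A := A) (B := B) ?_ ?_ ?_
  · rw [hAdef, hBdef, hes, hes]
  · intro θ hθ
    rcases le_total θ Q with h3 | h3
    · exact hanti ⟨hA0, hAQ.le⟩ ⟨hA0.trans hθ.1, h3⟩ hθ.1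
    · rw [hSAB]
      exact hmono ⟨h3, hθ.2.trans hB2⟩ ⟨hQB.le, hB2⟩ hθ.2
  · rintro θ (hθ | hθ)
    · exact hanti ⟨hθ.1, (hθ.2.trans hAQ).le⟩ ⟨hA0, hAQ.le⟩ hθ.2
    · rw [hSAB]
      exact hmono ⟨hQB.le, hB2⟩ ⟨(hQB.trans hθ.1).le, hθ.2⟩ hθ.1

theorem neg_half_lt_re_div_one_sub {v : ℂ} (hv : ‖v‖ < 1) : -(1 / 2) < (v / (1 - v)).re := by
  have hne : 1 - v ≠ 0 := by
    intro h
    rw [← sub_eq_zero.mp h, norm_one] at hv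
    exact lt_irrefl _ hv
  have h1 : v / (1 - v) = (1 - v)⁻¹ - 1 := by field_simp; ring
  have hpos := normSq_pos.mpr hne
  rw [h1, sub_re, inv_re, one_re]
  have : 1 / 2 < (1 - v).re / normSq (1 - v) := by
    rw [lt_div_iff₀ hpos, normSq_apply]
    have h2 : normSq v < 1 := by rw [normSq_eq_norm_sq]; nlinarith [norm_nonneg v]
    rw [normSq_apply] at h2
    simp only [sub_re, one_re, sub_im, one_im]
    nlinarith
  linarith

theorem neg_half_le_re_div_one_add {w : ℂ} (hw : ‖w‖ ≤ 1 / 3) : -(1 / 2) ≤ (w / (1 + w)).re := by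
  have h0 : 2 / 3 ≤ ‖1 + w‖ := by
    have := norm_sub_norm_le (1 : ℂ) (-w)
    rw [norm_one, norm_neg, sub_neg_eq_add] at this
    linarith
  have h1 : ‖w / (1 + w)‖ ≤ 1 / 2 := by
    rw [norm_div, div_le_iff₀ (by linarith)]
    linarith
  linarith [(abs_le.mp ((abs_re_le_norm _).trans h1)).1]

/-- The kernel `v (1 + κ v) / (1 - v)` is starlike for `‖κ‖ ≤ 1 / 3`, so that its argument
turns monotonically along circles. -/
theorem exists_rotatingKernel {κ z : ℂ} (hκ : ‖κ‖ ≤ 1 / 3) (hz : ‖z‖ < 1) (hz0 : z ≠ 0) :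
    ∃ ω, RotatingKernel (fun θ => circleKernel κ z (circleMap 0 1 θ)) ω := by
  have hpi := Real.pi_pos
  set v : ℝ → ℂ := fun θ => z * exp (-(θ * I)) with hv
  have hvn : ∀ θ, ‖v θ‖ = ‖z‖ := fun θ => by simp [hv, norm_exp]
  have hvd : ∀ θ, HasDerivAt v (-(I * v θ)) θ := by
    intro θ
    have h1 : HasDerivAt (fun s : ℂ => z * exp (-(s * I))) (z * (exp (-(θ * I)) * -(1 * I)))
        (θ : ℂ) := (((hasDerivAt_id (θ : ℂ)).mul_const I).neg.cexp).const_mul z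
    refine h1.comp_ofReal.congr_deriv ?_
    simp only [hv]
    ring
  have hκv : ∀ θ, ‖κ * v θ‖ ≤ 1 / 3 := by
    intro θ
    rw [norm_mul, hvn]
    nlinarith [norm_nonneg κ, norm_nonneg z]
  have hs1 : ∀ θ, 1 - v θ ∈ slitPlane := fun θ =>
    one_sub_mem_slitPlane ((hvn θ).trans_le hz.le) fun h => by
      have := hvn θ
      rw [h, norm_one] at this
      linarith
  have hs2 : ∀ θ, 1 + κ * v θ ∈ slitPlane := fun θ => by
    have := one_sub_mem_slitPlane (u := -(κ * v θ)) (by rw [norm_neg]; linarith [hκv θ])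
      (fun h => by
        have := hκv θ
        rw [← norm_neg, h, norm_one] at this
        norm_num at this)
    rwa [sub_neg_eq_add] at this
  set E : ℝ → ℂ := fun θ => log z - θ * I + log (1 + κ * v θ) - log (1 - v θ) with hE
  have hEd : ∀ θ, HasDerivAt E (-I * (1 + κ * v θ / (1 + κ * v θ) + v θ / (1 - v θ))) θ := by
    intro θ
    have d1 := (((hvd θ).const_mul κ).const_add 1).clog_real (hs2 θ)
    have d2 := ((hvd θ).const_sub 1).clog_real (hs1 θ)
    have d3 : HasDerivAt (fun θ : ℝ => log z - θ * I) (-(1 * I)) θ :=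
      ((hasDerivAt_id (θ : ℂ)).mul_const I).comp_ofReal.const_sub (log z)
    refine ((d3.add d1).sub d2).congr_deriv ?_
    have := slitPlane_ne_zero (hs1 θ)
    have := slitPlane_ne_zero (hs2 θ)
    field_simp
    ring
  have hk : ∀ θ, circleKernel κ z (circleMap 0 1 θ) = exp (E θ) := by
    intro θ
    have h1 := slitPlane_ne_zero (hs1 θ)
    have h2 := slitPlane_ne_zero (hs2 θ)
    have hexp : exp (E θ) = v θ * (1 + κ * v θ) / (1 - v θ) := by
      simp only [hE]
      rw [exp_sub, exp_add, exp_sub, exp_log hz0, exp_log h1, exp_log h2]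
      simp only [hv, exp_neg]
      ring
    rw [hexp]
    have hu : circleMap 0 1 θ = exp (θ * I) := by simp [circleMap]
    have hue := exp_ne_zero (θ * I)
    have hvu : v θ = z / exp (θ * I) := by simp only [hv, exp_neg]; rfl
    have h3 : exp (θ * I) - z ≠ 0 := by
      rw [hvu] at h1
      intro h
      apply h1
      rw [← sub_eq_zero.mp h, div_self hue, sub_self]
    rw [circleKernel, hu, hvu]
    field_simp
  refine ⟨fun θ => -(E θ).im, ?_, ?_, ?_, ?_, ?_, ?_, ?_, ?_⟩
  · exact continuous_circleKernel_circleMap hz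
  · intro θ
    simp only [hk]
    exact exp_ne_zero _
  · intro θ
    simp only [hk, norm_exp]
    rw [ofReal_exp, ← exp_add]
    congr 1
    push_cast
    rw [neg_mul, neg_neg, re_add_im]
  · exact (continuous_im.comp (continuous_iff_continuousAt.mpr fun θ =>
      (hEd θ).continuousAt)).neg
  · refine strictMono_of_deriv_pos fun θ => ?_
    have h1 : HasDerivAt (fun θ => -(E θ).im)
        (-(-I * (1 + κ * v θ / (1 + κ * v θ) + v θ / (1 - v θ))).im) θ :=
      (imCLM.hasFDerivAt.comp_hasDerivAt θ (hEd θ)).neg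
    rw [h1.deriv]
    have h2 := neg_half_lt_re_div_one_sub ((hvn θ).trans_lt hz)
    have h3 := neg_half_le_re_div_one_add (hκv θ)
    simp only [neg_mul, neg_im, I_mul_im, neg_neg, add_re, one_re]
    linarith
  · refine ⟨3 * Real.pi, fun θ => ?_⟩
    have h1 := abs_arg_le_pi z
    have h2 := abs_arg_le_pi (1 + κ * v θ)
    have h3 := abs_arg_le_pi (1 - v θ)
    rw [abs_le] at *
    simp only [hE, sub_im, add_im, log_im, mul_im, ofReal_re, I_im, ofReal_im, I_re]
    constructor <;> linarith
  · have : v (2 * Real.pi) = v 0 := by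
      simp only [hv]
      congr 1
      push_cast
      rw [exp_neg, exp_two_pi_mul_I]
      simp
    simp only [hE, this, sub_im, add_im, log_im, mul_im, ofReal_re, I_im, ofReal_im, I_re]
    ring
  · have h1 := circleAverage_mul_circleKernel (κ := κ) hz (F := fun _ => 1) one_lt_two
      (differentiableOn_const 1)
    simp only [kernelOp, one_mul, sub_self, mul_zero, deriv_const, Real.circleAverage_def,
      smul_eq_zero, inv_eq_zero] at h1
    rcases h1 with h1 | h1
    · linarith
    · exact h1

/-- Let `S` increase or decrease according to the sign of
`sin ((θ - X) / 2) * sin (Φ θ - Φ X)`, where `Φ` increases by `2π` over a period. Then `S` is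
unimodal or monotone, and its integral against a rotating kernel does not vanish. -/
theorem RotatingKernel.integral_ne_zero_of_hasDerivAt {k : ℝ → ℂ} {ω : ℝ → ℝ}
    (h : RotatingKernel k ω) {Φ : ℝ → ℝ} (hΦc : Continuous Φ) (hΦ : StrictMono Φ)
    (hper : Φ (2 * Real.pi) = Φ 0 + 2 * Real.pi) {X : ℝ} (hX : X ∈ Ioo 0 (2 * Real.pi))
    {S ρ : ℝ → ℝ} (hρ : ∀ θ ∈ Ioo 0 (2 * Real.pi), 0 < ρ θ)
    (hder : ∀ θ ∈ Ioo 0 (2 * Real.pi),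
      HasDerivAt S (ρ θ * (Real.sin ((θ - X) / 2) * Real.sin (Φ θ - Φ X))) θ)
    (hS : IntervalIntegrable S MeasureTheory.volume 0 (2 * Real.pi))
    (htop : 0 < Real.sin (Φ 0 - Φ X) →
      Filter.Tendsto S (nhdsWithin 0 (Ioi 0)) Filter.atTop ∧
      Filter.Tendsto S (nhdsWithin (2 * Real.pi) (Iio (2 * Real.pi))) Filter.atTop)
    (hbot : Real.sin (Φ 0 - Φ X) < 0 →
      Filter.Tendsto S (nhdsWithin 0 (Ioi 0)) Filter.atBot ∧
      Filter.Tendsto S (nhdsWithin (2 * Real.pi) (Iio (2 * Real.pi))) Filter.atBot) :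
    ∫ θ in (0 : ℝ)..2 * Real.pi, (S θ : ℂ) * k θ ≠ 0 := by
  have hpi := Real.pi_pos
  have hc : ContinuousOn S (Ioo 0 (2 * Real.pi)) := fun θ hθ =>
    (hder θ hθ).continuousAt.continuousWithinAt
  have hX0 := hΦ hX.1
  have hX2 := hΦ hX.2
  -- the sign of the derivative
  have hhalfpos : ∀ θ ∈ Ioo 0 (2 * Real.pi), X < θ → 0 < Real.sin ((θ - X) / 2) := fun θ hθ hlt =>
    Real.sin_pos_of_pos_of_lt_pi (by linarith) (by linarith [hθ.2, hX.1])
  have hhalfneg : ∀ θ ∈ Ioo 0 (2 * Real.pi), θ < X → Real.sin ((θ - X) / 2) < 0 := fun θ hθ hlt =>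
    Real.sin_neg_of_neg_of_neg_pi_lt (by linarith) (by linarith [hθ.1, hX.2])
  have hincr : ∀ θ ∈ Ioo 0 (2 * Real.pi), θ ≠ X → Φ X - Real.pi < Φ θ → Φ θ < Φ X + Real.pi →
      0 < deriv S θ := by
    intro θ hθ hne h1 h2
    rw [(hder θ hθ).deriv]
    refine mul_pos (hρ θ hθ) ?_
    rcases lt_or_gt_of_ne hne with hlt | hgt
    · have := hΦ hlt
      exact mul_pos_of_neg_of_neg (hhalfneg θ hθ hlt)
        (Real.sin_neg_of_neg_of_neg_pi_lt (by linarith) (by linarith))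
    · have := hΦ hgt
      exact mul_pos (hhalfpos θ hθ hgt)
        (Real.sin_pos_of_pos_of_lt_pi (by linarith) (by linarith))
  have hdecl : ∀ θ ∈ Ioo 0 (2 * Real.pi), Φ θ < Φ X - Real.pi → deriv S θ < 0 := by
    intro θ hθ h1
    have hlt : θ < X := hΦ.lt_iff_lt.mp (by linarith)
    rw [(hder θ hθ).deriv]
    refine mul_neg_of_pos_of_neg (hρ θ hθ) (mul_neg_of_neg_of_pos (hhalfneg θ hθ hlt) ?_)
    have := hΦ hθ.1
    rw [← Real.sin_add_two_pi]
    exact Real.sin_pos_of_pos_of_lt_pi (by linarith) (by linarith)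
  have hdecr : ∀ θ ∈ Ioo 0 (2 * Real.pi), Φ X + Real.pi < Φ θ → deriv S θ < 0 := by
    intro θ hθ h1
    have hlt : X < θ := hΦ.lt_iff_lt.mp (by linarith)
    rw [(hder θ hθ).deriv]
    refine mul_neg_of_pos_of_neg (hρ θ hθ) (mul_neg_of_pos_of_neg (hhalfpos θ hθ hlt) ?_)
    have := hΦ hθ.2
    rw [← Real.sin_sub_two_pi]
    exact Real.sin_neg_of_neg_of_neg_pi_lt (by linarith) (by linarith)
  -- monotonicity on an interval around `X`
  have hinc : ∀ a b, 0 < a → b < 2 * Real.pi → a ≤ X → X ≤ b → Φ X - Real.pi ≤ Φ a →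
      Φ b ≤ Φ X + Real.pi → StrictMonoOn S (Icc a b) := by
    intro a b ha hb haX hXb h1 h2
    have hsub : Icc a b ⊆ Ioo 0 (2 * Real.pi) := fun θ hθ =>
      ⟨ha.trans_le hθ.1, hθ.2.trans_lt hb⟩
    have m1 : StrictMonoOn S (Icc a X) := by
      refine strictMonoOn_of_deriv_pos (convex_Icc _ _)
        (hc.mono ((Icc_subset_Icc_right hXb).trans hsub)) fun θ hθ => ?_
      rw [interior_Icc] at hθ
      exact hincr θ (hsub ⟨hθ.1.le, hθ.2.le.trans hXb⟩) hθ.2.ne (h1.trans_lt (hΦ hθ.1))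
        (by linarith [hΦ hθ.2])
    have m2 : StrictMonoOn S (Icc X b) := by
      refine strictMonoOn_of_deriv_pos (convex_Icc _ _)
        (hc.mono ((Icc_subset_Icc_left haX).trans hsub)) fun θ hθ => ?_
      rw [interior_Icc] at hθ
      exact hincr θ (hsub ⟨haX.trans hθ.1.le, hθ.2.le⟩) hθ.1.ne' (by linarith [hΦ hθ.1])
        ((hΦ hθ.2).trans_le h2)
    rw [← Icc_union_Icc_eq_Icc haX hXb]
    exact m1.union m2 (isGreatest_Icc haX) (isLeast_Icc hXb)
  rcases lt_trichotomy (Φ 0) (Φ X - Real.pi) with hlt | heq | hgt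
  · obtain ⟨h0, h1⟩ := htop (by
      rw [← Real.sin_add_two_pi]
      exact Real.sin_pos_of_pos_of_lt_pi (by linarith) (by linarith))
    obtain ⟨Q, hQ, hQΦ⟩ := intermediate_value_Icc hX.1.le hΦc.continuousOn
      (⟨hlt.le, by linarith⟩ : Φ X - Real.pi ∈ Icc (Φ 0) (Φ X))
    have hQ0 : 0 < Q := hΦ.lt_iff_lt.mp (by linarith)
    have hQX : Q < X := hΦ.lt_iff_lt.mp (by linarith)
    refine h.integral_ne_zero_of_valley hS hc (Q := Q) ?_ ?_ h0 h1
    · refine strictAntiOn_of_deriv_neg (convex_Ioc _ _)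
        (hc.mono fun θ hθ => ⟨hθ.1, hθ.2.trans_lt (hQX.trans hX.2)⟩) fun θ hθ => ?_
      rw [interior_Ioc] at hθ
      exact hdecl θ ⟨hθ.1, hθ.2.trans (hQX.trans hX.2)⟩ (by rw [← hQΦ]; exact hΦ hθ.2)
    · intro s hs t ht hst
      have hb : max X t < 2 * Real.pi := max_lt hX.2 ht.2
      exact hinc Q (max X t) hQ0 hb hQX.le (le_max_left _ _) hQΦ.ge
        (by linarith [hΦ hb]) ⟨hs.1, hst.le.trans (le_max_right _ _)⟩
        ⟨ht.1, le_max_right _ _⟩ hst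
  · obtain ⟨A, hA, hAω⟩ := intermediate_value_Icc (by linarith : (0 : ℝ) ≤ 2 * Real.pi)
      h.continuous_angle.continuousOn
      (⟨by linarith, by rw [h.period]; linarith⟩ : ω 0 + Real.pi ∈ Icc (ω 0) (ω (2 * Real.pi)))
    have hA0 : 0 < A := h.strictMono.lt_iff_lt.mp (by linarith)
    have hA2 : A < 2 * Real.pi := h.strictMono.lt_iff_lt.mp (by rw [h.period]; linarith)
    have hmono : StrictMonoOn S (Ioo 0 (2 * Real.pi)) := by
      intro s hs t ht hst
      have ha : 0 < min X s := lt_min hX.1 hs.1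
      have hb : max X t < 2 * Real.pi := max_lt hX.2 ht.2
      exact hinc (min X s) (max X t) ha hb (min_le_left _ _) (le_max_left _ _)
        (by linarith [hΦ ha]) (by linarith [hΦ hb])
        ⟨min_le_right _ _, hst.le.trans (le_max_right _ _)⟩
        ⟨(min_le_right _ _).trans hst.le, le_max_right _ _⟩ hst
    refine h.integral_ne_zero hS le_rfl hA2.le (l := S A) hAω ?_ ?_
    · exact fun θ hθ => hmono ⟨hθ.1, hθ.2.trans hA2⟩ ⟨hA0, hA2⟩ hθ.2
    · rintro θ (hθ | hθ)
      · exact absurd (hθ.1.trans hθ.2) (lt_irrefl _)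
      · exact hmono ⟨hA0, hA2⟩ ⟨hA0.trans hθ.1, hθ.2⟩ hθ.1
  · obtain ⟨h0, h1⟩ := hbot (Real.sin_neg_of_neg_of_neg_pi_lt (by linarith) (by linarith))
    obtain ⟨Q, hQ, hQΦ⟩ := intermediate_value_Icc hX.2.le hΦc.continuousOn
      (⟨by linarith, by linarith⟩ : Φ X + Real.pi ∈ Icc (Φ X) (Φ (2 * Real.pi)))
    have hQ2 : Q < 2 * Real.pi := hΦ.lt_iff_lt.mp (by linarith)
    have hQX : X < Q := hΦ.lt_iff_lt.mp (by linarith)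
    have key := h.integral_ne_zero_of_valley (S := fun θ => -S θ) hS.neg hc.neg (Q := Q) ?_ ?_
      (Filter.tendsto_neg_atBot_atTop.comp h0) (Filter.tendsto_neg_atBot_atTop.comp h1)
    · intro hzero
      apply key
      simp only [ofReal_neg, neg_mul, intervalIntegral.integral_neg, hzero, neg_zero]
    · intro s hs t ht hst
      have ha : 0 < min X s := lt_min hX.1 hs.1
      exact neg_lt_neg (hinc (min X s) Q ha hQ2 (min_le_left _ _) hQX.le
        (by linarith [hΦ ha]) hQΦ.le ⟨min_le_right _ _, hst.le.trans ht.2⟩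
        ⟨(min_le_right _ _).trans hst.le, ht.2⟩ hst)
    · have : StrictAntiOn S (Ico Q (2 * Real.pi)) := by
        refine strictAntiOn_of_deriv_neg (convex_Ico _ _)
          (hc.mono fun θ hθ => ⟨(hX.1.trans hQX).trans_le hθ.1, hθ.2⟩) fun θ hθ => ?_
        rw [interior_Ico] at hθ
        exact hdecr θ ⟨(hX.1.trans hQX).trans hθ.1, hθ.2⟩ (by rw [← hQΦ]; exact hΦ hθ.1)
      exact fun s hs t ht hst => neg_lt_neg (this hs ht hst)

/-! ### The transform of a close-to-convex function -/

/-- A nonvanishing holomorphic function on a disk has a holomorphic logarithm. -/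
theorem exists_exp_eq_on_ball {q : ℂ → ℂ} {R : ℝ} (hR : 0 < R)
    (hq : DifferentiableOn ℂ q (ball 0 R)) (hq0 : ∀ u ∈ ball (0 : ℂ) R, q u ≠ 0) :
    ∃ l : ℂ → ℂ, (∀ u ∈ ball (0 : ℂ) R, HasDerivAt l (deriv q u / q u) u) ∧
      ∀ u ∈ ball (0 : ℂ) R, exp (l u) = q u := by
  have h0 : (0 : ℂ) ∈ ball (0 : ℂ) R := mem_ball_self hR
  obtain ⟨l, hl0, hl⟩ := DifferentiableOn.isExactOn_ball
    ((hq.deriv isOpen_ball).div hq hq0) |>.with_val_at 0 (log (q 0))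
  have hd : ∀ u ∈ ball (0 : ℂ) R, HasDerivAt (fun u => exp (-l u) * q u) 0 u := by
    intro u hu
    have h1 := (hl u hu).neg.cexp.mul
      (hq.differentiableAt (isOpen_ball.mem_nhds hu)).hasDerivAt
    refine h1.congr_deriv ?_
    have := hq0 u hu
    simp only [Pi.div_apply, Pi.neg_apply]
    field_simp
    ring
  refine ⟨l, hl, fun u hu => ?_⟩
  have hconst := isOpen_ball.is_const_of_deriv_eq_zero (convex_ball (0 : ℂ) R).isPreconnected
    (fun w hw => (hd w hw).differentiableAt.differentiableWithinAt)
    (fun w hw => (hd w hw).deriv) hu h0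
  simp only [hl0] at hconst
  rw [exp_neg, exp_neg, exp_log (hq0 0 h0), inv_mul_cancel₀ (hq0 0 h0)] at hconst
  have := exp_ne_zero (l u)
  field_simp at hconst
  exact hconst.symm

theorem sub_eq_sub_of_hasDerivAt {f f₂ F : ℂ → ℂ}
    (hf : ∀ u ∈ ball (0 : ℂ) 1, HasDerivAt f (F u) u)
    (hf₂ : ∀ u ∈ ball (0 : ℂ) 1, HasDerivAt f₂ (F u) u) {z : ℂ} (hz : ‖z‖ < 1) :
    f z - f 0 = f₂ z - f₂ 0 := by
  have hd : ∀ u ∈ ball (0 : ℂ) 1, HasDerivAt (fun u => f u - f₂ u) 0 u := fun u hu =>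
    ((hf u hu).sub (hf₂ u hu)).congr_deriv (sub_self _)
  have := isOpen_ball.is_const_of_deriv_eq_zero (convex_ball (0 : ℂ) 1).isPreconnected
    (fun w hw => (hd w hw).differentiableAt.differentiableWithinAt)
    (fun w hw => (hd w hw).deriv) (show z ∈ ball (0 : ℂ) 1 by simpa using hz)
    (mem_ball_self one_pos)
  linear_combination this

theorem kernelOp_congr {f f₂ F : ℂ → ℂ}
    (hf : ∀ u ∈ ball (0 : ℂ) 1, HasDerivAt f (F u) u)
    (hf₂ : ∀ u ∈ ball (0 : ℂ) 1, HasDerivAt f₂ (F u) u) {κ z : ℂ} (hz : ‖z‖ < 1) :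
    kernelOp κ z f = kernelOp κ z f₂ := by
  have h0 : (0 : ℂ) ∈ ball (0 : ℂ) 1 := mem_ball_self one_pos
  rw [kernelOp, kernelOp, sub_eq_sub_of_hasDerivAt hf hf₂ hz, (hf 0 h0).deriv, (hf₂ 0 h0).deriv]

theorem tendsto_log_norm_one_sub_circleMap {θ₀ : ℝ} (h : circleMap 0 1 θ₀ = 1) {l : Filter ℝ}
    (hl : l ≤ nhds θ₀) (hmem : ∀ᶠ θ in l, θ ∈ Ioo 0 (2 * Real.pi)) :
    Filter.Tendsto (fun θ => Real.log ‖1 - circleMap 0 1 θ‖) l Filter.atBot := by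
  refine Real.tendsto_log_nhdsNE_zero.comp (tendsto_nhdsWithin_iff.mpr ⟨?_, ?_⟩)
  · have hc : Continuous fun θ => ‖1 - circleMap 0 1 θ‖ :=
      (continuous_const.sub (continuous_circleMap 0 1)).norm
    have := hc.tendsto θ₀
    rw [h, sub_self, norm_zero] at this
    exact this.mono_left hl
  · filter_upwards [hmem] with θ hθ
    exact norm_ne_zero_iff.mpr (sub_ne_zero.mpr (circleMap_ne_one hθ).symm)

/-- On the circle, `(1 + u) / (1 - u)` is purely imaginary; up to a positive factor,
`(1 + u) / (1 - u) + τ i` is `-i sin ((θ - X) / 2)` with `X = π + 2 arctan τ`. -/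
theorem one_add_div_one_sub_circleMap {θ : ℝ} (hθ : θ ∈ Ioo 0 (2 * Real.pi)) (τ : ℝ) :
    (1 + circleMap 0 1 θ) / (1 - circleMap 0 1 θ) + τ * I =
      I * ((-(Real.sin ((θ - (Real.pi + 2 * Real.arctan τ)) / 2) /
        (Real.sin (θ / 2) * Real.cos (Real.arctan τ))) : ℝ) : ℂ) := by
  have hs : Real.sin (θ / 2) ≠ 0 :=
    (Real.sin_pos_of_pos_of_lt_pi (by linarith [hθ.1]) (by linarith [hθ.2])).ne'
  have hca := (Real.cos_arctan_pos τ).ne'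
  set a := Real.arctan τ with ha
  set c := Real.cos (θ / 2) with hc
  set s := Real.sin (θ / 2) with hsdef
  have hu : circleMap 0 1 θ = (c + s * I) ^ 2 := by
    rw [circleMap_zero, ofReal_one, one_mul, hc, hsdef, ofReal_cos, ofReal_sin, ← exp_mul_I,
      ← exp_nat_mul]
    congr 1
    push_cast
    ring
  have hcs : (c : ℂ) ^ 2 + (s : ℂ) ^ 2 = 1 := by
    exact_mod_cast Real.cos_sq_add_sin_sq (θ / 2)
  have hE : (c + s * I : ℂ) ≠ 0 := by
    intro h
    have h1 := congrArg re h
    have h2 := congrArg im h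
    simp at h1 h2
    exact hs h2
  have h1 : 1 - (c + s * I : ℂ) ^ 2 = -2 * I * s * (c + s * I) := by
    linear_combination -hcs + (s : ℂ) ^ 2 * I_sq
  have h2 : 1 + (c + s * I : ℂ) ^ 2 = 2 * c * (c + s * I) := by
    linear_combination -hcs + (s : ℂ) ^ 2 * I_sq
  have hsin : Real.sin ((θ - (Real.pi + 2 * a)) / 2) = -(s * Real.sin a + c * Real.cos a) := by
    have : (θ - (Real.pi + 2 * a)) / 2 = (θ / 2 - a) - Real.pi / 2 := by ring
    rw [this, Real.sin_sub_pi_div_two, Real.cos_sub]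
    ring
  have hτ : τ = Real.sin a / Real.cos a := by
    rw [← Real.tan_eq_sin_div_cos, ha, Real.tan_arctan]
  have hsC : (s : ℂ) ≠ 0 := ofReal_ne_zero.mpr hs
  have hcaC : Complex.cos (a : ℂ) ≠ 0 := by rw [← ofReal_cos]; exact ofReal_ne_zero.mpr hca
  rw [hu, h1, h2, hsin]
  have hτC : (τ : ℂ) = Real.sin a / Real.cos a := by rw [← ofReal_div, ← hτ]
  rw [hτC, show 2 * (c : ℂ) * (c + s * I) / (-2 * I * s * (c + s * I)) = I * (c / s) by
    field_simp
    linear_combination -(c : ℂ) * I_sq]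
  push_cast
  field_simp
  ring

/-- Let `f' = ((1 + u) / (1 - u) + τ i) q`, where `∫ q` is convex. Then the real part of a
suitable rotation of `f` is unimodal on the circle, so that `kernelOp κ z f ≠ 0`. -/
theorem kernelOp_ne_zero {q f : ℂ → ℂ} {R : ℝ} (hR : 1 < R)
    (hq : DifferentiableOn ℂ q (ball 0 R)) (hq0 : ∀ u ∈ ball (0 : ℂ) R, q u ≠ 0)
    (hpos : ∀ u ∈ ball (0 : ℂ) R, 0 < (1 + u * deriv q u / q u).re) (τ : ℝ)
    (hf : ∀ u ∈ ball (0 : ℂ) 1, HasDerivAt f (((1 + u) / (1 - u) + τ * I) * q u) u)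
    {κ z : ℂ} (hκ : ‖κ‖ ≤ 1 / 3) (hz : ‖z‖ < 1) (hz0 : z ≠ 0) : kernelOp κ z f ≠ 0 := by
  have hpi := Real.pi_pos
  have hsub : closedBall (0 : ℂ) 1 ⊆ ball 0 R := closedBall_subset_ball hR
  have h1R : (1 : ℂ) ∈ ball (0 : ℂ) R := hsub (by simp)
  have hcR : ∀ θ : ℝ, circleMap 0 1 θ ∈ ball (0 : ℂ) R := fun θ => hsub (by simp)
  obtain ⟨ω, hω⟩ := exists_rotatingKernel hκ hz hz0
  obtain ⟨l, hl, hlexp⟩ := exists_exp_eq_on_ball (by linarith) hq hq0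
  -- `f` is a logarithm plus a function holomorphic on a larger disk
  have hQ : DifferentiableOn ℂ (fun u => q u * (1 + u)) (ball 0 R) :=
    hq.mul ((differentiableOn_const 1).add differentiableOn_id)
  obtain ⟨β, hβ⟩ := DifferentiableOn.isExactOn_ball
    ((hq.const_mul (τ * I)).sub
      ((Complex.differentiableOn_dslope (isOpen_ball.mem_nhds h1R)).mpr hQ))
  have hβd : DifferentiableOn ℂ β (ball 0 R) := fun u hu =>
    (hβ u hu).differentiableAt.differentiableWithinAt
  set f₂ : ℂ → ℂ := fun u => -2 * q 1 * log (1 - u) + β u with hf₂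
  have hf₂d : ∀ u ∈ ball (0 : ℂ) R, 1 - u ∈ slitPlane →
      HasDerivAt f₂ (((1 + u) / (1 - u) + τ * I) * q u) u := by
    intro u hu hs
    have hu1 : u ≠ 1 := by
      rintro rfl
      exact slitPlane_ne_zero hs (sub_self _)
    have h1 := ((((hasDerivAt_id u).const_sub 1).clog hs).const_mul (-2 * q 1)).add (hβ u hu)
    refine h1.congr_deriv ?_
    have h3 : 1 - u ≠ 0 := sub_ne_zero.mpr hu1.symm
    simp only [Pi.sub_apply, dslope_of_ne _ hu1, slope_def_field, id_eq]
    rw [← neg_sub 1 u, div_neg]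
    field_simp
    ring
  have hball : ∀ u ∈ ball (0 : ℂ) 1, 1 - u ∈ slitPlane := fun u hu => by
    have hu' : ‖u‖ < 1 := by simpa using hu
    exact one_sub_mem_slitPlane hu'.le (by rintro rfl; simp at hu')
  have hcong : kernelOp κ z f = kernelOp κ z f₂ := kernelOp_congr hf
    (fun u hu => hf₂d u (hsub (ball_subset_closedBall hu)) (hball u hu)) hz
  -- the argument of the tangent to the image of the circle under `∫ q`
  set Φ : ℝ → ℝ := fun θ => θ + (l (circleMap 0 1 θ)).im with hΦdef
  have hΦd : ∀ θ, HasDerivAt Φ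
      (1 + (deriv q (circleMap 0 1 θ) / q (circleMap 0 1 θ) * (circleMap 0 1 θ * I)).im) θ := by
    intro θ
    have h1 := (hl _ (hcR θ)).scomp θ (hasDerivAt_circleMap 0 1 θ)
    have h2 := (hasDerivAt_id θ).add (imCLM.hasFDerivAt.comp_hasDerivAt θ h1)
    refine h2.congr_deriv ?_
    simp only [imCLM_apply, smul_eq_mul]
    rw [mul_comm (circleMap 0 1 θ * I)]
  have hΦc : Continuous Φ := continuous_iff_continuousAt.mpr fun θ => (hΦd θ).continuousAt
  have hΦ : StrictMono Φ := by
    refine strictMono_of_deriv_pos fun θ => ?_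
    rw [(hΦd θ).deriv]
    have h1 := hpos _ (hcR θ)
    rw [show deriv q (circleMap 0 1 θ) / q (circleMap 0 1 θ) * (circleMap 0 1 θ * I) =
      circleMap 0 1 θ * deriv q (circleMap 0 1 θ) / q (circleMap 0 1 θ) * I by ring, mul_I_im]
    simpa using h1
  have hone : circleMap 0 1 0 = 1 := by simp [circleMap]
  have htwo : circleMap 0 1 (2 * Real.pi) = 1 := by
    rw [circleMap_zero, ofReal_one, one_mul]
    push_cast
    exact exp_two_pi_mul_I
  have hper : Φ (2 * Real.pi) = Φ 0 + 2 * Real.pi := by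
    simp only [hΦdef, hone, htwo]; ring
  set X := Real.pi + 2 * Real.arctan τ with hXdef
  have hX : X ∈ Ioo 0 (2 * Real.pi) :=
    ⟨by linarith [Real.neg_pi_div_two_lt_arctan τ], by linarith [Real.arctan_lt_pi_div_two τ]⟩
  set ed : ℂ := -I * exp (-(Φ X * I)) with hed
  have hed0 : ed ≠ 0 := mul_ne_zero (neg_ne_zero.mpr I_ne_zero) (exp_ne_zero _)
  set S : ℝ → ℝ := fun θ => (ed * f₂ (circleMap 0 1 θ)).re with hS
  have huq : ∀ θ, circleMap 0 1 θ * q (circleMap 0 1 θ) =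
      ‖q (circleMap 0 1 θ)‖ * exp (Φ θ * I) := by
    intro θ
    have hu : circleMap 0 1 θ = exp (θ * I) := by simp [circleMap]
    rw [← hlexp _ (hcR θ), norm_exp, ofReal_exp, ← exp_add]
    calc circleMap 0 1 θ * exp (l (circleMap 0 1 θ))
        = exp (θ * I) * exp (l (circleMap 0 1 θ)) := by rw [← hu]
      _ = exp (θ * I + l (circleMap 0 1 θ)) := (exp_add _ _).symm
      _ = _ := by
        congr 1
        simp only [hΦdef]
        push_cast
        nth_rw 1 [← re_add_im (l (circleMap 0 1 θ))]
        ring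
  have hexp : ∀ θ : ℝ, ed * exp (Φ θ * I) = -I * exp (((Φ θ - Φ X : ℝ) : ℂ) * I) := by
    intro θ
    rw [hed, mul_assoc, ← exp_add]
    congr 2
    push_cast
    ring
  have hSd : ∀ θ ∈ Ioo 0 (2 * Real.pi), HasDerivAt S
      (‖q (circleMap 0 1 θ)‖ / (Real.sin (θ / 2) * Real.cos (Real.arctan τ)) *
        (Real.sin ((θ - X) / 2) * Real.sin (Φ θ - Φ X))) θ := by
    intro θ hθ
    have hs := one_sub_mem_slitPlane (u := circleMap 0 1 θ) (by simp) (circleMap_ne_one hθ)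
    have h1 := ((hf₂d _ (hcR θ) hs).scomp θ (hasDerivAt_circleMap 0 1 θ)).const_mul ed
    have h2 := reCLM.hasFDerivAt.comp_hasDerivAt θ h1
    refine h2.congr_deriv ?_
    rw [one_add_div_one_sub_circleMap hθ τ, ← hXdef]
    set w : ℝ := -(Real.sin ((θ - X) / 2) / (Real.sin (θ / 2) * Real.cos (Real.arctan τ)))
    have h3 : ed * ((circleMap 0 1 θ * I) • (I * (w : ℂ) * q (circleMap 0 1 θ))) =
        ((w * ‖q (circleMap 0 1 θ)‖ : ℝ) : ℂ) * (I * exp (((Φ θ - Φ X : ℝ) : ℂ) * I)) := by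
      have h4 := hexp θ
      have h5 := huq θ
      rw [smul_eq_mul]
      push_cast at h4 ⊢
      linear_combination ed * I * I * w * h5 + I * I * w * ‖q (circleMap 0 1 θ)‖ * h4 -
        (w * ‖q (circleMap 0 1 θ)‖ * I * exp ((Φ θ - Φ X) * I)) * I_sq
    rw [h3, reCLM_apply, re_ofReal_mul, I_mul_re, exp_ofReal_mul_I_im]
    simp only [w]
    ring
  -- behaviour at the singularity
  have hm : (ed * q 1).re = ‖q 1‖ * Real.sin (Φ 0 - Φ X) := by
    have h1 := huq 0
    rw [hone, one_mul] at h1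
    have h2 := hexp 0
    have h3 : ed * q 1 = (‖q 1‖ : ℂ) * (-I * exp (((Φ 0 - Φ X : ℝ) : ℂ) * I)) := by
      rw [← h2]
      linear_combination ed * h1
    rw [h3, re_ofReal_mul, neg_mul, neg_re, I_mul_re, exp_ofReal_mul_I_im, neg_neg]
  have hq1 : 0 < ‖q 1‖ := norm_pos_iff.mpr (hq0 1 h1R)
  have hβc : Continuous fun θ : ℝ => β (circleMap 0 1 θ) :=
    hβd.continuousOn.comp_continuous (continuous_circleMap 0 1) hcR
  obtain ⟨C, hC⟩ : ∃ C, ∀ θ, |S θ - -2 * (ed * q 1).re * Real.log ‖1 - circleMap 0 1 θ‖| ≤ C := by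
    obtain ⟨B, hB⟩ := (isCompact_sphere (0 : ℂ) 1).exists_bound_of_continuousOn
      (hβd.continuousOn.mono (sphere_subset_closedBall.trans hsub))
    refine ⟨2 * ‖ed * q 1‖ * Real.pi + ‖ed‖ * B, fun θ => ?_⟩
    have h1 : S θ - -2 * (ed * q 1).re * Real.log ‖1 - circleMap 0 1 θ‖ =
        2 * (ed * q 1).im * arg (1 - circleMap 0 1 θ) + (ed * β (circleMap 0 1 θ)).re := by
      have : ed * f₂ (circleMap 0 1 θ) = -2 * ((ed * q 1) * log (1 - circleMap 0 1 θ)) +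
          ed * β (circleMap 0 1 θ) := by simp only [hf₂]; ring
      simp only [hS]
      rw [this, add_re, mul_re (-2), mul_re (ed * q 1), log_re, log_im]
      simp
      ring
    rw [h1]
    refine (abs_add_le _ _).trans (add_le_add ?_ ?_)
    · rw [abs_mul, abs_mul, abs_two]
      gcongr
      · exact abs_im_le_norm _
      · exact abs_arg_le_pi _
    · refine (abs_re_le_norm _).trans ?_
      rw [norm_mul]
      gcongr
      exact hB _ (by simp)
  have hlogs : Filter.Tendsto (fun θ => Real.log ‖1 - circleMap 0 1 θ‖)
        (nhdsWithin 0 (Ioi 0)) Filter.atBot ∧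
      Filter.Tendsto (fun θ => Real.log ‖1 - circleMap 0 1 θ‖)
        (nhdsWithin (2 * Real.pi) (Iio (2 * Real.pi))) Filter.atBot :=
    ⟨tendsto_log_norm_one_sub_circleMap hone nhdsWithin_le_nhds
      (Ioo_mem_nhdsGT (by linarith)),
    tendsto_log_norm_one_sub_circleMap htwo nhdsWithin_le_nhds
      (Ioo_mem_nhdsLT (by linarith))⟩
  have htop : ∀ F : Filter ℝ, 0 < Real.sin (Φ 0 - Φ X) →
      Filter.Tendsto (fun θ => Real.log ‖1 - circleMap 0 1 θ‖) F Filter.atBot →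
      Filter.Tendsto S F Filter.atTop := by
    intro F hsin hF
    have hneg : -2 * (ed * q 1).re < 0 := by rw [hm]; nlinarith
    refine Filter.tendsto_atTop_mono (fun θ => ?_)
      (Filter.tendsto_atTop_add_const_right _ (-C) (hF.const_mul_atBot_of_neg hneg))
    linarith [(abs_le.mp (hC θ)).1]
  have hbot : ∀ F : Filter ℝ, Real.sin (Φ 0 - Φ X) < 0 →
      Filter.Tendsto (fun θ => Real.log ‖1 - circleMap 0 1 θ‖) F Filter.atBot →
      Filter.Tendsto S F Filter.atBot := by
    intro F hsin hF
    have hp : 0 < -2 * (ed * q 1).re := by rw [hm]; nlinarith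
    refine Filter.tendsto_atBot_mono (fun θ => ?_)
      (Filter.tendsto_atBot_add_const_right _ C (hF.const_mul_atBot hp))
    linarith [(abs_le.mp (hC θ)).2]
  -- the integral of `S`
  obtain ⟨hi1, hv1⟩ := integral_re_log_mul_circleKernel (κ := κ) hz (ed * (-2 * q 1))
  have hedβ : DifferentiableOn ℂ (fun u => ed * β u) (ball 0 R) := hβd.const_mul ed
  have hv2 := integral_re_mul_circleKernel (κ := κ) hz hR hedβ
  have hi2 : Continuous fun θ : ℝ => (ed * β (circleMap 0 1 θ)).re :=
    continuous_re.comp (continuous_const.mul hβc)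
  have hSsplit : S = fun θ => (ed * (-2 * q 1) * log (1 - circleMap 0 1 θ)).re +
      (ed * β (circleMap 0 1 θ)).re := by
    funext θ
    simp only [hS, hf₂]
    rw [← add_re]
    congr 1
    ring
  have hSi : IntervalIntegrable S MeasureTheory.volume 0 (2 * Real.pi) := by
    rw [hSsplit]
    exact hi1.add (hi2.intervalIntegrable _ _)
  have key := hω.integral_ne_zero_of_hasDerivAt hΦc hΦ hper hX
    (ρ := fun θ => ‖q (circleMap 0 1 θ)‖ / (Real.sin (θ / 2) * Real.cos (Real.arctan τ)))
    (fun θ hθ => div_pos (norm_pos_iff.mpr (hq0 _ (hcR θ)))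
      (mul_pos (Real.sin_pos_of_pos_of_lt_pi (by linarith [hθ.1]) (by linarith [hθ.2]))
        (Real.cos_arctan_pos τ))) hSd hSi
    (fun hs => ⟨htop _ hs hlogs.1, htop _ hs hlogs.2⟩)
    (fun hs => ⟨hbot _ hs hlogs.1, hbot _ hs hlogs.2⟩)
  intro hzero
  apply key
  have hkc := continuous_circleKernel_circleMap (κ := κ) hz
  have hi1C : IntervalIntegrable
      (fun θ : ℝ => (((ed * (-2 * q 1) * log (1 - circleMap 0 1 θ)).re : ℝ) : ℂ))
      MeasureTheory.volume 0 (2 * Real.pi) := by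
    simp only [intervalIntegrable_iff] at hi1 ⊢
    exact Complex.ofRealCLM.integrable_comp hi1
  rw [hSsplit]
  simp only [ofReal_add, add_mul]
  have hi3 : IntervalIntegrable (fun θ : ℝ => (((ed * β (circleMap 0 1 θ)).re : ℝ) : ℂ) *
      circleKernel κ z (circleMap 0 1 θ)) MeasureTheory.volume 0 (2 * Real.pi) :=
    ((continuous_ofReal.comp hi2).mul hkc).intervalIntegrable _ _
  rw [intervalIntegral.integral_add (hi1C.mul_continuousOn hkc.continuousOn) hi3, hv1, hv2,
    ← mul_add]
  have h0R : (0 : ℂ) ∈ ball (0 : ℂ) R := hsub (by simp)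
  have hdβ : deriv (fun u => ed * β u) 0 = ed * deriv β 0 :=
    deriv_const_mul _ (hβ 0 h0R).differentiableAt
  have hdf₂ : deriv f₂ 0 = 2 * q 1 + deriv β 0 := by
    have h1 := ((((hasDerivAt_id (0 : ℂ)).const_sub 1).clog (by simp)).const_mul (-2 * q 1)).add
      (hβ 0 h0R).differentiableAt.hasDerivAt
    refine h1.deriv.trans ?_
    simp
  rw [hcong] at hzero
  have : ed * (-2 * q 1) * ((1 + κ) * log (1 - z) + κ * z) + kernelOp κ z (fun u => ed * β u) =
      ed * kernelOp κ z f₂ := by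
    simp only [kernelOp, hdβ, hdf₂]
    simp only [hf₂, sub_zero, log_one]
    ring
  rw [this, hzero, mul_zero, mul_zero]

theorem kernelOp_eq_mul_dslope (κ w : ℂ) (f : ℂ → ℂ) :
    kernelOp κ w f = w * ((1 + κ) * dslope f 0 w - κ * deriv f 0) := by
  rcases eq_or_ne w 0 with rfl | hw
  · simp [kernelOp]
  · rw [kernelOp, dslope_of_ne _ hw, slope_def_field, sub_zero]
    field_simp

theorem differentiableOn_ball_of_hasDerivAt {f F : ℂ → ℂ} {R : ℝ}
    (hf : ∀ u ∈ ball (0 : ℂ) R, HasDerivAt f (F u) u) : DifferentiableOn ℂ f (ball 0 R) :=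
  fun u hu => (hf u hu).differentiableAt.differentiableWithinAt

/-- The rotated form of `kernelOp_ne_zero`. -/
theorem kernelOp_ne_zero_of_norm_eq_one {q f : ℂ → ℂ} {R : ℝ} (hR : 1 < R)
    (hq : DifferentiableOn ℂ q (ball 0 R)) (hq0 : ∀ u ∈ ball (0 : ℂ) R, q u ≠ 0)
    (hpos : ∀ u ∈ ball (0 : ℂ) R, 0 < (1 + u * deriv q u / q u).re) {y : ℂ} (hy : ‖y‖ = 1) (τ : ℝ)
    (hf : ∀ u ∈ ball (0 : ℂ) 1, HasDerivAt f (((y + u) / (y - u) + τ * I) * q u) u)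
    {κ z : ℂ} (hκ : ‖κ‖ ≤ 1 / 3) (hz : ‖z‖ < 1) (hz0 : z ≠ 0) : kernelOp κ z f ≠ 0 := by
  have hy0 : y ≠ 0 := by rintro rfl; simp at hy
  have hmem : ∀ {r : ℝ} {v : ℂ}, v ∈ ball (0 : ℂ) r → y * v ∈ ball (0 : ℂ) r := by
    intro r v hv
    simpa [hy] using hv
  have hmuld : ∀ v : ℂ, HasDerivAt (fun v => y * v) y v := fun v => by
    simpa using (hasDerivAt_id v).const_mul y
  have hqd : ∀ v ∈ ball (0 : ℂ) R,
      HasDerivAt (fun v => y * q (y * v)) (y * (deriv q (y * v) * y)) v :=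
    fun v hv => ((hq.differentiableAt (isOpen_ball.mem_nhds (hmem hv))).hasDerivAt.comp v
      (hmuld v)).const_mul y
  have hfd : ∀ v ∈ ball (0 : ℂ) 1, HasDerivAt (fun v => f (y * v))
      (((1 + v) / (1 - v) + τ * I) * (y * q (y * v))) v := by
    intro v hv
    refine ((hf _ (hmem hv)).comp v (hmuld v)).congr_deriv ?_
    have h1 : (y + y * v) / (y - y * v) = (1 + v) / (1 - v) := by
      rw [← mul_one_add, ← mul_one_sub, mul_div_mul_left _ _ hy0]
    rw [h1]
    ring
  have key := kernelOp_ne_zero (q := fun v => y * q (y * v)) (f := fun v => f (y * v)) hR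
    (differentiableOn_ball_of_hasDerivAt hqd)
    (fun v hv => mul_ne_zero hy0 (hq0 _ (hmem hv)))
    (fun v hv => by
      rw [(hqd v hv).deriv]
      have h1 := hpos _ (hmem hv)
      have h2 := hq0 _ (hmem hv)
      rwa [show v * (y * (deriv q (y * v) * y)) / (y * q (y * v)) =
        y * v * deriv q (y * v) / q (y * v) by field_simp])
    τ hfd hκ (z := y⁻¹ * z) (by simpa [hy] using hz) (mul_ne_zero (inv_ne_zero hy0) hz0)
  have h0 : (0 : ℂ) ∈ ball (0 : ℂ) 1 := mem_ball_self one_pos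
  intro hzero
  apply key
  have hd1 := (hfd 0 h0).deriv
  have hd2 := (hf 0 h0).deriv
  rw [kernelOp] at hzero ⊢
  rw [hd1]
  rw [hd2] at hzero
  simp only [mul_inv_cancel_left₀ hy0, mul_zero, add_zero, sub_zero, div_self hy0] at hzero ⊢
  refine Eq.trans ?_ hzero
  rw [div_one]
  field_simp

theorem re_kernelOp_div_pos_of_norm_eq_one {q G f : ℂ → ℂ} {R : ℝ} (hR : 1 < R)
    (hq : DifferentiableOn ℂ q (ball 0 R)) (hq0 : ∀ u ∈ ball (0 : ℂ) R, q u ≠ 0)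
    (hpos : ∀ u ∈ ball (0 : ℂ) R, 0 < (1 + u * deriv q u / q u).re)
    (hG : ∀ u ∈ ball (0 : ℂ) 1, HasDerivAt G (q u) u) {y : ℂ} (hy : ‖y‖ = 1)
    (hf : ∀ u ∈ ball (0 : ℂ) 1, HasDerivAt f ((y + u) / (y - u) * q u) u)
    {κ z : ℂ} (hκ : ‖κ‖ ≤ 1 / 3) (hM : ∀ w ∈ ball (0 : ℂ) 1, w ≠ 0 → kernelOp κ w G ≠ 0)
    (hz : ‖z‖ < 1) (hz0 : z ≠ 0) : 0 < (kernelOp κ z f / kernelOp κ z G).re := by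
  have hy0 : y ≠ 0 := by rintro rfl; simp at hy
  have h0 : (0 : ℂ) ∈ ball (0 : ℂ) 1 := mem_ball_self one_pos
  have h0R : (0 : ℂ) ∈ ball (0 : ℂ) R := mem_ball_self (by linarith)
  have hq00 := hq0 0 h0R
  have hdG : deriv G 0 = q 0 := (hG 0 h0).deriv
  have hdf : deriv f 0 = q 0 := by rw [(hf 0 h0).deriv]; simp [hy0]
  have hcont : ∀ {F : ℂ → ℂ}, DifferentiableOn ℂ F (ball 0 1) →
      ContinuousOn (fun w => (1 + κ) * dslope F 0 w - κ * deriv F 0) (ball 0 1) := fun hF =>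
    (continuousOn_const.mul ((Complex.differentiableOn_dslope
      (isOpen_ball.mem_nhds h0)).mpr hF).continuousOn).sub continuousOn_const
  set m : ℂ → ℂ := fun w => (1 + κ) * dslope f 0 w - κ * deriv f 0 with hm
  set n : ℂ → ℂ := fun w => (1 + κ) * dslope G 0 w - κ * deriv G 0 with hn
  have hn0 : n 0 = q 0 := by simp only [hn, dslope_same, hdG]; ring
  have hm0 : m 0 = q 0 := by simp only [hm, dslope_same, hdf]; ring
  have hne : ∀ w ∈ ball (0 : ℂ) 1, n w ≠ 0 := by
    intro w hw
    rcases eq_or_ne w 0 with rfl | hw0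
    · rwa [hn0]
    · have := hM w hw hw0
      rw [kernelOp_eq_mul_dslope] at this
      exact right_ne_zero_of_mul this
  have hJc : ContinuousOn (fun w => (m w / n w).re) (ball 0 1) :=
    continuous_re.comp_continuousOn ((hcont (differentiableOn_ball_of_hasDerivAt hf)).div
      (hcont (differentiableOn_ball_of_hasDerivAt hG)) hne)
  -- a purely imaginary quotient is excluded by `kernelOp_ne_zero_of_norm_eq_one`
  have hJne : ∀ w ∈ ball (0 : ℂ) 1, (m w / n w).re ≠ 0 := by
    intro w hw hre
    rcases eq_or_ne w 0 with rfl | hw0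
    · rw [hn0, hm0, div_self hq00] at hre
      simp at hre
    · set τ := (m w / n w).im with hτ
      have hJ : m w / n w = τ * I := by
        rw [← re_add_im (m w / n w), hre]
        simp [hτ]
      have hw1 : ‖w‖ < 1 := by simpa using hw
      refine kernelOp_ne_zero_of_norm_eq_one (f := fun u => f u - τ * I * G u) hR hq hq0 hpos hy
        (-τ) ?_ hκ hw1 hw0 ?_
      · intro u hu
        refine ((hf u hu).sub ((hG u hu).const_mul (τ * I))).congr_deriv ?_
        push_cast
        ring
      · have hd : deriv (fun u => f u - τ * I * G u) 0 = deriv f 0 - τ * I * deriv G 0 := by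
          rw [hdG]
          refine ((hf 0 h0).sub ((hG 0 h0).const_mul (τ * I))).deriv.trans ?_
          rw [(hf 0 h0).deriv]
        have h1 : kernelOp κ w (fun u => f u - τ * I * G u) =
            kernelOp κ w f - τ * I * kernelOp κ w G := by
          simp only [kernelOp, hd]; ring
        rw [h1, kernelOp_eq_mul_dslope κ w f, kernelOp_eq_mul_dslope κ w G]
        change w * m w - τ * I * (w * n w) = 0
        rw [div_eq_iff (hne w hw)] at hJ
        rw [hJ]
        ring
  have hzb : z ∈ ball (0 : ℂ) 1 := by simpa using hz
  have hmain : 0 < (m z / n z).re := by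
    by_contra hle
    push Not at hle
    obtain ⟨w, hw, hw0⟩ := (convex_ball (0 : ℂ) 1).isPreconnected.intermediate_value hzb h0 hJc
      (⟨hle, by rw [hn0, hm0, div_self hq00]; simp⟩ :
        (0 : ℝ) ∈ Icc (m z / n z).re (m 0 / n 0).re)
    exact hJne w hw hw0
  rw [kernelOp_eq_mul_dslope, kernelOp_eq_mul_dslope, mul_div_mul_left _ _ hz0]
  exact hmain

/-- The projection of `ℝ` onto `[0, 1]`, which makes integrands on a segment globally
continuous. -/
noncomputable def unitClamp (t : ℝ) : ℝ := max 0 (min t 1)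

theorem continuous_unitClamp : Continuous unitClamp :=
  continuous_const.max (continuous_id.min continuous_const)

theorem unitClamp_of_mem {t : ℝ} (ht : t ∈ Icc (0 : ℝ) 1) : unitClamp t = t := by
  rw [unitClamp, min_eq_left ht.2, max_eq_right ht.1]

theorem norm_unitClamp_mul_le (t : ℝ) (z : ℂ) : ‖(unitClamp t : ℂ) * z‖ ≤ ‖z‖ := by
  rw [norm_mul, norm_real, Real.norm_of_nonneg (show 0 ≤ unitClamp t from le_max_left _ _)]
  exact mul_le_of_le_one_left (norm_nonneg z) (max_le zero_le_one (min_le_right _ _))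

theorem unitClamp_mul_mem_ball (t : ℝ) {z : ℂ} (hz : ‖z‖ < 1) :
    (unitClamp t : ℂ) * z ∈ ball (0 : ℂ) 1 := by
  simpa using (norm_unitClamp_mul_le t z).trans_lt hz

theorem sub_eq_integral_unitClamp {f F : ℂ → ℂ} (hF : ContinuousOn F (ball 0 1))
    (hf : ∀ u ∈ ball (0 : ℂ) 1, HasDerivAt f (F u) u) {z : ℂ} (hz : ‖z‖ < 1) :
    f z - f 0 = ∫ t in (0 : ℝ)..1, z * F (unitClamp t * z) := by
  have hmem := fun t => unitClamp_mul_mem_ball t hz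
  have hcont : Continuous fun t : ℝ => z * F (unitClamp t * z) :=
    continuous_const.mul (hF.comp_continuous
      ((continuous_ofReal.comp continuous_unitClamp).mul continuous_const) hmem)
  have h := intervalIntegral.integral_eq_sub_of_hasDerivAt (a := 0) (b := 1)
    (f := fun t : ℝ => f (t * z)) (f' := fun t : ℝ => z * F (unitClamp t * z)) ?_
    (hcont.intervalIntegrable _ _)
  · rw [h]; simp
  · intro t ht
    rw [uIcc_of_le zero_le_one] at ht
    have h1 := hmem t
    rw [unitClamp_of_mem ht] at h1 ⊢
    have h2 : HasDerivAt (fun s : ℂ => s * z) z (t : ℂ) := by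
      simpa using (hasDerivAt_id (t : ℂ)).mul_const z
    refine ((hf _ h1).comp (t : ℂ) h2).comp_ofReal.congr_deriv ?_
    ring

/-- The Herglotz representation of a function holomorphic near the closed disk. -/
theorem integral_re_mul_herglotz {P : ℂ → ℂ} {R : ℝ} (hR : 1 < R)
    (hP : DifferentiableOn ℂ P (ball 0 R)) {w : ℂ} (hw : ‖w‖ < 1) :
    ∫ θ in (0 : ℝ)..2 * Real.pi, ((P (circleMap 0 1 θ)).re : ℂ) *
      ((circleMap 0 1 θ + w) / (circleMap 0 1 θ - w)) =
      2 * Real.pi * (P w - (P 0).im * I) := by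
  have hsub : closedBall (0 : ℂ) 1 ⊆ ball 0 R := closedBall_subset_ball hR
  have hPc : Continuous fun θ : ℝ => P (circleMap 0 1 θ) :=
    hP.continuousOn.comp_continuous (continuous_circleMap 0 1) fun θ => hsub (by simp)
  have hPr : Continuous fun θ : ℝ => ((P (circleMap 0 1 θ)).re : ℂ) :=
    continuous_ofReal.comp (continuous_re.comp hPc)
  have h1 := integral_re_mul_circleKernel (κ := 0) hw hR hP
  have h2 : ∫ θ in (0 : ℝ)..2 * Real.pi, ((P (circleMap 0 1 θ)).re : ℂ) =
      2 * Real.pi * (P 0).re := by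
    have hd : DiffContOnCl ℂ P (ball 0 |(1 : ℝ)|) := by
      rw [abs_one]
      exact (hP.mono (by rw [closure_ball _ one_ne_zero]; exact hsub)).diffContOnCl
    have h3 := hd.circleAverage
    rw [Real.circleAverage_def, inv_smul_eq_iff₀ (by positivity)] at h3
    have h4 : ∫ θ in (0 : ℝ)..2 * Real.pi, (P (circleMap 0 1 θ)).re =
        (∫ θ in (0 : ℝ)..2 * Real.pi, P (circleMap 0 1 θ)).re :=
      intervalIntegral.intervalIntegral_re (hPc.intervalIntegrable _ _)
    rw [intervalIntegral.integral_ofReal, h4, h3]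
    simp
  have h5 : ∀ θ : ℝ, ((P (circleMap 0 1 θ)).re : ℂ) *
      ((circleMap 0 1 θ + w) / (circleMap 0 1 θ - w)) = ((P (circleMap 0 1 θ)).re : ℂ) +
      2 * (((P (circleMap 0 1 θ)).re : ℂ) * circleKernel 0 w (circleMap 0 1 θ)) := by
    intro θ
    have h6 : ‖circleMap 0 1 θ‖ = 1 := by simp
    have h7 : circleMap 0 1 θ ≠ 0 := by rw [← norm_pos_iff, h6]; exact one_pos
    have h8 : circleMap 0 1 θ - w ≠ 0 := by
      refine sub_ne_zero.mpr fun h => ?_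
      rw [← h, h6] at hw
      exact lt_irrefl _ hw
    rw [circleKernel]
    field_simp
    ring
  simp only [h5]
  have hi : IntervalIntegrable (fun θ : ℝ => 2 * (((P (circleMap 0 1 θ)).re : ℂ) *
      circleKernel 0 w (circleMap 0 1 θ))) MeasureTheory.volume 0 (2 * Real.pi) :=
    (continuous_const.mul (hPr.mul (continuous_circleKernel_circleMap hw))).intervalIntegrable _ _
  rw [intervalIntegral.integral_add (hPr.intervalIntegrable _ _) hi, h2,
    intervalIntegral.integral_const_mul, h1, kernelOp]
  nth_rw 2 [← re_add_im (P 0)]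
  ring

theorem integral_re_mul_integral {q G f P : ℂ → ℂ} {R : ℝ} (hR : 1 < R)
    (hq : DifferentiableOn ℂ q (ball 0 R)) (hG : ∀ u ∈ ball (0 : ℂ) 1, HasDerivAt G (q u) u)
    (hP : DifferentiableOn ℂ P (ball 0 R))
    (hf : ∀ u ∈ ball (0 : ℂ) 1, HasDerivAt f (P u * q u) u) {z : ℂ} (hz : ‖z‖ < 1)
    (hKc : Continuous (fun θ t : ℝ => z * ((circleMap 0 1 θ + unitClamp t * z) /
      (circleMap 0 1 θ - unitClamp t * z) * q (unitClamp t * z))).uncurry) :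
    ∫ θ in (0 : ℝ)..2 * Real.pi, ((P (circleMap 0 1 θ)).re : ℂ) * (∫ t in (0 : ℝ)..1,
      z * ((circleMap 0 1 θ + unitClamp t * z) / (circleMap 0 1 θ - unitClamp t * z) *
        q (unitClamp t * z))) =
      2 * Real.pi * ((f z - f 0) - (P 0).im * I * (G z - G 0)) := by
  have hsub1 : ball (0 : ℂ) 1 ⊆ ball 0 R := ball_subset_ball hR.le
  have hsub : closedBall (0 : ℂ) 1 ⊆ ball 0 R := closedBall_subset_ball hR
  have hwc : Continuous fun t : ℝ => (unitClamp t : ℂ) * z :=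
    (continuous_ofReal.comp continuous_unitClamp).mul continuous_const
  have hwm := fun t => unitClamp_mul_mem_ball t hz
  have hqc : Continuous fun t : ℝ => q (unitClamp t * z) :=
    hq.continuousOn.comp_continuous hwc fun t => hsub1 (hwm t)
  have hPc : Continuous fun t : ℝ => P (unitClamp t * z) :=
    hP.continuousOn.comp_continuous hwc fun t => hsub1 (hwm t)
  have hhc : Continuous fun θ : ℝ => ((P (circleMap 0 1 θ)).re : ℂ) :=
    continuous_ofReal.comp (continuous_re.comp
      (hP.continuousOn.comp_continuous (continuous_circleMap 0 1) fun θ => hsub (by simp)))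
  have hPq : ContinuousOn (fun u => P u * q u) (ball 0 1) :=
    (hP.continuousOn.mono hsub1).mul (hq.continuousOn.mono hsub1)
  have hFc := (hhc.comp continuous_fst).mul hKc
  have hFi := hFc.continuousOn.integrableOn_compact (μ := MeasureTheory.volume)
    ((isCompact_uIcc (a := (0 : ℝ)) (b := 2 * Real.pi)).prod
      (isCompact_uIcc (a := (0 : ℝ)) (b := 1)))
  have hFi' := hFi.mono_set (prod_mono uIoc_subset_uIcc uIoc_subset_uIcc)
  have e0 := MeasureTheory.intervalIntegral_intervalIntegral_swap
    (F := fun θ t : ℝ => ((P (circleMap 0 1 θ)).re : ℂ) *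
      (z * ((circleMap 0 1 θ + unitClamp t * z) / (circleMap 0 1 θ - unitClamp t * z) *
        q (unitClamp t * z)))) hFi'
  have e2 : ∀ t : ℝ, ∫ θ in (0 : ℝ)..2 * Real.pi, ((P (circleMap 0 1 θ)).re : ℂ) *
      (z * ((circleMap 0 1 θ + unitClamp t * z) / (circleMap 0 1 θ - unitClamp t * z) *
        q (unitClamp t * z))) =
      2 * Real.pi * (z * (P (unitClamp t * z) * q (unitClamp t * z)) -
        (P 0).im * I * (z * q (unitClamp t * z))) := by
    intro t
    have e3 : ∀ θ : ℝ, ((P (circleMap 0 1 θ)).re : ℂ) *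
        (z * ((circleMap 0 1 θ + unitClamp t * z) / (circleMap 0 1 θ - unitClamp t * z) *
          q (unitClamp t * z))) = z * q (unitClamp t * z) *
        (((P (circleMap 0 1 θ)).re : ℂ) *
          ((circleMap 0 1 θ + unitClamp t * z) / (circleMap 0 1 θ - unitClamp t * z))) := by
      intro θ
      ring
    simp only [e3]
    rw [intervalIntegral.integral_const_mul,
      integral_re_mul_herglotz hR hP (by simpa using hwm t)]
    ring
  have i1 : IntervalIntegrable (fun t : ℝ => z * (P (unitClamp t * z) * q (unitClamp t * z)))
      MeasureTheory.volume 0 1 := (continuous_const.mul (hPc.mul hqc)).intervalIntegrable _ _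
  have i2 : IntervalIntegrable (fun t : ℝ => (P 0).im * I * (z * q (unitClamp t * z)))
      MeasureTheory.volume 0 1 :=
    (continuous_const.mul (continuous_const.mul hqc)).intervalIntegrable _ _
  simp only [← intervalIntegral.integral_const_mul ((P (circleMap 0 1 _)).re : ℂ)]
  rw [e0]
  simp only [e2]
  rw [intervalIntegral.integral_const_mul, intervalIntegral.integral_sub i1 i2,
    intervalIntegral.integral_const_mul ((P 0).im * I : ℂ), sub_eq_integral_unitClamp hPq hf hz,
    sub_eq_integral_unitClamp (hq.continuousOn.mono hsub1) hG hz]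

/-- Superposing the kernels `(y + u) / (y - u)` by the Herglotz representation: if `∫ q` is
convex and `f' = P q` with `Re P > 0`, then the quotient of the transforms of `f` and `∫ q`
has positive real part. -/
theorem re_kernelOp_div_pos {q G f P : ℂ → ℂ} {R : ℝ} (hR : 1 < R)
    (hq : DifferentiableOn ℂ q (ball 0 R)) (hq0 : ∀ u ∈ ball (0 : ℂ) R, q u ≠ 0)
    (hpos : ∀ u ∈ ball (0 : ℂ) R, 0 < (1 + u * deriv q u / q u).re)
    (hG : ∀ u ∈ ball (0 : ℂ) 1, HasDerivAt G (q u) u)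
    (hP : DifferentiableOn ℂ P (ball 0 R)) (hPpos : ∀ u ∈ ball (0 : ℂ) R, 0 < (P u).re)
    (hf : ∀ u ∈ ball (0 : ℂ) 1, HasDerivAt f (P u * q u) u)
    {κ z : ℂ} (hκ : ‖κ‖ ≤ 1 / 3) (hM : ∀ w ∈ ball (0 : ℂ) 1, w ≠ 0 → kernelOp κ w G ≠ 0)
    (hz : ‖z‖ < 1) (hz0 : z ≠ 0) : 0 < (kernelOp κ z f / kernelOp κ z G).re := by
  have hpi := Real.pi_pos
  have hsub1 : ball (0 : ℂ) 1 ⊆ ball 0 R := ball_subset_ball hR.le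
  have hsub : closedBall (0 : ℂ) 1 ⊆ ball 0 R := closedBall_subset_ball hR
  have h0 : (0 : ℂ) ∈ ball (0 : ℂ) 1 := mem_ball_self one_pos
  have hMz := hM z (by simpa using hz) hz0
  have hcm : Continuous (circleMap 0 1) := continuous_circleMap 0 1
  have hwc : Continuous fun t : ℝ => (unitClamp t : ℂ) * z :=
    (continuous_ofReal.comp continuous_unitClamp).mul continuous_const
  have hwm := fun t => unitClamp_mul_mem_ball t hz
  have hqc : Continuous fun t : ℝ => q (unitClamp t * z) :=
    hq.continuousOn.comp_continuous hwc fun t => hsub1 (hwm t)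
  set h : ℝ → ℝ := fun θ => (P (circleMap 0 1 θ)).re
  have hhc : Continuous h := continuous_re.comp
    (hP.continuousOn.comp_continuous hcm fun θ => hsub (by simp))
  set K : ℝ → ℝ → ℂ := fun θ t => z * ((circleMap 0 1 θ + unitClamp t * z) /
    (circleMap 0 1 θ - unitClamp t * z) * q (unitClamp t * z))
  have hden : ∀ y : ℂ, ‖y‖ = 1 → ∀ u ∈ ball (0 : ℂ) 1, y - u ≠ 0 := by
    intro y hy u hu
    refine sub_ne_zero.mpr fun heq => ?_
    have hu1 : ‖u‖ < 1 := by simpa using hu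
    rw [← heq, hy] at hu1
    exact lt_irrefl _ hu1
  have hKc : Continuous K.uncurry := by
    have c1 : Continuous fun p : ℝ × ℝ => circleMap 0 1 p.1 := hcm.comp continuous_fst
    have c2 : Continuous fun p : ℝ × ℝ => (unitClamp p.2 : ℂ) * z := hwc.comp continuous_snd
    exact continuous_const.mul (((c1.add c2).div (c1.sub c2) fun p =>
      hden _ (by simp) _ (hwm p.2)).mul (hqc.comp continuous_snd))
  set N : ℝ → ℂ := fun θ => (1 + κ) * (∫ t in (0 : ℝ)..1, K θ t) - κ * z * q 0 with hN
  have hIc : Continuous fun θ => ∫ t in (0 : ℝ)..1, K θ t :=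
    intervalIntegral.continuous_parametric_intervalIntegral_of_continuous' hKc 0 1
  have hNc : Continuous N := (continuous_const.mul hIc).sub continuous_const
  have hNpos : ∀ θ, 0 < (N θ / kernelOp κ z G).re := by
    intro θ
    have hy : ‖circleMap 0 1 θ‖ = 1 := by simp
    have hd : DifferentiableOn ℂ (fun u => (circleMap 0 1 θ + u) / (circleMap 0 1 θ - u) * q u)
        (ball 0 1) :=
      (((differentiableOn_const _).add differentiableOn_id).div
        ((differentiableOn_const _).sub differentiableOn_id) (hden _ hy)).mul (hq.mono hsub1)
    obtain ⟨F, hF⟩ := hd.isExactOn_ball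
    have h1 := re_kernelOp_div_pos_of_norm_eq_one hR hq hq0 hpos hG hy hF hκ hM hz hz0
    have hy0 : circleMap 0 1 θ ≠ 0 := by rw [← norm_pos_iff, hy]; exact one_pos
    have h2 : deriv F 0 = q 0 := by rw [(hF 0 h0).deriv]; simp [hy0]
    rwa [kernelOp, sub_eq_integral_unitClamp hd.continuousOn hF hz, h2] at h1
  have hswap : ∫ θ in (0 : ℝ)..2 * Real.pi, (h θ : ℂ) * (∫ t in (0 : ℝ)..1, K θ t) =
      2 * Real.pi * ((f z - f 0) - (P 0).im * I * (G z - G 0)) :=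
    integral_re_mul_integral hR hq hG hP hf hz hKc
  have hP0 : ∫ θ in (0 : ℝ)..2 * Real.pi, (h θ : ℂ) = 2 * Real.pi * (P 0).re := by
    have e1 := integral_re_mul_herglotz hR hP (w := 0) (by simp)
    have e2 : ∀ θ : ℝ, (circleMap 0 1 θ + 0) / (circleMap 0 1 θ - 0) = 1 := by
      intro θ
      rw [add_zero, sub_zero, div_self]
      rw [← norm_pos_iff]
      simp
    simp only [e2, mul_one] at e1
    rw [e1]
    nth_rw 1 [← re_add_im (P 0)]
    ring
  have hhC : Continuous fun θ => (h θ : ℂ) := continuous_ofReal.comp hhc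
  have htotal : ∫ θ in (0 : ℝ)..2 * Real.pi, (h θ : ℂ) * (N θ / kernelOp κ z G) =
      2 * Real.pi * (kernelOp κ z f / kernelOp κ z G - (P 0).im * I) := by
    have e1 : ∀ θ, (h θ : ℂ) * (N θ / kernelOp κ z G) =
        (1 + κ) / kernelOp κ z G * ((h θ : ℂ) * (∫ t in (0 : ℝ)..1, K θ t)) -
          κ * z * q 0 / kernelOp κ z G * (h θ : ℂ) := by
      intro θ
      simp only [hN]
      ring
    simp only [e1]
    have i1 : IntervalIntegrable (fun θ => (1 + κ) / kernelOp κ z G *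
        ((h θ : ℂ) * (∫ t in (0 : ℝ)..1, K θ t))) MeasureTheory.volume 0 (2 * Real.pi) :=
      (continuous_const.mul (hhC.mul hIc)).intervalIntegrable _ _
    have i2 : IntervalIntegrable (fun θ => κ * z * q 0 / kernelOp κ z G * (h θ : ℂ))
        MeasureTheory.volume 0 (2 * Real.pi) :=
      (continuous_const.mul hhC).intervalIntegrable _ _
    rw [intervalIntegral.integral_sub i1 i2, intervalIntegral.integral_const_mul,
      intervalIntegral.integral_const_mul, hswap, hP0]
    have e2 : kernelOp κ z f = (1 + κ) * (f z - f 0) - κ * z * (P 0 * q 0) := by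
      rw [kernelOp, (hf 0 h0).deriv]
    have e3 : kernelOp κ z G = (1 + κ) * (G z - G 0) - κ * z * q 0 := by
      rw [kernelOp, (hG 0 h0).deriv]
    rw [e2]
    field_simp
    rw [e3]
    have e4 : P 0 = (P 0).re + (P 0).im * I := (re_add_im _).symm
    linear_combination κ * z * q 0 * e4
  have hre : ∫ θ in (0 : ℝ)..2 * Real.pi, h θ * (N θ / kernelOp κ z G).re =
      2 * Real.pi * (kernelOp κ z f / kernelOp κ z G).re := by
    have e1 : ∫ θ in (0 : ℝ)..2 * Real.pi, ((h θ : ℂ) * (N θ / kernelOp κ z G)).re =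
        (∫ θ in (0 : ℝ)..2 * Real.pi, (h θ : ℂ) * (N θ / kernelOp κ z G)).re :=
      intervalIntegral.intervalIntegral_re
        ((hhC.mul (hNc.div_const _)).intervalIntegrable _ _)
    simp only [re_ofReal_mul] at e1
    rw [e1, htotal]
    simp
  have hposint : 0 < ∫ θ in (0 : ℝ)..2 * Real.pi, h θ * (N θ / kernelOp κ z G).re :=
    intervalIntegral.intervalIntegral_pos_of_pos
      ((hhc.mul (continuous_re.comp (hNc.div_const _))).intervalIntegrable _ _)
      (fun θ => mul_pos (hPpos _ (hsub (by simp))) (hNpos θ)) (by linarith)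
  rw [hre] at hposint
  exact pos_of_mul_pos_right hposint (by linarith)

/-- By the Marx–Strohhäcker theorem, the transform of a convex function does not vanish. -/
theorem IsConvexFunction.kernelOp_ne_zero {g : ℂ → ℂ} (hg : IsConvexFunction g)
    (hne : ∀ z ∈ ball (0 : ℂ) 1, deriv g z ≠ 0) {κ : ℂ} (hκ : ‖κ‖ ≤ 1 / 3) {z : ℂ}
    (hz : z ∈ ball (0 : ℂ) 1) (hz0 : z ≠ 0) : kernelOp κ z g ≠ 0 := by
  have hg0 := hne 0 (mem_ball_self one_pos)
  have hre := hg.half_le_re_div hne hz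
  set ζ := dslope g 0 z / deriv g 0 with hζ
  rw [kernelOp_eq_mul_dslope, show dslope g 0 z = ζ * deriv g 0 by rw [hζ]; field_simp]
  refine mul_ne_zero hz0 fun h => ?_
  have h1 : κ * (1 - ζ) = ζ := by
    have : deriv g 0 * ((1 + κ) * ζ - κ) = 0 := by linear_combination h
    rcases mul_eq_zero.mp this with h2 | h2
    · exact absurd h2 hg0
    · linear_combination -h2
  have h2 : ‖1 - ζ‖ ^ 2 ≤ ‖ζ‖ ^ 2 := by
    rw [← normSq_eq_norm_sq, ← normSq_eq_norm_sq, normSq_apply, normSq_apply]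
    simp only [sub_re, one_re, sub_im, one_im]
    nlinarith
  have h3 : ‖1 - ζ‖ ≤ ‖ζ‖ := by
    nlinarith [norm_nonneg (1 - ζ), norm_nonneg ζ]
  have h4 : ‖ζ‖ = ‖κ‖ * ‖1 - ζ‖ := by rw [← norm_mul, h1]
  have h5 : 1 / 2 ≤ ‖ζ‖ := hre.trans (re_le_norm ζ)
  nlinarith [norm_nonneg κ]

/-- For `f` close-to-convex with respect to `g`, the quotient of the transforms of `f` and `g`
has positive real part. -/
theorem IsConvexFunction.re_kernelOp_div_pos {f g : ℂ → ℂ} (hg : IsConvexFunction g)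
    (hfd : DifferentiableOn ℂ f (ball 0 1))
    (hfg : ∀ z ∈ ball (0 : ℂ) 1, 0 < (deriv f z / deriv g z).re) {κ : ℂ} (hκ : ‖κ‖ ≤ 1 / 3)
    {z : ℂ} (hz : z ∈ ball (0 : ℂ) 1) (hz0 : z ≠ 0) :
    0 < (kernelOp κ z f / kernelOp κ z g).re := by
  have hne : ∀ z ∈ ball (0 : ℂ) 1, deriv g z ≠ 0 := fun z hz h => by
    have := hfg z hz
    simp [h] at this
  have hz1 : ‖z‖ < 1 := by simpa using hz
  obtain ⟨r, hzr, hr1⟩ := exists_between hz1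
  have hr0 : 0 < r := (norm_nonneg z).trans_lt hzr
  have hrC : (r : ℂ) ≠ 0 := ofReal_ne_zero.mpr hr0.ne'
  have hmem : ∀ u ∈ ball (0 : ℂ) r⁻¹, (r : ℂ) * u ∈ ball (0 : ℂ) 1 := by
    intro u hu
    have hu' : ‖u‖ < r⁻¹ := by simpa using hu
    rw [mem_ball_zero_iff, norm_mul, norm_real, Real.norm_of_nonneg hr0.le]
    calc r * ‖u‖ < r * r⁻¹ := by gcongr
      _ = 1 := mul_inv_cancel₀ hr0.ne'
  have hR : 1 < r⁻¹ := (one_lt_inv₀ hr0).mpr hr1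
  have hsub1 : ball (0 : ℂ) 1 ⊆ ball 0 r⁻¹ := ball_subset_ball hR.le
  have hmuld : ∀ v : ℂ, HasDerivAt (fun v => (r : ℂ) * v) r v := fun v => by
    simpa using (hasDerivAt_id v).const_mul (r : ℂ)
  have hcomp : ∀ {F : ℂ → ℂ}, DifferentiableOn ℂ F (ball 0 1) → ∀ u ∈ ball (0 : ℂ) r⁻¹,
      HasDerivAt (fun u => F (r * u)) (deriv F (r * u) * r) u := fun hF u hu =>
    ((hF.differentiableAt (isOpen_ball.mem_nhds (hmem u hu))).hasDerivAt).comp u (hmuld u)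
  have hgd := hg.differentiableOn
  have hg2 := hgd.deriv isOpen_ball
  have hqd : ∀ u ∈ ball (0 : ℂ) r⁻¹,
      HasDerivAt (fun u => deriv g (r * u) * r) (deriv (deriv g) (r * u) * r * r) u :=
    fun u hu => (hcomp hg2 u hu).mul_const _
  have hscale : ∀ {F : ℂ → ℂ}, DifferentiableOn ℂ F (ball 0 1) → ∀ w : ℂ,
      kernelOp κ w (fun u => F (r * u)) = kernelOp κ (r * w) F := by
    intro F hF w
    have h0 : (0 : ℂ) ∈ ball (0 : ℂ) r⁻¹ := mem_ball_self (by linarith)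
    rw [kernelOp, kernelOp, (hcomp hF 0 h0).deriv, mul_zero]
    ring
  have hzr' : ‖(r : ℂ)⁻¹ * z‖ < 1 := by
    rw [norm_mul, norm_inv, norm_real, Real.norm_of_nonneg hr0.le, inv_mul_lt_one₀ hr0]
    exact hzr
  have key := PowerDeformation.re_kernelOp_div_pos (q := fun u => deriv g (r * u) * r)
    (G := fun u => g (r * u)) (f := fun u => f (r * u))
    (P := fun u => deriv f (r * u) / deriv g (r * u)) hR
    (differentiableOn_ball_of_hasDerivAt hqd)
    (fun u hu => mul_ne_zero (hne _ (hmem u hu)) hrC)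
    (fun u hu => by
      rw [(hqd u hu).deriv]
      have h1 := hg.re_one_add_pos hne (hmem u hu)
      have h2 := hne _ (hmem u hu)
      rwa [show u * (deriv (deriv g) (r * u) * r * r) / (deriv g (r * u) * r) =
        r * u * deriv (deriv g) (r * u) / deriv g (r * u) by field_simp])
    (fun u hu => hcomp hgd u (hsub1 hu))
    ((differentiableOn_ball_of_hasDerivAt (hcomp (hfd.deriv isOpen_ball))).div
      (differentiableOn_ball_of_hasDerivAt (hcomp hg2)) fun u hu => hne _ (hmem u hu))
    (fun u hu => hfg _ (hmem u hu))
    (fun u hu => (hcomp hfd u (hsub1 hu)).congr_deriv (by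
      have h2 := hne _ (hmem u (hsub1 hu))
      field_simp))
    hκ
    (fun w hw hw0 => by
      rw [hscale hgd]
      exact hg.kernelOp_ne_zero hne hκ (hmem w (hsub1 hw)) (mul_ne_zero hrC hw0))
    hzr' (mul_ne_zero (inv_ne_zero hrC) hz0)
  rwa [hscale hfd, hscale hgd, mul_inv_cancel_left₀ hrC] at key

/-- Linear comparison of `f z / z` with `ζ z = (g z - g 0) / (z g' 0)`, uniformly in `κ`. -/
theorem IsCloseToConvex.exists_comparison {f : ℂ → ℂ} (hf : IsCloseToConvex f) :
    ∃ (c : ℂ) (ζ : ℂ → ℂ), 0 < c.re ∧ ContinuousOn ζ (ball 0 1) ∧ ζ 0 = 1 ∧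
      (∀ z ∈ ball (0 : ℂ) 1, 1 / 2 ≤ (ζ z).re) ∧
      ∀ κ : ℂ, ‖κ‖ ≤ 1 / 3 → ∀ z ∈ ball (0 : ℂ) 1,
        0 < (c * (((1 + κ) * quotient f z - κ) / ((1 + κ) * ζ z - κ))).re := by
  obtain ⟨g, hg, hfg⟩ := hf.exists_convex
  have hne : ∀ z ∈ ball (0 : ℂ) 1, deriv g z ≠ 0 := fun z hz h => by
    have := hfg z hz
    simp [h] at this
  have h0 : (0 : ℂ) ∈ ball (0 : ℂ) 1 := mem_ball_self one_pos
  have hg0 := hne 0 h0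
  have hc0 : 0 < ((deriv g 0)⁻¹).re := by
    have := hfg 0 h0
    rwa [hf.deriv_zero, one_div] at this
  refine ⟨(deriv g 0)⁻¹, fun z => dslope g 0 z / deriv g 0, hc0, ?_, by simp [hg0],
    fun z hz => hg.half_le_re_div hne hz, fun κ hκ z hz => ?_⟩
  · exact ((Complex.differentiableOn_dslope (isOpen_ball.mem_nhds h0)).mpr
      hg.differentiableOn).continuousOn.div_const _
  · rcases eq_or_ne z 0 with rfl | hz0
    · rw [hf.quotient_zero]
      simpa [hg0] using hc0
    · have h1 := hg.re_kernelOp_div_pos hf.differentiableOn hfg hκ hz hz0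
      have h2 := hg.kernelOp_ne_zero hne hκ hz hz0
      rw [kernelOp_eq_mul_dslope] at h2
      have h3 := right_ne_zero_of_mul h2
      have h4 : (1 + κ) * (dslope g 0 z / deriv g 0) - κ =
          ((1 + κ) * dslope g 0 z - κ * deriv g 0) / deriv g 0 := by field_simp
      rw [kernelOp_eq_mul_dslope, kernelOp_eq_mul_dslope, mul_div_mul_left _ _ hz0,
        hf.deriv_zero, mul_one] at h1
      rw [h4, quotient]
      rwa [show (deriv g 0)⁻¹ * (((1 + κ) * dslope f 0 z - κ) /
        (((1 + κ) * dslope g 0 z - κ * deriv g 0) / deriv g 0)) =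
        ((1 + κ) * dslope f 0 z - κ) / ((1 + κ) * dslope g 0 z - κ * deriv g 0) by
          field_simp]

/-- Two continuous logarithms on the disk that agree at the origin are equal. -/
theorem eq_of_exp_eq_of_continuousOn {l₁ l₂ : ℂ → ℂ} (h₁ : ContinuousOn l₁ (ball 0 1))
    (h₂ : ContinuousOn l₂ (ball 0 1)) (hexp : ∀ z ∈ ball (0 : ℂ) 1, exp (l₁ z) = exp (l₂ z))
    (h0 : l₁ 0 = l₂ 0) {z : ℂ} (hz : z ∈ ball (0 : ℂ) 1) : l₁ z = l₂ z := by
  have hint : ∀ w ∈ ball (0 : ℂ) 1, ∃ n : ℤ, l₁ w = l₂ w + n * (2 * Real.pi * I) := fun w hw =>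
    exp_eq_exp_iff_exists_int.mp (hexp w hw)
  set φ : ℂ → ℝ := fun w => (l₁ w - l₂ w).im / (2 * Real.pi) with hφ
  have hφc : ContinuousOn φ (ball 0 1) :=
    (continuous_im.comp_continuousOn (h₁.sub h₂)).div_const _
  have hφi : ∀ w n, l₁ w = l₂ w + (n : ℤ) * (2 * Real.pi * I) → φ w = n := by
    intro w n hn
    simp only [hφ]
    rw [hn, add_sub_cancel_left, show (n : ℂ) * (2 * Real.pi * I) =
      ((n * (2 * Real.pi) : ℝ) : ℂ) * I by push_cast; ring, im_ofReal_mul, I_im]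
    field_simp
  have hφint : ∀ w ∈ ball (0 : ℂ) 1, ∃ n : ℤ, φ w = n := fun w hw => by
    obtain ⟨n, hn⟩ := hint w hw
    exact ⟨n, hφi w n hn⟩
  have hb0 : (0 : ℂ) ∈ ball (0 : ℂ) 1 := mem_ball_self one_pos
  have hφ0 : φ 0 = 0 := by simp [hφ, h0]
  have hpre := (convex_ball (0 : ℂ) 1).isPreconnected
  have hhalf : ∀ x ∈ ball (0 : ℂ) 1, ∀ n : ℤ, 2 * φ x ≠ 2 * n + 1 := by
    intro x hx n hxn
    obtain ⟨m, hm⟩ := hφint x hx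
    rw [hm] at hxn
    have : 2 * m = 2 * n + 1 := by exact_mod_cast hxn
    omega
  obtain ⟨n, hn⟩ := hint z hz
  have hφz := hφi z n hn
  rcases lt_trichotomy n 0 with hneg | rfl | hpos
  · exfalso
    have h1 : (n : ℝ) ≤ -1 := by exact_mod_cast (by omega : n ≤ -1)
    obtain ⟨x, hx, hxv⟩ := hpre.intermediate_value hz hb0 hφc
      (⟨by rw [hφz]; linarith, by rw [hφ0]; norm_num⟩ : (-1 / 2 : ℝ) ∈ Icc (φ z) (φ 0))
    exact hhalf x hx (-1) (by rw [hxv]; norm_num)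
  · simpa using hn
  · exfalso
    have h1 : (1 : ℝ) ≤ n := by exact_mod_cast (by omega : 1 ≤ n)
    obtain ⟨x, hx, hxv⟩ := hpre.intermediate_value hb0 hz hφc
      (⟨by rw [hφ0]; norm_num, by rw [hφz]; linarith⟩ : (1 / 2 : ℝ) ∈ Icc (φ 0) (φ z))
    exact hhalf x hx 0 (by rw [hxv]; norm_num)

theorem abs_arg_lt_pi_div_two {z : ℂ} (hz : 0 < z.re) : |arg z| < Real.pi / 2 :=
  abs_arg_lt_pi_div_two_iff.mpr (Or.inl hz)

/-- The variability region of `log (f z / z)` is contained in a region bounded by two curves: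
`|z / f z - 1| < 3`, and, where the argument exceeds `π` in modulus, `Re (f z / z) < -1 / 2`. -/
theorem IsCloseToConvex.logQuotient_mem {f : ℂ → ℂ} (hf : IsCloseToConvex f) {z : ℂ}
    (hz : z ∈ ball (0 : ℂ) 1) :
    1 < 8 * ‖exp (logQuotient f z)‖ ^ 2 + 2 * (exp (logQuotient f z)).re ∧
    (Real.pi ≤ |(logQuotient f z).im| → |(logQuotient f z).im| < 3 * Real.pi / 2 ∧
      (exp (logQuotient f z)).re < -1 / 2) := by
  obtain ⟨c, ζ, hc, hζc, hζ0, hζre, hcmp⟩ := hf.exists_comparison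
  have hl := isLogQuotient_logQuotient hf.toIsNormalizedAnalytic hf.injOn
  set l := logQuotient f
  -- otherwise `κ = w / (1 - w)`, with `w = f z / z`, is admissible and makes the comparison vanish
  have hA1 : ∀ w ∈ ball (0 : ℂ) 1, ‖1 - exp (l w)‖ < 3 * ‖exp (l w)‖ := by
    intro w hw
    by_contra hle
    push Not at hle
    have hW := exp_ne_zero (l w)
    have hWpos := norm_pos_iff.mpr hW
    have h1 : 1 - exp (l w) ≠ 0 := norm_pos_iff.mp (by linarith)
    have h2 : ‖exp (l w) / (1 - exp (l w))‖ ≤ 1 / 3 := by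
      rw [norm_div, div_le_iff₀ (norm_pos_iff.mpr h1)]
      linarith
    have h3 := hcmp _ h2 w hw
    rw [← hl.exp_eq w hw] at h3
    have h4 : (1 + exp (l w) / (1 - exp (l w))) * exp (l w) - exp (l w) / (1 - exp (l w)) = 0 := by
      field_simp
      ring
    rw [h4] at h3
    simp at h3
  have hA1' : ∀ w ∈ ball (0 : ℂ) 1,
      1 < 8 * ‖exp (l w)‖ ^ 2 + 2 * (exp (l w)).re := by
    intro w hw
    have h1 := hA1 w hw
    have h2 : ‖1 - exp (l w)‖ ^ 2 < (3 * ‖exp (l w)‖) ^ 2 := by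
      gcongr
    have h3 : ‖1 - exp (l w)‖ ^ 2 = 1 - 2 * (exp (l w)).re + ‖exp (l w)‖ ^ 2 := by
      rw [← normSq_eq_norm_sq, ← normSq_eq_norm_sq, normSq_apply, normSq_apply]
      simp only [sub_re, one_re, sub_im, one_im]
      ring
    nlinarith
  refine ⟨hA1' z hz, ?_⟩
  have hvre : ∀ w ∈ ball (0 : ℂ) 1, 0 < (1 + exp (-l w) / 2).re := by
    intro w hw
    have h1 := hA1' w hw
    have hW := exp_ne_zero (l w)
    have hpos := normSq_pos.mpr hW
    rw [exp_neg, add_re, one_re, show (exp (l w))⁻¹ / 2 = ((1 / 2 : ℝ) : ℂ) * (exp (l w))⁻¹ by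
      push_cast; ring, re_ofReal_mul, inv_re]
    rw [← normSq_eq_norm_sq] at h1
    have h2 : -1 < (exp (l w)).re / normSq (exp (l w)) / 2 := by
      rw [div_div, lt_div_iff₀ (by positivity)]
      have h3 : (exp (l w)).re * (exp (l w)).re ≤ normSq (exp (l w)) := by
        rw [normSq_apply]; nlinarith [mul_self_nonneg (exp (l w)).im]
      by_contra hle
      push Not at hle
      nlinarith
    linarith
  have hbase : ∀ w ∈ ball (0 : ℂ) 1,
      0 < (c * ((exp (l w) + 1 / 2) / (ζ w + 1 / 2))).re := by
    intro w hw
    have h1 := hcmp (-1 / 3) (by norm_num) w hw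
    rw [← hl.exp_eq w hw] at h1
    rwa [show (1 + -1 / 3 : ℂ) * exp (l w) - -1 / 3 = 2 / 3 * (exp (l w) + 1 / 2) by ring,
      show (1 + -1 / 3 : ℂ) * ζ w - -1 / 3 = 2 / 3 * (ζ w + 1 / 2) by ring,
      mul_div_mul_left _ _ (by norm_num : (2 / 3 : ℂ) ≠ 0)] at h1
  have hζ' : ∀ w ∈ ball (0 : ℂ) 1, 0 < (ζ w + 1 / 2).re := by
    intro w hw
    have := hζre w hw
    rw [add_re]
    norm_num
    linarith
  have hslit : ∀ {x : ℂ}, 0 < x.re → x ∈ slitPlane := fun h => mem_slitPlane_iff.mpr (Or.inl h)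
  have hc0 : c ≠ 0 := by rintro rfl; simp at hc
  have hlc := hl.differentiableOn.continuousOn
  have hexpc : ContinuousOn (fun w => exp (l w)) (ball 0 1) := continuous_exp.comp_continuousOn hlc
  have hζne : ∀ w ∈ ball (0 : ℂ) 1, ζ w + 1 / 2 ≠ 0 := fun w hw =>
    slitPlane_ne_zero (hslit (hζ' w hw))
  have hone : (1 + exp (-0) / 2 : ℂ) = 3 / 2 := by norm_num
  -- two forms of the continuous logarithm of `f z / z + 1 / 2`
  have heq := eq_of_exp_eq_of_continuousOn
    (l₁ := fun w => l w + log (1 + exp (-l w) / 2))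
    (l₂ := fun w => log (ζ w + 1 / 2) + log (c * ((exp (l w) + 1 / 2) / (ζ w + 1 / 2))) - log c)
    (hlc.add ((continuousOn_const.add ((continuous_exp.comp_continuousOn hlc.neg).div_const 2)).clog
      fun w hw => hslit (hvre w hw)))
    ((((hζc.add continuousOn_const).clog fun w hw => hslit (hζ' w hw)).add
      ((continuousOn_const.mul ((hexpc.add continuousOn_const).div
        (hζc.add continuousOn_const) hζne)).clog fun w hw => hslit (hbase w hw))).sub
      continuousOn_const)
    (fun w hw => by
      rw [exp_add, exp_sub, exp_add, exp_log (slitPlane_ne_zero (hslit (hvre w hw))),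
        exp_log (hζne w hw), exp_log (slitPlane_ne_zero (hslit (hbase w hw))), exp_log hc0,
        exp_neg]
      have h1 := exp_ne_zero (l w)
      have h2 := hζne w hw
      have h3 : 2 * ζ w + 1 ≠ 0 := by
        rw [show 2 * ζ w + 1 = 2 * (ζ w + 1 / 2) by ring]
        exact mul_ne_zero two_ne_zero h2
      field_simp)
    (by
      simp only [hl.map_zero, hζ0, exp_zero]
      rw [div_self (by norm_num), mul_one, hone, add_sub_cancel_right, zero_add]
      norm_num)
    hz
  set A := l z + log (1 + exp (-l z) / 2) with hA
  have hexpA : exp A = exp (l z) + 1 / 2 := by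
    rw [hA, exp_add, exp_log (slitPlane_ne_zero (hslit (hvre z hz))), exp_neg]
    have h1 := exp_ne_zero (l z)
    field_simp
  have hAim : A.im = (l z).im + arg (1 + exp (-l z) / 2) := by rw [hA, add_im, log_im]
  -- three principal arguments, each less than `π / 2` in modulus
  have hAim2 : |A.im| < 3 * Real.pi / 2 := by
    rw [heq]
    simp only [sub_im, add_im, log_im]
    have h1 := abs_lt.mp (abs_arg_lt_pi_div_two (hζ' z hz))
    have h2 := abs_lt.mp (abs_arg_lt_pi_div_two (hbase z hz))
    have h3 := abs_lt.mp (abs_arg_lt_pi_div_two hc)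
    rw [add_im] at *
    rw [abs_lt]
    constructor <;> linarith [h1.1, h1.2, h2.1, h2.2, h3.1, h3.2]
  have h4 := abs_lt.mp (abs_arg_lt_pi_div_two (hvre z hz))
  have h5 := abs_lt.mp hAim2
  intro hT
  have hcosA : Real.cos A.im < 0 := by
    rcases le_abs.mp hT with h | h
    · exact Real.cos_neg_of_pi_div_two_lt_of_lt (by linarith [h4.1]) (by linarith [h5.2])
    · rw [← Real.cos_neg]
      exact Real.cos_neg_of_pi_div_two_lt_of_lt (by linarith [h4.2]) (by linarith [h5.1])
  have hre : (exp (l z)).re < -1 / 2 := by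
    have h6 := congrArg re hexpA
    rw [exp_re, add_re (exp (l z))] at h6
    have h7 := mul_neg_of_pos_of_neg (Real.exp_pos A.re) hcosA
    norm_num at h6
    linarith
  refine ⟨?_, hre⟩
  have hcos : Real.cos |(l z).im| < 0 := by
    rw [Real.cos_abs]
    rw [exp_re] at hre
    by_contra hle
    push Not at hle
    have := mul_nonneg (Real.exp_pos (l z).re).le hle
    linarith
  have hlt : |(l z).im| < 2 * Real.pi := by
    rw [abs_lt]
    constructor <;> linarith [h4.1, h4.2, h5.1, h5.2]
  by_contra hle
  push Not at hle
  have : 0 ≤ Real.cos |(l z).im| := by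
    rw [← Real.cos_sub_two_pi]
    exact Real.cos_nonneg_of_mem_Icc ⟨by linarith, by linarith⟩
  linarith

/-! ### The two bounds and the threshold -/

theorem isMinOn_of_deriv_sign {f f' : ℝ → ℝ} {D : Set ℝ} (hD : Convex ℝ D)
    (hf : ∀ x ∈ D, HasDerivAt f (f' x) x) {a : ℝ} (ha : a ∈ D)
    (hneg : ∀ x ∈ D, x < a → f' x ≤ 0) (hpos : ∀ x ∈ D, a < x → 0 ≤ f' x) {x : ℝ} (hx : x ∈ D) :
    f a ≤ f x := by
  have hsub : ∀ {u v : ℝ}, u ∈ D → v ∈ D → Icc u v ⊆ D := fun hu hv => hD.ordConnected.out hu hv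
  rcases le_total x a with h | h
  · refine antitoneOn_of_deriv_nonpos (convex_Icc x a)
      (fun y hy => (hf y (hsub hx ha hy)).continuousAt.continuousWithinAt)
      (fun y hy => (hf y (hsub hx ha (interior_subset hy))).differentiableAt.differentiableWithinAt)
      (fun y hy => ?_) (left_mem_Icc.mpr h) (right_mem_Icc.mpr h) h
    have hyD := hsub hx ha (interior_subset hy)
    rw [interior_Icc] at hy
    rw [(hf y hyD).deriv]
    exact hneg y hyD hy.2
  · refine monotoneOn_of_deriv_nonneg (convex_Icc a x)
      (fun y hy => (hf y (hsub ha hx hy)).continuousAt.continuousWithinAt)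
      (fun y hy => (hf y (hsub ha hx (interior_subset hy))).differentiableAt.differentiableWithinAt)
      (fun y hy => ?_) (left_mem_Icc.mpr h) (right_mem_Icc.mpr h) h
    have hyD := hsub ha hx (interior_subset hy)
    rw [interior_Icc] at hy
    rw [(hf y hyD).deriv]
    exact hpos y hyD hy.1

/-- The minimum of `Re L - b Im L` on the boundary curve `|z / f z - 1| = 3`. -/
noncomputable def innerBound (b : ℝ) : ℝ :=
  -Real.log (√(1 - 8 * b ^ 2) + 3) + Real.log (1 + b ^ 2) / 2 -
    b * Real.arctan (3 * b / √(1 - 8 * b ^ 2))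

/-- The minimum of `Re L - b Im L` on the boundary curve `Re (f z / z) = -1 / 2`. -/
noncomputable def outerBound (b : ℝ) : ℝ :=
  Real.log (1 + b ^ 2) / 2 - Real.log 2 - b * (Real.arctan b + Real.pi)

/-- The difference of the two bounds. -/
noncomputable def thresholdFun (b : ℝ) : ℝ :=
  b * (Real.arctan b - Real.arctan (3 * b / √(1 - 8 * b ^ 2)) + Real.pi) -
    (Real.log (√(1 - 8 * b ^ 2) + 3) - Real.log 2)

theorem innerBound_sub_outerBound (b : ℝ) : innerBound b - outerBound b = thresholdFun b := by
  rw [innerBound, outerBound, thresholdFun]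
  ring

theorem thresholdEquation_iff {b : ℝ} (hb : 8 * b ^ 2 < 1) :
    ThresholdEquation b ↔ thresholdFun b = 0 := by
  set s := √(1 - 8 * b ^ 2) with hs
  have hs2 : s ^ 2 = 1 - 8 * b ^ 2 := Real.sq_sqrt (by linarith)
  have h1 : 5 - 4 * b ^ 2 + 3 * s = (s + 3) ^ 2 / 2 := by nlinarith
  have h2 : Real.log ((s + 3) ^ 2 / 2) = 2 * Real.log (s + 3) - Real.log 2 := by
    rw [Real.log_div (by positivity) two_ne_zero, Real.log_pow]
    norm_num
  rw [ThresholdEquation, thresholdFun, ← hs, h1, h2]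
  constructor <;> intro h <;> linarith

theorem lt_one_div_iff {b : ℝ} (hb : 0 ≤ b) : b < 1 / (2 * √2) ↔ 8 * b ^ 2 < 1 := by
  have h2 : (√2 : ℝ) ^ 2 = 2 := Real.sq_sqrt (by norm_num)
  rw [lt_div_iff₀ (by positivity)]
  have h4 : 8 * b ^ 2 = (b * (2 * √2)) ^ 2 := by
    rw [mul_pow, mul_pow, h2]; ring
  rw [h4, sq_lt_one_iff₀ (by positivity)]

theorem hasDerivAt_thresholdFun {b : ℝ} (hb : 8 * b ^ 2 < 1) :
    HasDerivAt thresholdFun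
      (Real.arctan b - Real.arctan (3 * b / √(1 - 8 * b ^ 2)) + Real.pi) b := by
  set s := √(1 - 8 * b ^ 2) with hs
  have hs0 : 0 < s := Real.sqrt_pos.mpr (by linarith)
  have hs2 : s ^ 2 = 1 - 8 * b ^ 2 := Real.sq_sqrt (by linarith)
  have hsd : HasDerivAt (fun b : ℝ => √(1 - 8 * b ^ 2)) (-(8 * b) / s) b := by
    have h1 : HasDerivAt (fun b : ℝ => 1 - 8 * b ^ 2) (-(8 * (2 * b))) b := by
      simpa using ((hasDerivAt_pow 2 b).const_mul 8).const_sub 1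
    refine (h1.sqrt (by linarith)).congr_deriv ?_
    rw [← hs]
    field_simp
  have hquot : HasDerivAt (fun b : ℝ => 3 * b / √(1 - 8 * b ^ 2))
      ((3 * s - 3 * b * (-(8 * b) / s)) / s ^ 2) b := by
    have h1 : HasDerivAt (fun b : ℝ => 3 * b) 3 b := by
      simpa using (hasDerivAt_id b).const_mul 3
    exact h1.div hsd hs0.ne'
  have h := ((hasDerivAt_id b).mul (((Real.hasDerivAt_arctan b).sub hquot.arctan).add_const
    Real.pi)).sub (((hsd.add_const 3).log (by positivity)).sub_const (Real.log 2))
  refine h.congr_deriv ?_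
  rw [← hs]
  have h1 : 1 + b ^ 2 ≠ 0 := by positivity
  have h3 : s + 3 ≠ 0 := by positivity
  have h4 : (1 / (1 + (3 * b / s) ^ 2)) * ((3 * s - 3 * b * (-(8 * b) / s)) / s ^ 2) =
      3 / (s * (1 + b ^ 2)) := by
    have h6 : 1 + (3 * b / s) ^ 2 = (1 + b ^ 2) / s ^ 2 := by
      field_simp
      linear_combination hs2
    rw [h6]
    field_simp
    linear_combination hs2
  simp only [id, Pi.sub_apply, ← hs]
  rw [show ((1 / (1 + b ^ 2)) - (1 / (1 + (3 * b / s) ^ 2)) *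
    ((3 * s - 3 * b * (-(8 * b) / s)) / s ^ 2)) = 1 / (1 + b ^ 2) - 3 / (s * (1 + b ^ 2)) by
      rw [h4]]
  field_simp
  linear_combination b * hs2

theorem strictMonoOn_thresholdFun : StrictMonoOn thresholdFun (Ico 0 (1 / (2 * √2))) := by
  have h8 : ∀ b ∈ Ico (0 : ℝ) (1 / (2 * √2)), 8 * b ^ 2 < 1 := fun b hb =>
    (lt_one_div_iff hb.1).mp hb.2
  refine strictMonoOn_of_deriv_pos (convex_Ico _ _) (fun b hb =>
    (hasDerivAt_thresholdFun (h8 b hb)).continuousAt.continuousWithinAt) fun b hb => ?_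
  have hb' := interior_subset hb
  rw [(hasDerivAt_thresholdFun (h8 b hb')).deriv]
  have h1 := Real.arctan_lt_pi_div_two (3 * b / √(1 - 8 * b ^ 2))
  have h2 : 0 ≤ Real.arctan b := Real.arctan_nonneg.mpr hb'.1
  linarith [Real.pi_pos]

theorem arctan_le_taylor {x : ℝ} (hx : 0 ≤ x) :
    Real.arctan x ≤ x - x ^ 3 / 3 + x ^ 5 / 5 := by
  have hd : ∀ y ∈ Ici (0 : ℝ), HasDerivAt (fun y => y - y ^ 3 / 3 + y ^ 5 / 5 - Real.arctan y)
      (1 - 3 * y ^ 2 / 3 + 5 * y ^ 4 / 5 - 1 / (1 + y ^ 2)) y := fun y _ => by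
    refine ((((hasDerivAt_id y).sub ((hasDerivAt_pow 3 y).div_const 3)).add
      ((hasDerivAt_pow 5 y).div_const 5)).sub (Real.hasDerivAt_arctan y)).congr_deriv ?_
    norm_num
  have h := isMinOn_of_deriv_sign (convex_Ici (0 : ℝ)) hd self_mem_Ici
    (fun y hy h => absurd h (not_lt.mpr hy)) (fun y hy _ => by
      have : 1 - 3 * y ^ 2 / 3 + 5 * y ^ 4 / 5 - 1 / (1 + y ^ 2) = y ^ 6 / (1 + y ^ 2) := by
        field_simp; ring
      rw [this]; positivity) (x := x) hx
  simp at h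
  linarith

theorem taylor_le_arctan {x : ℝ} (hx : 0 ≤ x) :
    x - x ^ 3 / 3 + x ^ 5 / 5 - x ^ 7 / 7 ≤ Real.arctan x := by
  have hd : ∀ y ∈ Ici (0 : ℝ),
      HasDerivAt (fun y => Real.arctan y - (y - y ^ 3 / 3 + y ^ 5 / 5 - y ^ 7 / 7))
      (1 / (1 + y ^ 2) - (1 - 3 * y ^ 2 / 3 + 5 * y ^ 4 / 5 - 7 * y ^ 6 / 7)) y := fun y _ => by
    refine ((Real.hasDerivAt_arctan y).sub ((((hasDerivAt_id y).sub
      ((hasDerivAt_pow 3 y).div_const 3)).add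
      ((hasDerivAt_pow 5 y).div_const 5)).sub ((hasDerivAt_pow 7 y).div_const 7))).congr_deriv ?_
    norm_num
  have h := isMinOn_of_deriv_sign (convex_Ici (0 : ℝ)) hd self_mem_Ici
    (fun y hy h => absurd h (not_lt.mpr hy)) (fun y hy _ => by
      have : 1 / (1 + y ^ 2) - (1 - 3 * y ^ 2 / 3 + 5 * y ^ 4 / 5 - 7 * y ^ 6 / 7) =
          y ^ 8 / (1 + y ^ 2) := by
        field_simp; ring
      rw [this]; positivity) (x := x) hx
  simp at h
  linarith

/-- The addition formula at `π / 4` replaces the argument of `arctan`, which is close to `1` near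
the threshold, by one close to `0`. -/
theorem thresholdFun_eq {b : ℝ} (hb0 : 0 < b) (hb : 8 * b ^ 2 < 1) :
    thresholdFun b = b * (Real.arctan b + Real.arctan ((√(1 - 8 * b ^ 2) - 3 * b) /
      (√(1 - 8 * b ^ 2) + 3 * b)) + 3 * Real.pi / 4) -
      (Real.log 2 + Real.log (1 - (1 - √(1 - 8 * b ^ 2)) / 4)) := by
  set s := √(1 - 8 * b ^ 2) with hs
  have hs0 : 0 < s := Real.sqrt_pos.mpr (by linarith)
  have h1 : Real.arctan (3 * b / s) + Real.arctan ((s - 3 * b) / (s + 3 * b)) = Real.pi / 4 := by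
    have h2 : 3 * b / s * ((s - 3 * b) / (s + 3 * b)) < 1 := by
      rw [div_mul_div_comm, div_lt_one (by positivity)]
      nlinarith [mul_pos hb0 hs0, mul_pos hb0 hb0, mul_pos hs0 hs0]
    rw [Real.arctan_add h2, ← Real.arctan_one]
    congr 1
    rw [div_eq_one_iff_eq (by linarith)]
    field_simp
    ring
  have h3 : Real.log (s + 3) = 2 * Real.log 2 + Real.log (1 - (1 - s) / 4) := by
    rw [show s + 3 = 2 * (2 * (1 - (1 - s) / 4)) by ring,
      Real.log_mul two_ne_zero (by linarith), Real.log_mul two_ne_zero (by linarith)]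
    ring
  rw [thresholdFun, ← hs, h3]
  linear_combination (-b) * h1

theorem log_one_sub_bounds {x : ℝ} (hx0 : 0 ≤ x) (hx : x < 1) :
    |Real.log (1 - x) + (x + x ^ 2 / 2 + x ^ 3 / 3 + x ^ 4 / 4 + x ^ 5 / 5)| ≤
      x ^ 6 / (1 - x) := by
  have h := Real.abs_log_sub_add_sum_range_le (by rwa [abs_of_nonneg hx0] : |x| < 1) 5
  rw [abs_of_nonneg hx0] at h
  simp only [Finset.sum_range_succ, Finset.sum_range_zero] at h
  norm_num at h
  rwa [add_comm] at h

theorem thresholdFun_neg : thresholdFun 0.24001 < 0 := by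
  rw [thresholdFun_eq (by norm_num) (by norm_num)]
  set s := √(1 - 8 * (0.24001 : ℝ) ^ 2)
  have hsl : 0.73427624 ≤ s := Real.le_sqrt_of_sq_le (by norm_num)
  have hsu : s ≤ 0.73427625 := Real.sqrt_le_iff.mpr ⟨by norm_num, by norm_num⟩
  have h1 := arctan_le_taylor (show (0 : ℝ) ≤ 0.24001 by norm_num)
  have h2 : Real.arctan ((s - 3 * 0.24001) / (s + 3 * 0.24001)) ≤ 0.00979591 := by
    have h3 : (s - 3 * 0.24001) / (s + 3 * 0.24001) ≤ 0.00979591 := by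
      rw [div_le_iff₀ (by linarith)]
      linarith
    refine (Real.arctan_strictMono.monotone h3).trans ((arctan_le_taylor (by norm_num)).trans ?_)
    norm_num
  have h4 := Real.pi_lt_d6
  have h5 := Real.log_two_gt_d9
  have h6 : Real.log (1 - 0.06643094) ≤ Real.log (1 - (1 - s) / 4) :=
    Real.log_le_log (by norm_num) (by linarith)
  have h7 := (abs_le.mp (log_one_sub_bounds (x := 0.06643094) (by norm_num) (by norm_num))).1
  norm_num at h1 h7 ⊢
  norm_num at h2 h4 h5 h6
  linarith

theorem thresholdFun_pos : 0 < thresholdFun 0.24002 := by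
  rw [thresholdFun_eq (by norm_num) (by norm_num)]
  set s := √(1 - 8 * (0.24002 : ℝ) ^ 2)
  have hsl : 0.73425009 ≤ s := Real.le_sqrt_of_sq_le (by norm_num)
  have hsu : s ≤ 0.7342501 := Real.sqrt_le_iff.mpr ⟨by norm_num, by norm_num⟩
  have h1 := taylor_le_arctan (show (0 : ℝ) ≤ 0.24002 by norm_num)
  have h2 : 0.00975694 ≤ Real.arctan ((s - 3 * 0.24002) / (s + 3 * 0.24002)) := by
    have h3 : 0.00975726 ≤ (s - 3 * 0.24002) / (s + 3 * 0.24002) := by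
      rw [le_div_iff₀ (by linarith)]
      linarith
    refine le_trans ?_ ((taylor_le_arctan (by norm_num)).trans (Real.arctan_strictMono.monotone h3))
    norm_num
  have h4 := Real.pi_gt_d6
  have h5 := Real.log_two_lt_d9
  have h6 : Real.log (1 - (1 - s) / 4) ≤ Real.log (1 - 0.06643747) :=
    Real.log_le_log (by linarith) (by linarith)
  have h7 := (abs_le.mp (log_one_sub_bounds (x := 0.06643747) (by norm_num) (by norm_num))).2
  norm_num at h1 h7 ⊢
  norm_num at h2 h4 h5 h6
  linarith

/-- The threshold equation has a single solution, located by the two evaluations above. -/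
theorem exists_threshold : ∃ b₀ : ℝ, 0.24001 ≤ b₀ ∧ b₀ < 0.24002 ∧ thresholdFun b₀ = 0 := by
  have h8 : ∀ b ∈ Icc (0.24001 : ℝ) 0.24002, 8 * b ^ 2 < 1 := fun b hb => by
    have h1 : b ^ 2 ≤ 0.24002 ^ 2 := pow_le_pow_left₀ (by linarith [hb.1]) hb.2 2
    norm_num at h1
    linarith
  obtain ⟨b, hb, hb0⟩ := intermediate_value_Icc (f := thresholdFun)
    (by norm_num : (0.24001 : ℝ) ≤ 0.24002)
    (fun b hb => (hasDerivAt_thresholdFun (h8 b hb)).continuousAt.continuousWithinAt)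
    (⟨thresholdFun_neg.le, thresholdFun_pos.le⟩ : (0 : ℝ) ∈ Icc _ _)
  refine ⟨b, hb.1, lt_of_le_of_ne hb.2 ?_, hb0⟩
  rintro rfl
  exact thresholdFun_pos.ne' hb0

/-- The tangent line of `-log cos` at `arctan b`. -/
theorem neg_log_cos_sub_ge {b φ : ℝ} (hφ : φ ∈ Ioo (-(Real.pi / 2)) (Real.pi / 2)) :
    Real.log (1 + b ^ 2) / 2 - b * Real.arctan b ≤ -Real.log (Real.cos φ) - b * φ := by
  have hd : ∀ x ∈ Ioo (-(Real.pi / 2)) (Real.pi / 2),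
      HasDerivAt (fun x => -Real.log (Real.cos x) - b * x) (Real.tan x - b) x := fun x hx => by
    have hc := Real.cos_pos_of_mem_Ioo hx
    refine (((Real.hasDerivAt_cos x).log hc.ne').neg.sub
      ((hasDerivAt_id x).const_mul b)).congr_deriv ?_
    rw [Real.tan_eq_sin_div_cos]
    ring
  have hmono : ∀ x ∈ Ioo (-(Real.pi / 2)) (Real.pi / 2), Real.arctan (Real.tan x) = x :=
    fun x hx => Real.arctan_tan hx.1 hx.2
  have h := isMinOn_of_deriv_sign (convex_Ioo _ _) hd
    ⟨Real.neg_pi_div_two_lt_arctan b, Real.arctan_lt_pi_div_two b⟩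
    (fun x hx hlt => by
      rw [← hmono x hx] at hlt
      linarith [Real.arctan_strictMono.lt_iff_lt.mp hlt])
    (fun x hx hlt => by
      rw [← hmono x hx] at hlt
      linarith [Real.arctan_strictMono.lt_iff_lt.mp hlt]) hφ
  have hcos : Real.log (Real.cos (Real.arctan b)) = -(Real.log (1 + b ^ 2) / 2) := by
    rw [Real.cos_arctan, one_div, Real.log_inv, Real.log_sqrt (by positivity)]
  rw [hcos, neg_neg] at h
  exact h

theorem innerBound_eq {b : ℝ} (hb : 8 * b ^ 2 < 1) :
    Real.cos (Real.arctan (3 * b / √(1 - 8 * b ^ 2))) = √(1 - 8 * b ^ 2) / √(1 + b ^ 2) ∧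
    innerBound b = -Real.log (Real.cos (Real.arctan (3 * b / √(1 - 8 * b ^ 2))) +
      √(8 + Real.cos (Real.arctan (3 * b / √(1 - 8 * b ^ 2))) ^ 2)) -
      b * Real.arctan (3 * b / √(1 - 8 * b ^ 2)) := by
  rw [innerBound]
  set s := √(1 - 8 * b ^ 2)
  have hs0 : 0 < s := Real.sqrt_pos.mpr (by linarith)
  have hs2 : s ^ 2 = 1 - 8 * b ^ 2 := Real.sq_sqrt (by linarith)
  set r := √(1 + b ^ 2) with hr
  have hr0 : 0 < r := Real.sqrt_pos.mpr (by positivity)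
  have hr2 : r ^ 2 = 1 + b ^ 2 := Real.sq_sqrt (by positivity)
  have hcos : Real.cos (Real.arctan (3 * b / s)) = s / r := by
    rw [Real.cos_arctan]
    have h1 : 1 + (3 * b / s) ^ 2 = (r / s) ^ 2 := by
      field_simp
      linear_combination hs2 - hr2
    rw [h1, Real.sqrt_sq (by positivity), one_div_div]
  refine ⟨hcos, ?_⟩
  have h2 : √(8 + (s / r) ^ 2) = 3 / r := by
    rw [show 8 + (s / r) ^ 2 = (3 / r) ^ 2 by
      field_simp
      linear_combination hs2 + 8 * hr2, Real.sqrt_sq (by positivity)]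
  have h3 : Real.log r = Real.log (1 + b ^ 2) / 2 := by rw [hr, Real.log_sqrt (by positivity)]
  rw [hcos, h2, ← add_div, Real.log_div (by positivity) hr0.ne', h3]
  ring

/-! ### Minimization over the region -/

/-- `Re L - b Im L` on the boundary curve `|z / f z - 1| = 3`, parametrized by the argument. -/
noncomputable def innerCurve (b T : ℝ) : ℝ :=
  -Real.log (Real.cos T + √(8 + Real.cos T ^ 2)) - b * T

theorem abs_lt_sqrt_eight_add_sq (c : ℝ) : |c| < √(8 + c ^ 2) := by
  rw [← Real.sqrt_sq_eq_abs]
  exact Real.sqrt_lt_sqrt (sq_nonneg c) (by linarith)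

theorem hasDerivAt_innerCurve (b T : ℝ) :
    HasDerivAt (innerCurve b) (Real.sin T / √(8 + Real.cos T ^ 2) - b) T := by
  have hq := abs_lt.mp (abs_lt_sqrt_eight_add_sq (Real.cos T))
  set c := Real.cos T with hc
  set q := √(8 + c ^ 2) with hqdef
  have hq0 : 0 < q := Real.sqrt_pos.mpr (by positivity)
  have hqd : HasDerivAt (fun T => √(8 + Real.cos T ^ 2)) (-(c * Real.sin T) / q) T := by
    have h1 : HasDerivAt (fun T => 8 + Real.cos T ^ 2) (2 * c * -Real.sin T) T := by
      simpa [hc] using ((Real.hasDerivAt_cos T).pow 2).const_add 8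
    refine (h1.sqrt (by positivity)).congr_deriv ?_
    rw [← hc, ← hqdef]
    field_simp
  refine ((((Real.hasDerivAt_cos T).add hqd).log (by
    simp only [Pi.add_apply]; rw [← hc, ← hqdef]; linarith)).neg.sub
    ((hasDerivAt_id T).const_mul b)).congr_deriv ?_
  simp only [Pi.add_apply]
  rw [← hc, ← hqdef]
  have h2 : c + q ≠ 0 := by linarith
  field_simp
  ring

theorem innerCurve_deriv_nonpos_iff {b T : ℝ} (hb : 0 ≤ b) (hT : T ∈ Icc 0 Real.pi) :
    Real.sin T / √(8 + Real.cos T ^ 2) - b ≤ 0 ↔ 1 - 8 * b ^ 2 ≤ (1 + b ^ 2) * Real.cos T ^ 2 := by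
  have hs := Real.sin_nonneg_of_mem_Icc hT
  have hcs := Real.sin_sq_add_cos_sq T
  set q := √(8 + Real.cos T ^ 2)
  have hq0 : 0 < q := Real.sqrt_pos.mpr (by positivity)
  have hq2 : q ^ 2 = 8 + Real.cos T ^ 2 := Real.sq_sqrt (by positivity)
  rw [sub_nonpos, div_le_iff₀ hq0, ← pow_le_pow_iff_left₀ hs (by positivity) two_ne_zero,
    mul_pow, hq2]
  constructor <;> intro h <;> nlinarith

theorem outerBound_le_innerCurve_pi {b : ℝ} : outerBound b ≤ innerCurve b Real.pi := by
  have h := neg_log_cos_sub_ge (b := b) (φ := 0)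
    ⟨by linarith [Real.pi_pos], by linarith [Real.pi_pos]⟩
  rw [Real.cos_zero, Real.log_one] at h
  have h9 : √(8 + (-1 : ℝ) ^ 2) = 3 := by
    rw [show (8 + (-1) ^ 2 : ℝ) = 3 ^ 2 by norm_num, Real.sqrt_sq (by norm_num)]
  rw [outerBound, innerCurve, Real.cos_pi, h9]
  norm_num
  linarith

theorem outerBound_le_innerCurve {b T : ℝ} (hb : 0 ≤ b) (hb8 : 1 ≤ 8 * b ^ 2)
    (hT : T ∈ Icc 0 Real.pi) : outerBound b ≤ innerCurve b T :=
  outerBound_le_innerCurve_pi.trans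
    (isMinOn_of_deriv_sign (convex_Icc 0 Real.pi) (fun x _ => hasDerivAt_innerCurve b x)
      (right_mem_Icc.mpr Real.pi_pos.le)
      (fun x hx _ => (innerCurve_deriv_nonpos_iff hb hx).mpr (by
        nlinarith [mul_nonneg (add_nonneg zero_le_one (sq_nonneg b)) (sq_nonneg (Real.cos x))]))
      (fun x hx h => absurd h (not_lt.mpr hx.2)) hT)

theorem min_le_innerCurve {b T : ℝ} (hb : 0 ≤ b) (hb8 : 8 * b ^ 2 < 1)
    (hT : T ∈ Icc 0 Real.pi) : min (innerBound b) (outerBound b) ≤ innerCurve b T := by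
  obtain ⟨hcos, hinner⟩ := innerBound_eq hb8
  rw [hinner]
  set s := √(1 - 8 * b ^ 2)
  have hs2 : s ^ 2 = 1 - 8 * b ^ 2 := Real.sq_sqrt (by linarith)
  set T₁ := Real.arctan (3 * b / s)
  have hT0 : 0 ≤ T₁ := Real.arctan_nonneg.mpr (by positivity)
  have hT2 : T₁ < Real.pi / 2 := Real.arctan_lt_pi_div_two _
  have hcos1 : (1 + b ^ 2) * Real.cos T₁ ^ 2 = 1 - 8 * b ^ 2 := by
    rw [hcos, div_pow, hs2, Real.sq_sqrt (by positivity)]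
    field_simp
  have hcpos : 0 < Real.cos T₁ := Real.cos_pos_of_mem_Ioo ⟨by linarith, hT2⟩
  have hsign1 : ∀ x ∈ Icc 0 Real.pi, Real.cos T₁ ^ 2 ≤ Real.cos x ^ 2 →
      Real.sin x / √(8 + Real.cos x ^ 2) - b ≤ 0 := fun x hx h =>
    (innerCurve_deriv_nonpos_iff hb hx).mpr (by rw [← hcos1]; gcongr)
  have hsign2 : ∀ x ∈ Icc 0 Real.pi, Real.cos x ^ 2 < Real.cos T₁ ^ 2 →
      0 ≤ Real.sin x / √(8 + Real.cos x ^ 2) - b := fun x hx h => by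
    by_contra hlt
    push Not at hlt
    have h1 := (innerCurve_deriv_nonpos_iff hb hx).mp hlt.le
    rw [← hcos1] at h1
    have h2 := le_of_mul_le_mul_left h1 (by positivity)
    linarith
  -- the curve function decreases up to `T₁`, increases up to `π - T₁`, and decreases again
  rcases le_total T (Real.pi - T₁) with h | h
  · refine (min_le_left _ _).trans (isMinOn_of_deriv_sign (convex_Icc 0 (Real.pi - T₁))
      (fun x _ => hasDerivAt_innerCurve b x) (a := T₁) ⟨hT0, by linarith⟩ ?_ ?_ ⟨hT.1, h⟩)
    · intro x hx hlt
      have h1 := Real.cos_le_cos_of_nonneg_of_le_pi hx.1 (by linarith) hlt.le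
      exact hsign1 x ⟨hx.1, by linarith [hx.2]⟩ (by gcongr)
    · intro x hx hlt
      rcases hx.2.lt_or_eq with h0 | h0
      · have h1 := Real.cos_lt_cos_of_nonneg_of_le_pi hT0 (by linarith [hx.2]) hlt
        have h2 := Real.cos_lt_cos_of_nonneg_of_le_pi hx.1 (by linarith) h0
        rw [Real.cos_pi_sub] at h2
        exact hsign2 x ⟨hx.1, by linarith [hx.2]⟩ (sq_lt_sq' h2 h1)
      · -- at `π - T₁` the derivative vanishes
        subst h0
        rw [Real.sin_pi_sub, Real.cos_pi_sub, neg_sq]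
        by_contra hlt
        push Not at hlt
        have hxm : T₁ ∈ Icc 0 Real.pi := ⟨hT0, by linarith⟩
        have hq0 : 0 < √(8 + Real.cos T₁ ^ 2) := Real.sqrt_pos.mpr (by positivity)
        have hq2 : √(8 + Real.cos T₁ ^ 2) ^ 2 = 8 + Real.cos T₁ ^ 2 := Real.sq_sqrt (by positivity)
        have hs0' := Real.sin_nonneg_of_mem_Icc hxm
        have hcs := Real.sin_sq_add_cos_sq T₁
        rw [sub_neg, div_lt_iff₀ hq0, ← pow_lt_pow_iff_left₀ hs0' (by positivity) two_ne_zero,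
          mul_pow, hq2] at hlt
        nlinarith
  · refine (min_le_right _ _).trans (outerBound_le_innerCurve_pi.trans
      (isMinOn_of_deriv_sign (convex_Icc (Real.pi - T₁) Real.pi)
      (fun x _ => hasDerivAt_innerCurve b x) (a := Real.pi)
      (right_mem_Icc.mpr (by linarith)) ?_ (fun x hx h => absurd h (not_lt.mpr hx.2)) ⟨h, hT.2⟩))
    intro x hx _
    have h1 := Real.cos_le_cos_of_nonneg_of_le_pi (by linarith) hx.2 hx.1
    rw [Real.cos_pi_sub] at h1
    refine hsign1 x ⟨by linarith [hx.1], hx.2⟩ ?_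
    rw [← neg_sq (Real.cos x)]
    exact pow_le_pow_left₀ hcpos.le (by linarith) 2

/-- The minimum of `x - b T` over the region described in `IsCloseToConvex.logQuotient_mem`. -/
theorem bounds_le_sub_mul {x T b : ℝ} (hb : 0 ≤ b)
    (h1 : 1 < 8 * Real.exp x ^ 2 + 2 * (Real.exp x * Real.cos T))
    (h2 : Real.pi ≤ |T| → |T| < 3 * Real.pi / 2 ∧ Real.exp x * Real.cos T < -1 / 2) :
    (8 * b ^ 2 < 1 → min (innerBound b) (outerBound b) ≤ x - b * T) ∧
    (1 ≤ 8 * b ^ 2 → outerBound b ≤ x - b * T) := by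
  have hpi := Real.pi_pos
  -- `h1` says that `exp x` exceeds the positive root of a quadratic polynomial
  have hx : -Real.log (Real.cos T + √(8 + Real.cos T ^ 2)) < x := by
    have hq := abs_lt.mp (abs_lt_sqrt_eight_add_sq (Real.cos T))
    have hq2 : √(8 + Real.cos T ^ 2) ^ 2 = 8 + Real.cos T ^ 2 := Real.sq_sqrt (by positivity)
    set c := Real.cos T
    set q := √(8 + c ^ 2)
    have hy := Real.exp_pos x
    have h3 : 0 < (Real.exp x * (c + q) - 1) * (Real.exp x * (q - c) + 1) := by nlinarith
    have h4 : 0 < Real.exp x * (q - c) + 1 := by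
      have := mul_pos hy (by linarith : 0 < q - c)
      linarith
    have h5 := (pos_iff_pos_of_mul_pos h3).mpr h4
    rw [neg_lt, ← Real.log_exp (-x)]
    refine Real.log_lt_log (Real.exp_pos _) ?_
    rw [Real.exp_neg, inv_lt_iff_one_lt_mul₀ hy]
    linarith
  rcases lt_or_ge T 0 with hT | hT
  · -- `x ≥ -log 4`, the value on the curve at `0`
    have h0 : innerCurve b 0 ≤ x - b * T := by
      have hle : -Real.log 4 ≤ -Real.log (Real.cos T + √(8 + Real.cos T ^ 2)) := by
        have hq := abs_lt.mp (abs_lt_sqrt_eight_add_sq (Real.cos T))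
        have hc1 := Real.cos_le_one T
        have hq3 : √(8 + Real.cos T ^ 2) ≤ 3 := by
          rw [Real.sqrt_le_left (by norm_num)]
          nlinarith [Real.neg_one_le_cos T]
        exact neg_le_neg (Real.log_le_log (by linarith) (by linarith))
      have h9 : √(8 + (1 : ℝ) ^ 2) = 3 := by
        rw [show (8 + 1 ^ 2 : ℝ) = 3 ^ 2 by norm_num, Real.sqrt_sq (by norm_num)]
      rw [innerCurve, Real.cos_zero, h9]
      norm_num
      nlinarith
    exact ⟨fun h => (min_le_innerCurve hb h ⟨le_rfl, hpi.le⟩).trans h0,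
      fun h => (outerBound_le_innerCurve hb h ⟨le_rfl, hpi.le⟩).trans h0⟩
  · rcases le_or_gt T Real.pi with hTpi | hTpi
    · have h0 : innerCurve b T ≤ x - b * T := by rw [innerCurve]; linarith
      exact ⟨fun h => (min_le_innerCurve hb h ⟨hT, hTpi⟩).trans h0,
        fun h => (outerBound_le_innerCurve hb h ⟨hT, hTpi⟩).trans h0⟩
    · rw [abs_of_nonneg hT] at h2
      obtain ⟨h3, h4⟩ := h2 hTpi.le
      have hout : outerBound b ≤ x - b * T := by
        have hφ : T - Real.pi ∈ Ioo (-(Real.pi / 2)) (Real.pi / 2) := ⟨by linarith, by linarith⟩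
        have h5 := neg_log_cos_sub_ge (b := b) hφ
        have hc := Real.cos_pos_of_mem_Ioo hφ
        rw [Real.cos_sub_pi] at h5 hc
        have h6 : -(Real.log 2 + Real.log (-Real.cos T)) ≤ x := by
          rw [← Real.log_mul two_ne_zero hc.ne', neg_le, ← Real.log_exp (-x), Real.exp_neg]
          refine Real.log_le_log (by positivity) ?_
          rw [inv_le_iff_one_le_mul₀ (Real.exp_pos x)]
          linarith
        rw [outerBound]
        linarith
      exact ⟨fun _ => (min_le_right _ _).trans hout, fun _ => hout⟩

/-! ### Extremal functions -/

/-- For unimodular `x ≠ y`, the image of the disk under this function is the complement of a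
half-line; it is an extreme point of the class of close-to-convex functions. -/
noncomputable def extremalFun (x y u : ℂ) : ℂ := u * (1 - (x + y) / 2 * u) / (1 - y * u) ^ 2

theorem one_sub_mul_mem_slitPlane {y u : ℂ} (hy : ‖y‖ ≤ 1) (hu : u ∈ ball (0 : ℂ) 1) :
    1 - y * u ∈ slitPlane := by
  have hu' : ‖u‖ < 1 := by simpa using hu
  have h : ‖y * u‖ < 1 := by
    rw [norm_mul]
    nlinarith [norm_nonneg u, norm_nonneg y]
  exact one_sub_mem_slitPlane h.le (by intro h1; rw [h1, norm_one] at h; exact lt_irrefl _ h)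

theorem hasDerivAt_one_sub_mul (y u : ℂ) : HasDerivAt (fun u => 1 - y * u) (-y) u := by
  simpa using ((hasDerivAt_id u).const_mul y).const_sub 1

theorem hasDerivAt_extremalFun (x : ℂ) {y u : ℂ} (h : 1 - y * u ≠ 0) :
    HasDerivAt (extremalFun x y) ((1 - x * u) / (1 - y * u) ^ 3) u := by
  have h1 := (((hasDerivAt_id u).mul (hasDerivAt_one_sub_mul ((x + y) / 2) u)).div
    ((hasDerivAt_one_sub_mul y u).pow 2) (pow_ne_zero 2 h))
  refine h1.congr_deriv ?_
  simp only [id, Pi.mul_apply, Pi.pow_apply]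
  field_simp
  ring

/-- The image of the disk under `k u / (1 - y u)` is a half-plane. -/
theorem isConvexFunction_halfPlane {k y : ℂ} (hk : k ≠ 0) (hy : ‖y‖ = 1) :
    IsConvexFunction (fun u => k * u / (1 - y * u)) := by
  have hne : ∀ u ∈ ball (0 : ℂ) 1, 1 - y * u ≠ 0 := fun u hu =>
    slitPlane_ne_zero (one_sub_mul_mem_slitPlane hy.le hu)
  refine ⟨fun u hu => ?_, fun u hu v hv huv => ?_, ?_⟩
  · exact (((hasDerivAt_id u).const_mul k).div (hasDerivAt_one_sub_mul y u)
      (hne u hu)).differentiableAt.differentiableWithinAt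
  · have h1 := hne u hu
    have h2 := hne v hv
    rw [div_eq_div_iff h1 h2] at huv
    refine mul_left_cancel₀ hk ?_
    linear_combination huv
  · have himage : (fun u => k * u / (1 - y * u)) '' ball 0 1 =
        {w : ℂ | -(1 / 2) < (y * w / k).re} := by
      have hnorm : ∀ w : ℂ, -(1 / 2) < (y * w).re ↔ ‖w‖ < ‖1 + y * w‖ := by
        intro w
        have h1 : ‖1 + y * w‖ ^ 2 = 1 + 2 * (y * w).re + ‖w‖ ^ 2 := by
          have h2 : ‖w‖ ^ 2 = normSq (y * w) := by
            rw [normSq_eq_norm_sq, norm_mul, hy, one_mul]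
          rw [h2, ← normSq_eq_norm_sq, normSq_apply, normSq_apply]
          simp only [add_re, one_re, add_im, one_im]
          ring
        rw [← pow_lt_pow_iff_left₀ (norm_nonneg _) (norm_nonneg _) two_ne_zero, h1]
        constructor <;> intro h <;> linarith
      ext w
      constructor
      · rintro ⟨u, hu, rfl⟩
        have h1 := hne u hu
        have hu' : ‖u‖ < 1 := by simpa using hu
        simp only [mem_ofPred_eq]
        have h2 : y * (k * u / (1 - y * u)) / k = y * (u / (1 - y * u)) := by field_simp
        rw [h2, hnorm, show 1 + y * (u / (1 - y * u)) = 1 / (1 - y * u) by field_simp; ring,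
          norm_div, norm_div, norm_one]
        exact div_lt_div_of_pos_right hu' (norm_pos_iff.mpr h1)
      · intro hw
        simp only [mem_ofPred_eq] at hw
        rw [mul_div_assoc, hnorm] at hw
        set v := w / k with hv
        have h1 : 0 < ‖1 + y * v‖ := (norm_nonneg _).trans_lt hw
        have h2 : 1 + y * v ≠ 0 := norm_pos_iff.mp h1
        refine ⟨v / (1 + y * v), ?_, ?_⟩
        · rw [mem_ball_zero_iff, norm_div, div_lt_one h1]
          exact hw
        · have h3 : 1 - y * (v / (1 + y * v)) = 1 / (1 + y * v) := by field_simp; ring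
          have h4 : k * (v / (1 + y * v)) / (1 / (1 + y * v)) = k * v := by
            rw [div_div_eq_mul_div, div_one, mul_div_assoc', div_mul_cancel₀ _ h2]
          simp only
          rw [h3, h4, hv]
          field_simp
    rw [himage]
    refine convex_halfSpace_gt (f := fun w : ℂ => (y * w / k).re) ⟨fun a b => ?_, fun r a => ?_⟩ _
    · rw [mul_add, add_div, add_re]
    · rw [real_smul, mul_left_comm, mul_div_assoc, re_ofReal_mul, smul_eq_mul]

theorem isCloseToConvex_extremalFun {x y : ℂ} (hx : ‖x‖ = 1) (hy : ‖y‖ = 1) (hxy : x ≠ y) :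
    IsCloseToConvex (extremalFun x y) := by
  have hne : ∀ u ∈ ball (0 : ℂ) 1, 1 - y * u ≠ 0 := fun u hu =>
    slitPlane_ne_zero (one_sub_mul_mem_slitPlane hy.le hu)
  have h0 : (0 : ℂ) ∈ ball (0 : ℂ) 1 := mem_ball_self one_pos
  have hy0 : y ≠ 0 := by rintro rfl; simp at hy
  have hk : 1 - x / y ≠ 0 := by
    rw [sub_ne_zero]
    intro h
    rw [eq_div_iff hy0, one_mul] at h
    exact hxy h.symm
  have hdf : ∀ u ∈ ball (0 : ℂ) 1, deriv (extremalFun x y) u = (1 - x * u) / (1 - y * u) ^ 3 :=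
    fun u hu => (hasDerivAt_extremalFun x (hne u hu)).deriv
  refine ⟨⟨fun u hu => (hasDerivAt_extremalFun x
    (hne u hu)).differentiableAt.differentiableWithinAt, by simp [extremalFun], ?_⟩,
    fun u => (1 - x / y) * u / (1 - y * u), isConvexFunction_halfPlane hk hy, fun u hu => ?_⟩
  · rw [hdf 0 h0]; simp
  · have h1 := hne u hu
    have hdg : deriv (fun u => (1 - x / y) * u / (1 - y * u)) u =
        (1 - x / y) / (1 - y * u) ^ 2 := by
      refine ((((hasDerivAt_id u).const_mul (1 - x / y)).div (hasDerivAt_one_sub_mul y u)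
        h1).congr_deriv ?_).deriv
      simp only [id]
      field_simp
      ring
    rw [hdf u hu, hdg]
    have hkey : (1 - x * u) / (1 - y * u) ^ 3 / ((1 - x / y) / (1 - y * u) ^ 2) =
        1 + y * u / (1 - y * u) + x / y / (1 - x / y) := by
      have h2 : y - x ≠ 0 := sub_ne_zero.mpr hxy.symm
      have h3 : 1 - x / y = (y - x) / y := by field_simp
      have h4 : 1 + y * u / (1 - y * u) = 1 / (1 - y * u) := by field_simp; ring
      have h5 : x / y / ((y - x) / y) = x / (y - x) := by field_simp
      have h6 : (1 - x * u) / (1 - y * u) ^ 3 / ((y - x) / y / (1 - y * u) ^ 2) =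
          (1 - x * u) * y / ((1 - y * u) * (y - x)) := by field_simp
      rw [h3, h4, h5, h6, div_add_div _ _ h1 h2]
      congr 1
      ring
    rw [hkey, add_re, add_re, one_re]
    have h4 : ‖y * u‖ < 1 := by
      rw [norm_mul, hy, one_mul]; simpa using hu
    have h5 := neg_half_lt_re_div_one_sub h4
    have h6 : (x / y / (1 - x / y)).re = -(1 / 2) := by
      have h7 : ‖x / y‖ = 1 := by rw [norm_div, hx, hy, div_one]
      set t := x / y
      have h8 : normSq t = 1 := by rw [normSq_eq_norm_sq, h7, one_pow]
      have hpos := normSq_pos.mpr hk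
      rw [div_re, ← add_div, div_eq_iff hpos.ne']
      rw [normSq_apply] at h8 ⊢
      simp only [sub_re, one_re, sub_im, one_im]
      nlinarith
    linarith

theorem logQuotient_extremalFun {x y : ℂ} (hx : ‖x‖ = 1) (hy : ‖y‖ = 1) (hxy : x ≠ y) {u : ℂ}
    (hu : u ∈ ball (0 : ℂ) 1) :
    logQuotient (extremalFun x y) u = log (1 - (x + y) / 2 * u) - 2 * log (1 - y * u) := by
  have hf := isCloseToConvex_extremalFun hx hy hxy
  have hm : ‖(x + y) / 2‖ ≤ 1 := by
    rw [norm_div, div_le_one (by simp)]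
    refine (norm_add_le _ _).trans ?_
    rw [hx, hy]
    norm_num
  have hs1 : ∀ u ∈ ball (0 : ℂ) 1, 1 - (x + y) / 2 * u ∈ slitPlane := fun u hu =>
    one_sub_mul_mem_slitPlane hm hu
  have hs2 : ∀ u ∈ ball (0 : ℂ) 1, 1 - y * u ∈ slitPlane := fun u hu =>
    one_sub_mul_mem_slitPlane hy.le hu
  refine (isLogQuotient_logQuotient hf.toIsNormalizedAnalytic hf.injOn).eqOn
    (g₂ := fun u => log (1 - (x + y) / 2 * u) - 2 * log (1 - y * u)) ⟨fun v hv => ?_, by simp,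
      fun v hv => ?_⟩ hu
  · exact (((hasDerivAt_one_sub_mul _ v).clog (hs1 v hv)).sub (((hasDerivAt_one_sub_mul y v).clog
      (hs2 v hv)).const_mul 2)).differentiableAt.differentiableWithinAt
  · have h1 := slitPlane_ne_zero (hs2 v hv)
    rw [exp_sub, exp_log (slitPlane_ne_zero (hs1 v hv)), two_mul, exp_add, exp_log h1]
    rcases eq_or_ne v 0 with rfl | hv0
    · rw [hf.toIsNormalizedAnalytic.quotient_zero]; simp
    · rw [quotient_of_ne_zero hf.map_zero hv0, extremalFun]
      field_simp

/-- A bound for `Re L - b Im L` over the class extends to boundary values of extremal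
functions. -/
theorem le_boundary_value {x y : ℂ} (hx : ‖x‖ = 1) (hy : ‖y‖ = 1) (hxy : x ≠ y) (hy1 : y ≠ 1)
    {B b : ℝ} (hB : ∀ f, IsCloseToConvex f → ∀ z ∈ ball (0 : ℂ) 1,
      B ≤ (logQuotient f z).re - b * (logQuotient f z).im) :
    B ≤ (log (1 - (x + y) / 2) - 2 * log (1 - y)).re -
      b * (log (1 - (x + y) / 2) - 2 * log (1 - y)).im := by
  have hm : ‖(x + y) / 2‖ ≤ 1 := by
    rw [norm_div, div_le_one (by simp)]
    refine (norm_add_le _ _).trans ?_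
    rw [hx, hy]
    norm_num
  have hm1 : (x + y) / 2 ≠ 1 := by
    intro h
    have h1 : x = 2 - y := by linear_combination 2 * h
    have h2 : y.re < 1 := by
      refine lt_of_le_of_ne ((re_le_norm y).trans hy.le) fun h3 => hy1 ?_
      have h4 : normSq y = 1 := by rw [normSq_eq_norm_sq, hy, one_pow]
      rw [normSq_apply, h3] at h4
      exact Complex.ext (by simpa using h3) (by simpa using h4)
    have h3 : x.re ≤ 1 := (re_le_norm x).trans hx.le
    rw [h1] at h3
    norm_num at h3
    linarith
  have hlim : Filter.Tendsto (fun ρ : ℝ =>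
      log (1 - (x + y) / 2 * ρ) - 2 * log (1 - y * ρ)) (nhdsWithin 1 (Iio 1))
      (nhds (log (1 - (x + y) / 2) - 2 * log (1 - y))) := by
    have hc : ContinuousAt (fun ρ : ℝ => log (1 - (x + y) / 2 * ρ) - 2 * log (1 - y * ρ)) 1 := by
      have c1 : ∀ w : ℂ, ContinuousAt (fun ρ : ℝ => 1 - w * ρ) 1 := fun w => by fun_prop
      exact ((c1 _).clog (by simpa using one_sub_mem_slitPlane hm hm1)).sub
        (continuousAt_const.mul ((c1 _).clog (by simpa using one_sub_mem_slitPlane hy.le hy1)))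
    have := hc.tendsto
    simp only [ofReal_one, mul_one] at this
    exact this.mono_left nhdsWithin_le_nhds
  have hlim2 := ((continuous_re.tendsto _).comp hlim).sub
    (((continuous_im.tendsto _).comp hlim).const_mul b)
  refine ge_of_tendsto hlim2 ?_
  filter_upwards [Ioo_mem_nhdsLT (show (0 : ℝ) < 1 from one_pos)] with ρ hρ
  have hu : (ρ : ℂ) ∈ ball (0 : ℂ) 1 := by
    rw [mem_ball_zero_iff, norm_real, Real.norm_of_nonneg hρ.1.le]
    exact hρ.2
  have := hB _ (isCloseToConvex_extremalFun hx hy hxy) ρ hu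
  rwa [logQuotient_extremalFun hx hy hxy hu] at this

/-- Conjugating the parameters of the extremal function conjugates the boundary value, so that the
sign of `b` does not matter. -/
theorem le_boundary_value_abs {x y : ℂ} (hx : ‖x‖ = 1) (hy : ‖y‖ = 1) (hxy : x ≠ y) (hy1 : y ≠ 1)
    {B b : ℝ} (hB : ∀ f, IsCloseToConvex f → ∀ z ∈ ball (0 : ℂ) 1,
      B ≤ (logQuotient f z).re - b * (logQuotient f z).im)
    {L : ℂ} (hL : log (1 - (x + y) / 2) - 2 * log (1 - y) = L) :
    B ≤ L.re - |b| * L.im := by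
  rw [← hL]
  rcases abs_cases b with ⟨h, -⟩ | ⟨h, -⟩
  · rw [h]
    exact le_boundary_value hx hy hxy hy1 hB
  · rw [h]
    have key := le_boundary_value (x := (starRingEnd ℂ) x) (y := (starRingEnd ℂ) y)
      (by rwa [norm_conj]) (by rwa [norm_conj]) (fun h => hxy ((starRingEnd ℂ).injective h))
      (fun h => hy1 ((starRingEnd ℂ).injective (by rw [h, map_one]))) hB
    have harg : ∀ {w : ℂ}, ‖w‖ ≤ 1 → (1 - w).arg ≠ Real.pi := by
      intro w hw
      rcases eq_or_ne w 1 with rfl | hw1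
      · rw [sub_self, arg_zero]; exact Real.pi_pos.ne
      · exact slitPlane_arg_ne_pi (one_sub_mem_slitPlane hw hw1)
    have hm : ‖(x + y) / 2‖ ≤ 1 := by
      rw [norm_div, div_le_one (by simp)]
      refine (norm_add_le _ _).trans ?_
      rw [hx, hy]
      norm_num
    have h1 : log (1 - ((starRingEnd ℂ) x + (starRingEnd ℂ) y) / 2) -
        2 * log (1 - (starRingEnd ℂ) y) =
        (starRingEnd ℂ) (log (1 - (x + y) / 2) - 2 * log (1 - y)) := by
      rw [map_sub, map_mul, ← log_conj _ (harg hm), ← log_conj _ (harg hy.le)]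
      simp [map_ofNat (starRingEnd ℂ) 2]
    rw [h1, conj_re, conj_im] at key
    linarith

theorem log_eq_of_exp_eq {z w : ℂ} (h : exp w = z) (h1 : -Real.pi < w.im) (h2 : w.im ≤ Real.pi) :
    log z = w := by
  rw [← h, log_exp h1 h2]

theorem one_add_mul_I_ne_zero (a : ℝ) : 1 + (a : ℂ) * I ≠ 0 := by
  intro h
  have := congrArg re h
  simp at this

theorem re_log_one_add_mul_I (a : ℝ) : (log (1 + a * I)).re = Real.log (1 + a ^ 2) / 2 := by
  have h : ‖1 + (a : ℂ) * I‖ = √(1 + a ^ 2) := by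
    rw [norm_def, normSq_apply]
    congr 1
    simp
    ring
  rw [log_re, h, Real.log_sqrt (by positivity)]

theorem im_log_one_add_mul_I (a : ℝ) : (log (1 + a * I)).im = Real.arctan a := by
  have h1 : 0 < (1 + (a : ℂ) * I).re := by simp
  have h2 := abs_lt.mp (abs_arg_lt_pi_div_two h1)
  rw [log_im, ← Real.arctan_tan h2.1 h2.2, tan_arg]
  simp

theorem norm_neg_conj_div {d : ℂ} (hd : d ≠ 0) : ‖-(starRingEnd ℂ) d / d‖ = 1 := by
  rw [norm_div, norm_neg, norm_conj, div_self (norm_ne_zero_iff.mpr hd)]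

theorem exp_log_two : exp (Real.log 2 : ℝ) = 2 := by
  rw [← ofReal_exp, Real.exp_log two_pos]
  norm_num

theorem log_two_div (a : ℝ) : log (2 / (1 + a * I)) = (Real.log 2 : ℝ) - log (1 + a * I) := by
  have him : (((Real.log 2 : ℝ) : ℂ) - log (1 + a * I)).im = -Real.arctan a := by
    rw [sub_im, ofReal_im, im_log_one_add_mul_I, zero_sub]
  have h1 := Real.arctan_lt_pi_div_two a
  have h2 := Real.neg_pi_div_two_lt_arctan a
  refine log_eq_of_exp_eq ?_ (by rw [him]; linarith) (by rw [him]; linarith)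
  rw [exp_sub, exp_log_two, exp_log (one_add_mul_I_ne_zero a)]

/-- The minimum on the curve `|z / f z - 1| = 3` is a boundary value of an extremal function. -/
theorem le_innerBound {B b : ℝ} (hb : 8 * b ^ 2 < 1)
    (hB : ∀ f, IsCloseToConvex f → ∀ z ∈ ball (0 : ℂ) 1,
      B ≤ (logQuotient f z).re - b * (logQuotient f z).im) : B ≤ innerBound |b| := by
  rw [innerBound, sq_abs]
  set s := √(1 - 8 * b ^ 2)
  have hs0 : 0 < s := Real.sqrt_pos.mpr (by linarith)
  have hs2 : s ^ 2 = 1 - 8 * |b| ^ 2 := by rw [sq_abs]; exact Real.sq_sqrt (by linarith)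
  rw [← sq_abs]
  set β := |b| with hβ
  -- the parameter with `β = a / (2 + a ^ 2)`, which makes all boundary data rational
  set a := 4 * β / (1 + s) with ha
  have ha2 : a ^ 2 = 2 * (1 - s) / (1 + s) := by
    rw [ha]
    field_simp
    linear_combination 2 * hs2
  have hβa : β = a / (2 + a ^ 2) := by
    rw [ha2, ha]
    field_simp
    ring
  have hsa : s = (2 - a ^ 2) / (2 + a ^ 2) := by
    rw [ha2]
    field_simp
    ring
  have ha2' : a ^ 2 < 2 := by
    rw [ha2, div_lt_iff₀ (by positivity)]
    linarith
  -- unimodular parameters `-conj d / d` and `-conj e / e`, equal to `1 - 2 a / d` and `1 - 2 / e`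
  set d : ℂ := a - (2 + a ^ 2) * I with hd
  set e : ℂ := 1 + a * I with he
  have he0 : e ≠ 0 := one_add_mul_I_ne_zero a
  have hd0 : d ≠ 0 := by
    intro h
    have := congrArg im h
    simp [hd, ← ofReal_pow] at this
    nlinarith
  have hdc : (starRingEnd ℂ) d = 2 * a - d := by
    simp [hd, ← ofReal_pow, map_ofNat (starRingEnd ℂ) 2]; ring
  have hec : (starRingEnd ℂ) e = 2 - e := by simp [he]; ring
  have hx1 : -(starRingEnd ℂ) d / d = 1 - 2 * a / d := by rw [hdc]; field_simp; ring
  have hy1 : -(starRingEnd ℂ) e / e = 1 - 2 / e := by rw [hec]; field_simp; ring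
  have hxy : -(starRingEnd ℂ) d / d ≠ -(starRingEnd ℂ) e / e := by
    rw [hx1, hy1]
    intro h
    have h1 : 2 * (a : ℂ) / d = 2 / e := by linear_combination -h
    rw [div_eq_div_iff hd0 he0] at h1
    have h2 := congrArg im h1
    simp [hd, he, ← ofReal_pow] at h2
    nlinarith
  have hyne : -(starRingEnd ℂ) e / e ≠ 1 := by
    rw [hy1]
    intro h
    have : 2 / e = 0 := by linear_combination -h
    simp [he0] at this
  have hv0 := one_add_mul_I_ne_zero (-(a / 2))
  have hmid : 1 - (-(starRingEnd ℂ) d / d + -(starRingEnd ℂ) e / e) / 2 =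
      1 / ((1 + ((-(a / 2) : ℝ) : ℂ) * I) * e) := by
    rw [hx1, hy1]
    have : 1 - (1 - 2 * (a : ℂ) / d + (1 - 2 / e)) / 2 = (a * e + d) / (d * e) := by
      field_simp; ring
    rw [this, div_eq_div_iff (mul_ne_zero hd0 he0) (mul_ne_zero hv0 he0)]
    simp only [hd, he]
    push_cast
    linear_combination (1 + (a : ℂ) * I) * (a : ℂ) * I_sq
  have hlog : log (1 - (-(starRingEnd ℂ) d / d + -(starRingEnd ℂ) e / e) / 2) =
      -log (1 + ((-(a / 2) : ℝ) : ℂ) * I) - log e := by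
    have him : (-log (1 + ((-(a / 2) : ℝ) : ℂ) * I) - log e).im =
        Real.arctan (a / 2) - Real.arctan a := by
      rw [sub_im, neg_im, im_log_one_add_mul_I, he, im_log_one_add_mul_I, Real.arctan_neg, neg_neg]
    have h1 := Real.arctan_lt_pi_div_two a
    have h2 := Real.neg_pi_div_two_lt_arctan a
    have h3 := Real.arctan_lt_pi_div_two (a / 2)
    have h4 := Real.neg_pi_div_two_lt_arctan (a / 2)
    refine log_eq_of_exp_eq ?_ (by rw [him]; linarith) (by rw [him]; linarith)
    rw [hmid, exp_sub, exp_neg, exp_log hv0, exp_log he0]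
    field_simp
  have key := le_boundary_value_abs (norm_neg_conj_div hd0) (norm_neg_conj_div he0) hxy hyne hB rfl
  rw [hlog, hy1, sub_sub_cancel, he, log_two_div] at key
  have hTsum : Real.arctan (a / 2) + Real.arctan a = Real.arctan (3 * β / s) := by
    rw [Real.arctan_add (by nlinarith)]
    congr 1
    have h1 : 2 - a ^ 2 ≠ 0 := by linarith
    rw [hβa, hsa]
    field_simp
    ring
  have hlog1 : Real.log (s + 3) = 3 * Real.log 2 + Real.log (1 + (a / 2) ^ 2) -
      Real.log (2 + a ^ 2) := by
    have : s + 3 = 2 ^ 3 * (1 + (a / 2) ^ 2) / (2 + a ^ 2) := by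
      rw [hsa]; field_simp; ring
    rw [this, Real.log_div (by positivity) (by positivity), Real.log_mul (by positivity)
      (by positivity), Real.log_pow]
    norm_num
  have hlog2 : Real.log (1 + β ^ 2) = 2 * Real.log 2 + Real.log (1 + a ^ 2) +
      Real.log (1 + (a / 2) ^ 2) - 2 * Real.log (2 + a ^ 2) := by
    have : 1 + β ^ 2 = 2 ^ 2 * (1 + a ^ 2) * (1 + (a / 2) ^ 2) / (2 + a ^ 2) ^ 2 := by
      rw [hβa]; field_simp; ring
    rw [this, Real.log_div (by positivity) (by positivity), Real.log_mul (by positivity)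
      (by positivity), Real.log_mul (by positivity) (by positivity), Real.log_pow, Real.log_pow]
    norm_num
  have hre : (-log (1 + ((-(a / 2) : ℝ) : ℂ) * I) - log (1 + a * I) -
      2 * ((Real.log 2 : ℝ) - log (1 + a * I))).re =
      -(Real.log (1 + (a / 2) ^ 2) / 2) + Real.log (1 + a ^ 2) / 2 - 2 * Real.log 2 := by
    have h2 : (2 * (((Real.log 2 : ℝ) : ℂ) - log (1 + a * I))).re =
        2 * (Real.log 2 - Real.log (1 + a ^ 2) / 2) := by
      rw [show (2 : ℂ) = ((2 : ℝ) : ℂ) by norm_num, re_ofReal_mul, sub_re, ofReal_re,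
        re_log_one_add_mul_I]
    rw [sub_re, sub_re, neg_re, h2, re_log_one_add_mul_I, re_log_one_add_mul_I, neg_sq]
    ring
  have him : (-log (1 + ((-(a / 2) : ℝ) : ℂ) * I) - log (1 + a * I) -
      2 * ((Real.log 2 : ℝ) - log (1 + a * I))).im = Real.arctan (a / 2) + Real.arctan a := by
    have h2 : (2 * (((Real.log 2 : ℝ) : ℂ) - log (1 + a * I))).im = 2 * -Real.arctan a := by
      rw [show (2 : ℂ) = ((2 : ℝ) : ℂ) by norm_num, im_ofReal_mul, sub_im, ofReal_im,
        im_log_one_add_mul_I, zero_sub]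
    rw [sub_im, sub_im, neg_im, h2, im_log_one_add_mul_I, im_log_one_add_mul_I, Real.arctan_neg]
    ring
  rw [hre, him, hTsum, ← hβ] at key
  rw [hlog1, hlog2]
  linarith

/-- Boundary values of extremal functions with `1 - x = 2 / (1 + Y i)`, `1 - y = 2 / (1 + X i)`. -/
theorem le_boundary_value_arctan {B b X Y : ℝ} (hXY : X ≠ Y)
    (hB : ∀ f, IsCloseToConvex f → ∀ z ∈ ball (0 : ℂ) 1,
      B ≤ (logQuotient f z).re - b * (logQuotient f z).im) :
    B ≤ Real.log (1 + ((X + Y) / 2) ^ 2) / 2 + Real.log (1 + X ^ 2) / 2 -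
      Real.log (1 + Y ^ 2) / 2 - Real.log 2 -
      |b| * (Real.arctan ((X + Y) / 2) + Real.arctan X - Real.arctan Y) := by
  have hpi := Real.pi_pos
  set d : ℂ := 1 + Y * I with hd
  set e : ℂ := 1 + X * I with he
  have he0 : e ≠ 0 := one_add_mul_I_ne_zero X
  have hd0 : d ≠ 0 := one_add_mul_I_ne_zero Y
  have hdc : (starRingEnd ℂ) d = 2 - d := by simp [hd]; ring
  have hec : (starRingEnd ℂ) e = 2 - e := by simp [he]; ring
  have hx1 : -(starRingEnd ℂ) d / d = 1 - 2 / d := by rw [hdc]; field_simp; ring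
  have hy1 : -(starRingEnd ℂ) e / e = 1 - 2 / e := by rw [hec]; field_simp; ring
  have hxy : -(starRingEnd ℂ) d / d ≠ -(starRingEnd ℂ) e / e := by
    rw [hx1, hy1]
    intro h
    have h1 : (2 : ℂ) / d = 2 / e := by linear_combination -h
    rw [div_eq_div_iff hd0 he0] at h1
    have h2 := congrArg im h1
    simp [hd, he] at h2
    exact hXY h2
  have hyne : -(starRingEnd ℂ) e / e ≠ 1 := by
    rw [hy1]
    intro h
    have : 2 / e = 0 := by linear_combination -h
    simp [he0] at this
  have hv0 := one_add_mul_I_ne_zero ((X + Y) / 2)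
  have hmid : 1 - (-(starRingEnd ℂ) d / d + -(starRingEnd ℂ) e / e) / 2 =
      2 * (1 + (((X + Y) / 2 : ℝ) : ℂ) * I) / (e * d) := by
    rw [hx1, hy1]
    have : 1 - (1 - 2 / d + (1 - 2 / e)) / 2 = (e + d) / (e * d) := by
      field_simp; ring
    rw [this]
    congr 1
    simp only [hd, he]
    push_cast
    ring
  set v : ℂ := 1 + (((X + Y) / 2 : ℝ) : ℂ) * I with hv
  have hlog : log (1 - (-(starRingEnd ℂ) d / d + -(starRingEnd ℂ) e / e) / 2) =
      (Real.log 2 : ℝ) + log v - log e - log d := by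
    have him : (((Real.log 2 : ℝ) : ℂ) + log v - log e - log d).im =
        Real.arctan ((X + Y) / 2) - Real.arctan X - Real.arctan Y := by
      rw [sub_im, sub_im, add_im, ofReal_im, hv, im_log_one_add_mul_I, he, im_log_one_add_mul_I,
        hd, im_log_one_add_mul_I, zero_add]
    have h1 := Real.arctan_lt_pi_div_two X
    have h2 := Real.neg_pi_div_two_lt_arctan X
    have h3 := Real.arctan_lt_pi_div_two Y
    have h4 := Real.neg_pi_div_two_lt_arctan Y
    -- the arctangent of the mean lies between those of `X` and `Y`
    have h5 : |Real.arctan ((X + Y) / 2) - Real.arctan X - Real.arctan Y| < Real.pi / 2 := by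
      rw [abs_lt]
      rcases le_total X Y with h | h
      · have m1 := Real.arctan_strictMono.monotone (show X ≤ (X + Y) / 2 by linarith)
        have m2 := Real.arctan_strictMono.monotone (show (X + Y) / 2 ≤ Y by linarith)
        constructor <;> linarith
      · have m1 := Real.arctan_strictMono.monotone (show Y ≤ (X + Y) / 2 by linarith)
        have m2 := Real.arctan_strictMono.monotone (show (X + Y) / 2 ≤ X by linarith)
        constructor <;> linarith
    have h6 := abs_lt.mp h5
    refine log_eq_of_exp_eq ?_ (by rw [him]; linarith [h6.1]) (by rw [him]; linarith [h6.2])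
    rw [hmid, exp_sub, exp_sub, exp_add, exp_log_two, exp_log hv0, exp_log he0, exp_log hd0,
      div_div]
  have key := le_boundary_value_abs (norm_neg_conj_div hd0) (norm_neg_conj_div he0) hxy hyne hB rfl
  rw [hlog, hy1, sub_sub_cancel, hv, hd, he, log_two_div] at key
  have h2 : 2 * (((Real.log 2 : ℝ) : ℂ) - log (1 + X * I)) =
      ((2 * Real.log 2 : ℝ) : ℂ) - ((2 : ℝ) : ℂ) * log (1 + X * I) := by push_cast; ring
  rw [h2] at key
  simp only [sub_re, sub_im, add_re, add_im, ofReal_re, ofReal_im, re_ofReal_mul, im_ofReal_mul,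
    re_log_one_add_mul_I, im_log_one_add_mul_I] at key
  refine key.trans (le_of_eq ?_)
  ring

/-- The minimum on the curve `Re (f z / z) = -1 / 2` is the limit of boundary values of extremal
functions with `X + Y = 2 |b|` and `X → ∞`. -/
theorem le_outerBound {B b : ℝ} (hB : ∀ f, IsCloseToConvex f → ∀ z ∈ ball (0 : ℂ) 1,
      B ≤ (logQuotient f z).re - b * (logQuotient f z).im) : B ≤ outerBound |b| := by
  set β := |b| with hβ
  have hX : Filter.Tendsto (fun X : ℝ => X) Filter.atTop Filter.atTop := Filter.tendsto_id
  have hY : Filter.Tendsto (fun X : ℝ => 2 * β - X) Filter.atTop Filter.atBot :=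
    Filter.tendsto_atBot_add_const_left _ (2 * β) Filter.tendsto_neg_atTop_atBot
  -- the logarithms in `X` and `Y` cancel in the limit, and the arctangents contribute `π`
  have hratio : Filter.Tendsto (fun X : ℝ => (1 + X ^ 2) / (1 + (2 * β - X) ^ 2)) Filter.atTop
      (nhds 1) := by
    have hinv : Filter.Tendsto (fun X : ℝ => X⁻¹) Filter.atTop (nhds 0) := tendsto_inv_atTop_zero
    have h1 : Filter.Tendsto (fun X : ℝ => (X⁻¹ ^ 2 + 1) / (X⁻¹ ^ 2 + (2 * β * X⁻¹ - 1) ^ 2))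
        Filter.atTop (nhds ((0 ^ 2 + 1) / (0 ^ 2 + (2 * β * 0 - 1) ^ 2))) :=
      ((hinv.pow 2).add_const 1).div
        ((hinv.pow 2).add (((hinv.const_mul (2 * β)).sub_const 1).pow 2))
        (by norm_num)
    norm_num at h1
    refine h1.congr' ?_
    filter_upwards [Filter.eventually_gt_atTop 0] with X hX0
    have h2 : (1 + (2 * β - X) ^ 2) ≠ 0 := by positivity
    have h3 : ((X ^ 2)⁻¹ + (2 * β * X⁻¹ - 1) ^ 2) ≠ 0 := by positivity
    rw [div_eq_div_iff h3 h2]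
    field_simp
  have hlogs : Filter.Tendsto (fun X : ℝ => Real.log (1 + X ^ 2) / 2 -
      Real.log (1 + (2 * β - X) ^ 2) / 2) Filter.atTop (nhds 0) := by
    have h1 := ((Real.continuousAt_log one_ne_zero).tendsto.comp hratio).div_const 2
    rw [Real.log_one, zero_div] at h1
    refine h1.congr fun X => ?_
    simp only [Function.comp]
    rw [Real.log_div (by positivity) (by positivity)]
    ring
  have harc : Filter.Tendsto (fun X : ℝ => Real.arctan X - Real.arctan (2 * β - X)) Filter.atTop
      (nhds (Real.pi / 2 - -(Real.pi / 2))) :=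
    ((Real.tendsto_arctan_atTop.mono_right nhdsWithin_le_nhds).comp hX).sub
      ((Real.tendsto_arctan_atBot.mono_right nhdsWithin_le_nhds).comp hY)
  have hlim := ((hlogs.const_add (Real.log (1 + β ^ 2) / 2 - Real.log 2)).sub
    ((harc.const_add (Real.arctan β)).const_mul β))
  have hval : Real.log (1 + β ^ 2) / 2 - Real.log 2 + 0 -
      β * (Real.arctan β + (Real.pi / 2 - -(Real.pi / 2))) = outerBound β := by
    rw [outerBound]; ring
  rw [hval] at hlim
  refine ge_of_tendsto hlim ?_
  filter_upwards [Filter.eventually_gt_atTop β] with X hX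
  have key := le_boundary_value_arctan (X := X) (Y := 2 * β - X) (by intro h; linarith) hB
  rw [show (X + (2 * β - X)) / 2 = β by ring, ← hβ] at key
  linarith

/-! ### General exponents -/

theorem quotient_powerDeformation {f : ℂ → ℂ} (hf : IsCloseToConvex f) (c : ℂ) {z : ℂ}
    (hz : z ∈ ball (0 : ℂ) 1) :
    quotient (powerDeformation c f) z = exp (c * logQuotient f z) := by
  have hL := isLogQuotient_logQuotient hf.toIsNormalizedAnalytic hf.injOn
  by_cases h : z = 0
  · have hd := ((hL.differentiableOn.differentiableAt (isOpen_ball.mem_nhds hz)).const_mul c).cexp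
    have h1 := (hasDerivAt_id z).mul hd.hasDerivAt
    subst h
    have h2 : deriv (powerDeformation c f) 0 = _ := h1.deriv
    simp [quotient, h2]
  · rw [quotient_of_ne_zero (by simp [powerDeformation]) h, powerDeformation,
      mul_div_cancel_left₀ _ h]

theorem log_norm_quotient_powerDeformation {f : ℂ → ℂ} (hf : IsCloseToConvex f) {a : ℝ}
    (ha : a ≠ 0) (b : ℝ) {z : ℂ} (hz : z ∈ ball (0 : ℂ) 1) :
    Real.log ‖quotient (powerDeformation (a + b * I) f) z‖ =
      a * ((logQuotient f z).re - b / a * (logQuotient f z).im) := by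
  rw [quotient_powerDeformation hf _ hz, norm_exp, Real.log_exp]
  simp
  field_simp

/-- The values of `log |f_c z / z|` for `c = 1 + β i`, to which all other exponents with nonzero
real part reduce by scaling. -/
def normalizedValues (β : ℝ) : Set ℝ :=
  {x | ∃ f : ℂ → ℂ, IsCloseToConvex f ∧ ∃ z ∈ ball (0 : ℂ) 1,
    x = (logQuotient f z).re - β * (logQuotient f z).im}

theorem logModulusValues_eq_image {a : ℝ} (ha : a ≠ 0) (b : ℝ) :
    logModulusValues (a + b * I) = (a * ·) '' normalizedValues (b / a) := by
  ext x
  constructor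
  · rintro ⟨f, hf, z, hz, rfl⟩
    exact ⟨_, ⟨f, hf, z, hz, rfl⟩, (log_norm_quotient_powerDeformation hf ha b hz).symm⟩
  · rintro ⟨_, ⟨f, hf, z, hz, rfl⟩, rfl⟩
    exact ⟨f, hf, z, hz, (log_norm_quotient_powerDeformation hf ha b hz).symm⟩

theorem IsCloseToConvex.bounds_le {f : ℂ → ℂ} (hf : IsCloseToConvex f) {z : ℂ}
    (hz : z ∈ ball (0 : ℂ) 1) (β : ℝ) :
    (8 * β ^ 2 < 1 → min (innerBound |β|) (outerBound |β|) ≤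
      (logQuotient f z).re - β * (logQuotient f z).im) ∧
    (1 ≤ 8 * β ^ 2 → outerBound |β| ≤ (logQuotient f z).re - β * (logQuotient f z).im) := by
  obtain ⟨h1, h2⟩ := hf.logQuotient_mem hz
  rw [norm_exp, exp_re] at h1
  rw [exp_re] at h2
  rcases le_total 0 β with hβ | hβ
  · rw [abs_of_nonneg hβ]
    exact bounds_le_sub_mul hβ h1 h2
  · rw [abs_of_nonpos hβ]
    have := bounds_le_sub_mul (x := (logQuotient f z).re) (T := -(logQuotient f z).im)
      (neg_nonneg.mpr hβ) (by rwa [Real.cos_neg]) (by rwa [Real.cos_neg, abs_neg])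
    simpa using this

theorem isGLB_normalizedValues_inner {β : ℝ} (hβ : 8 * β ^ 2 < 1) (h : thresholdFun |β| ≤ 0) :
    IsGLB (normalizedValues β) (innerBound |β|) := by
  have hle : innerBound |β| ≤ outerBound |β| := by linarith [innerBound_sub_outerBound |β|]
  constructor
  · rintro _ ⟨f, hf, z, hz, rfl⟩
    have := (hf.bounds_le hz β).1 hβ
    rwa [min_eq_left hle] at this
  · exact fun B hB => le_innerBound hβ fun f hf z hz => hB ⟨f, hf, z, hz, rfl⟩

theorem isGLB_normalizedValues_outer {β : ℝ} (h : 8 * β ^ 2 < 1 → 0 ≤ thresholdFun |β|) :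
    IsGLB (normalizedValues β) (outerBound |β|) := by
  constructor
  · rintro _ ⟨f, hf, z, hz, rfl⟩
    rcases lt_or_ge (8 * β ^ 2) 1 with h8 | h8
    · have := (hf.bounds_le hz β).1 h8
      rwa [min_eq_right (by linarith [innerBound_sub_outerBound |β|, h h8])] at this
    · exact (hf.bounds_le hz β).2 h8
  · exact fun B hB => le_outerBound fun f hf z hz => hB ⟨f, hf, z, hz, rfl⟩

theorem isGLB_mul_image {s : Set ℝ} {m a : ℝ} (ha : 0 < a) (h : IsGLB s m) :
    IsGLB ((a * ·) '' s) (a * m) :=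
  (OrderIso.mulLeft₀ a ha).isGLB_image'.mpr h

theorem isLUB_mul_image {s : Set ℝ} {m a : ℝ} (ha : a < 0) (h : IsGLB s m) :
    IsLUB ((a * ·) '' s) (a * m) := by
  have h1 := isGLB_mul_image (neg_pos.mpr ha) h
  constructor
  · rintro _ ⟨x, hx, rfl⟩
    exact mul_le_mul_of_nonpos_left (h.1 hx) ha.le
  · intro B hB
    have := h1.2 (show -B ∈ _ from by
      rintro _ ⟨x, hx, rfl⟩
      have := hB ⟨x, hx, rfl⟩
      simp only at this ⊢
      linarith)
    linarith

theorem innerBound_abs (b : ℝ) : innerBound |b| = innerBound b := by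
  rcases abs_choice b with h | h <;> rw [h]
  simp only [innerBound]
  rw [neg_sq, mul_neg, neg_div, Real.arctan_neg]
  ring

theorem sqrt_sq_sub {a : ℝ} (ha : a ≠ 0) (b : ℝ) :
    √(a ^ 2 - 8 * b ^ 2) = |a| * √(1 - 8 * (b / a) ^ 2) := by
  rw [← Real.sqrt_sq_eq_abs, ← Real.sqrt_mul (sq_nonneg a)]
  congr 1
  field_simp

theorem mul_innerBound {a b : ℝ} (ha : a ≠ 0) (hb : 8 * (b / a) ^ 2 < 1) :
    a * innerBound |b / a| = -(a / 2) * Real.log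
        (2 * (5 * a ^ 2 - 4 * b ^ 2 + 3 * |a| * √(a ^ 2 - 8 * b ^ 2)) / (a ^ 2 + b ^ 2)) -
      a * (b / a) * Real.arctan (3 * (b / a) / √(1 - 8 * (b / a) ^ 2)) := by
  rw [innerBound_abs, sqrt_sq_sub ha]
  obtain ⟨β, rfl⟩ : ∃ β, b = β * a := ⟨b / a, by field_simp⟩
  rw [mul_div_cancel_right₀ β ha] at *
  set s := √(1 - 8 * β ^ 2) with hs
  have hs2 : s ^ 2 = 1 - 8 * β ^ 2 := Real.sq_sqrt (by linarith)
  have hq : 2 * (5 * a ^ 2 - 4 * (β * a) ^ 2 + 3 * |a| * (|a| * s)) / (a ^ 2 + (β * a) ^ 2) =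
      (s + 3) ^ 2 / (1 + β ^ 2) := by
    have h1 : |a| * |a| = a ^ 2 := by rw [← sq, sq_abs]
    have h2 : a ^ 2 + (β * a) ^ 2 = a ^ 2 * (1 + β ^ 2) := by ring
    have h3 : 2 * (5 * a ^ 2 - 4 * (β * a) ^ 2 + 3 * |a| * (|a| * s)) = a ^ 2 * (s + 3) ^ 2 := by
      linear_combination 6 * s * h1 - a ^ 2 * hs2
    rw [h2, h3, mul_div_mul_left _ _ (pow_ne_zero 2 ha)]
  rw [hq, Real.log_div (by positivity) (by positivity), Real.log_pow, innerBound, ← hs]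
  push_cast
  ring

theorem mul_outerBound {a : ℝ} (ha : a ≠ 0) (b : ℝ) :
    a * outerBound |b / a| = a / 2 * Real.log (a ^ 2 + b ^ 2) - a * Real.log (2 * |a|) -
      a * |b / a| * (Real.arctan |b / a| + Real.pi) := by
  have ha' : 0 < |a| := abs_pos.mpr ha
  have h : 1 + |b / a| ^ 2 = (a ^ 2 + b ^ 2) / |a| ^ 2 := by
    rw [sq_abs, sq_abs]
    field_simp
  have h0 : a ^ 2 + b ^ 2 ≠ 0 := by positivity
  rw [outerBound, h, Real.log_div h0 (by positivity), Real.log_pow,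
    Real.log_mul two_ne_zero ha'.ne']
  push_cast
  ring

end PowerDeformation

open PowerDeformation

theorem theorem5p1 :
    ∃ b₀ : ℝ,
      (0 < b₀ ∧ b₀ < 1 / (2 * √2) ∧ PowerDeformation.ThresholdEquation b₀) ∧
      (∀ b : ℝ, 0 < b → b < 1 / (2 * √2) → PowerDeformation.ThresholdEquation b → b = b₀) ∧
      (0.24001 ≤ b₀ ∧ b₀ < 0.24002) ∧
      ∀ a b : ℝ,
        (0 < a →
          (|b / a| ≤ b₀ →
            IsGLB (PowerDeformation.logModulusValues (a + b * Complex.I))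
              (-(a / 2) * Real.log
                  (2 * (5 * a ^ 2 - 4 * b ^ 2 + 3 * a * √(a ^ 2 - 8 * b ^ 2)) / (a ^ 2 + b ^ 2))
                - b * Real.arctan (3 * b / √(a ^ 2 - 8 * b ^ 2)))) ∧
          (b₀ ≤ |b / a| →
            IsGLB (PowerDeformation.logModulusValues (a + b * Complex.I))
              (a / 2 * Real.log (a ^ 2 + b ^ 2) - a * Real.log (2 * a)
                - |b| * (Real.arctan |b / a| + Real.pi)))) ∧
        (a < 0 →
          (|b / a| ≤ b₀ →
            IsLUB (PowerDeformation.logModulusValues (a + b * Complex.I))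
              (-(a / 2) * Real.log
                  (2 * (5 * a ^ 2 - 4 * b ^ 2 + 3 * |a| * √(a ^ 2 - 8 * b ^ 2)) / (a ^ 2 + b ^ 2))
                + b * Real.arctan (3 * b / √(a ^ 2 - 8 * b ^ 2)))) ∧
          (b₀ ≤ |b / a| →
            IsLUB (PowerDeformation.logModulusValues (a + b * Complex.I))
              (a / 2 * Real.log (a ^ 2 + b ^ 2) - a * Real.log (2 * |a|)
                + |b| * (Real.arctan |b / a| + Real.pi)))) := by
  obtain ⟨b₀, hl, hu, hb₀⟩ := exists_threshold
  have h0 : 0 < b₀ := by linarith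
  have h8 : 8 * b₀ ^ 2 < 1 := by nlinarith
  have hlt : b₀ < 1 / (2 * √2) := (lt_one_div_iff h0.le).mpr h8
  have hmono := strictMonoOn_thresholdFun
  have hmem : b₀ ∈ Ico 0 (1 / (2 * √2)) := ⟨h0.le, hlt⟩
  have hinner : ∀ β : ℝ, |β| ≤ b₀ → 8 * β ^ 2 < 1 ∧
      IsGLB (normalizedValues β) (innerBound |β|) := by
    intro β hβ
    have hβ8 : 8 * β ^ 2 < 1 := by
      rw [← sq_abs]
      nlinarith [abs_nonneg β]
    refine ⟨hβ8, isGLB_normalizedValues_inner hβ8 ?_⟩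
    rw [← hb₀]
    exact hmono.monotoneOn ⟨abs_nonneg β, hβ.trans_lt hlt⟩ hmem hβ
  have houter : ∀ β : ℝ, b₀ ≤ |β| → IsGLB (normalizedValues β) (outerBound |β|) := by
    intro β hβ
    refine isGLB_normalizedValues_outer fun hβ8 => ?_
    rw [← hb₀]
    refine hmono.monotoneOn hmem ⟨abs_nonneg β, (lt_one_div_iff (abs_nonneg β)).mpr ?_⟩ hβ
    rwa [sq_abs]
  refine ⟨b₀, ⟨h0, hlt, (thresholdEquation_iff h8).mpr hb₀⟩, fun b hb hb' hE => ?_, ⟨hl, hu⟩,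
    fun a b => ⟨fun ha => ⟨fun h => ?_, fun h => ?_⟩, fun ha => ⟨fun h => ?_, fun h => ?_⟩⟩⟩
  · refine hmono.injOn ⟨hb.le, hb'⟩ hmem ?_
    rw [hb₀]
    exact (thresholdEquation_iff ((lt_one_div_iff hb.le).mp hb')).mp hE
  · obtain ⟨h1, h2⟩ := hinner _ h
    have h3 := isGLB_mul_image ha h2
    rw [mul_innerBound ha.ne' h1] at h3
    rw [logModulusValues_eq_image ha.ne']
    convert h3 using 2
    · rw [abs_of_pos ha]
    · rw [sqrt_sq_sub ha.ne', abs_of_pos ha, mul_div_cancel₀ b ha.ne', mul_div_assoc', div_div]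
  · have h3 := isGLB_mul_image ha (houter _ h)
    rw [mul_outerBound ha.ne', abs_of_pos ha, abs_div b a, abs_of_pos ha,
      mul_div_cancel₀ |b| ha.ne'] at h3
    rwa [logModulusValues_eq_image ha.ne', abs_div b a, abs_of_pos ha]
  · obtain ⟨h1, h2⟩ := hinner _ h
    have h3 := isLUB_mul_image ha h2
    rw [mul_innerBound ha.ne h1] at h3
    rw [logModulusValues_eq_image ha.ne]
    convert h3 using 1
    have h4 : 3 * b / √(a ^ 2 - 8 * b ^ 2) = -(3 * (b / a) / √(1 - 8 * (b / a) ^ 2)) := by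
      rw [sqrt_sq_sub ha.ne, abs_of_neg ha, neg_mul, div_neg, mul_div_assoc', div_div]
    rw [h4, Real.arctan_neg, mul_div_cancel₀ b ha.ne]
    ring
  · have h3 := isLUB_mul_image ha (houter _ h)
    rw [mul_outerBound ha.ne] at h3
    rw [logModulusValues_eq_image ha.ne]
    convert h3 using 1
    have : a * |b / a| = -|b| := by
      rw [abs_div, abs_of_neg ha]
      have := ha.ne
      field_simp
    rw [this]
    ring
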